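/- For $n,d\ge 1$ and a kernel $K:[-1,1]\to[0,1]$, let $\mathsf{RGG}(n,d,K)$ denote the random graph on $[n]$ obtained by drawing $x_1,\dots,x_n$ independently and uniformly from the unit sphere $S^{d-1}\subset\mathbb{R}^d$ and then, conditionally on these points, connecting each pair $i<j$ independently with probability $K(\langle x_i,x_j\rangle)$. Let $\mathrm{TV}(n,d,K)$ be the total variation distance between $\mathsf{RGG}(n,d,K)$ and the Erdős–Rényi graph $G(n,\mathbb{E}[K(\langle x_1,x_2\rangle)])$ with the same edge density. **Theorem (linear kernel).** Let $p=p_n\in(0,\tfrac12)$ and $0<r=r_n\le p_n$ be sequences for which there is a constant $c>0$ with $r_n\ge c\sqrt{p_n/n}\,\log n$ for all sufficiently large $n$. Consider the linear kernel $K_n(t)=p_n+r_nt$, $t\in[-1,1]$. Then the critical dimension for detection is $$d_*(n)=\Big(\frac{n r_n^2}{p_n}\Big)^{3/4},$$ that is, for every sequence of dimensions $d=d_n\ge 1$, as $n\to\infty$: 1. if $d_n/d_*(n)\to 0$, then $\mathrm{TV}(n,d_n,K_n)\to 1$; 2. if $d_n/d_*(n)\to\infty$, then $\mathrm{TV}(n,d_n,K_n)\to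 0$. -/

import Mathlib

open MeasureTheory Filter Topology Asymptotics ProbabilityTheory

/-- The unit sphere `S^{d-1}` of the Euclidean space `ℝ^d`. -/
abbrev UnitSphere (d : ℕ) : Type := Metric.sphere (0 : EuclideanSpace ℝ (Fin d)) 1

/-- The uniform distribution on `S^{d-1}`: the surface measure, normalized to total mass one
(for `d ≥ 1`; for `d = 0` the sphere is empty and this is the zero measure). -/
noncomputable def sphereUniform (d : ℕ) : Measure (UnitSphere d) :=
  ((volume : Measure (EuclideanSpace ℝ (Fin d))).toSphere Set.univ)⁻¹ •
    (volume : Measure (EuclideanSpace ℝ (Fin d))).toSphere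

/-- A connection kernel `K : [-1,1] → [0,1]`. -/
abbrev RGGKernel : Type := Set.Icc (-1 : ℝ) 1 → unitInterval

/-- The inner product of two points of the unit sphere, as an element of `[-1,1]`. -/
noncomputable def sphereInner {d : ℕ} (x y : UnitSphere d) : Set.Icc (-1 : ℝ) 1 :=
  ⟨inner ℝ (x : EuclideanSpace ℝ (Fin d)) (y : EuclideanSpace ℝ (Fin d)), by
    have hx : ‖(x : EuclideanSpace ℝ (Fin d))‖ = 1 := mem_sphere_zero_iff_norm.mp x.2
    have hy : ‖(y : EuclideanSpace ℝ (Fin d))‖ = 1 := mem_sphere_zero_iff_norm.mp y.2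
    have h := abs_real_inner_le_norm (x : EuclideanSpace ℝ (Fin d))
      (y : EuclideanSpace ℝ (Fin d))
    rw [hx, hy, one_mul] at h
    exact abs_le.mp h⟩

open Classical in
/-- The conditional probability of the graph `G` given the latent points `x₁, …, xₙ`, when the pairs
`i < j` are connected independently, each with probability `K(⟨xᵢ, xⱼ⟩)`. -/
noncomputable def rggCondProb {n d : ℕ} (K : RGGKernel) (x : Fin n → UnitSphere d)
    (G : SimpleGraph (Fin n)) : ENNReal :=
  ∏ e : Fin n × Fin n with e.1 < e.2,
    if G.Adj e.1 e.2 then ENNReal.ofReal (K (sphereInner (x e.1) (x e.2)) : ℝ)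
    else ENNReal.ofReal (1 - (K (sphereInner (x e.1) (x e.2)) : ℝ))

open Classical in
/-- The law `RGG(n,d,K)` of the random geometric graph: the point mass at `G` is the average of the
conditional probability of `G` over independent uniform latent points. -/
noncomputable def rggLaw (n d : ℕ) (K : RGGKernel) : Measure (SimpleGraph (Fin n)) :=
  ∑ G : SimpleGraph (Fin n),
    (∫⁻ x, rggCondProb K x G ∂(Measure.pi fun _ : Fin n => sphereUniform d)) • Measure.dirac G

theorem sphereUniform_univ_le_one (d : ℕ) : sphereUniform d Set.univ ≤ 1 := by
  rw [sphereUniform, Measure.smul_apply, smul_eq_mul]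
  exact ENNReal.inv_mul_le_one _

/-- The edge density `E[K(⟨x₁, x₂⟩)]`, for independent uniform points `x₁, x₂` of `S^{d-1}`. -/
noncomputable def edgeDensity (d : ℕ) (K : RGGKernel) : unitInterval :=
  ⟨∫ x, ∫ y, (K (sphereInner x y) : ℝ) ∂(sphereUniform d) ∂(sphereUniform d), by
    have key : ∀ f : UnitSphere d → ℝ, (∀ x, 0 ≤ f x ∧ f x ≤ 1) →
        0 ≤ ∫ x, f x ∂(sphereUniform d) ∧ ∫ x, f x ∂(sphereUniform d) ≤ 1 := by
      intro f hf
      refine ⟨integral_nonneg fun x => (hf x).1, ?_⟩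
      by_cases hi : Integrable f (sphereUniform d)
      · have hfin : IsFiniteMeasure (sphereUniform d) := by
          exact ⟨(sphereUniform_univ_le_one d).trans_lt ENNReal.one_lt_top⟩
        calc ∫ x, f x ∂(sphereUniform d) ≤ ∫ _, (1 : ℝ) ∂(sphereUniform d) :=
              integral_mono hi (integrable_const _) fun x => (hf x).2
          _ = (sphereUniform d).real Set.univ := by simp
          _ ≤ 1 := ENNReal.toReal_le_of_le_ofReal zero_le_one (by
              simpa using sphereUniform_univ_le_one d)
      · rw [integral_undef hi]
        exact zero_le_one
    exact key _ fun x => key _ fun y => (K (sphereInner x y)).2⟩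

/-- The total variation distance `sup_S |μ(S) - ν(S)|` of two probability measures. -/
noncomputable def tvDist {Ω : Type*} [MeasurableSpace Ω] (μ ν : Measure Ω) : ℝ :=
  ⨆ S : {S : Set Ω // MeasurableSet S}, |μ.real S - ν.real S|

/-- The total variation distance between `RGG(n,d,K)` and the Erdős–Rényi graph `G(n,p)` with the
same edge density `p`. -/
noncomputable def rggTV (n d : ℕ) (K : RGGKernel) : ℝ :=
  tvDist (rggLaw n d K) (SimpleGraph.binomialRandom (Fin n) (edgeDensity d K))

/-- `dstar` is the critical dimension (sharp detection threshold) for the kernels `K n`: as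
`n → ∞`, the total variation distance tends to one if `d ≪ dstar`, and to zero if `d ≫ dstar`. -/
structure IsCriticalDimension (K : ℕ → RGGKernel) (dstar : ℕ → ℝ) : Prop where
  detectable : ∀ d : ℕ → ℕ, (∀ n, 1 ≤ d n) →
    (fun n => (d n : ℝ)) =o[atTop] dstar →
      Tendsto (fun n => rggTV n (d n) (K n)) atTop (𝓝 1)
  undetectable : ∀ d : ℕ → ℕ, (∀ n, 1 ≤ d n) →
    dstar =o[atTop] (fun n => (d n : ℝ)) →
      Tendsto (fun n => rggTV n (d n) (K n)) atTop (𝓝 0)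

/-!
The two regimes are separated by the signed number of triangles. Write `a = n r² / p`; the critical
dimension is `a ^ (3/4)`, and the lower bound on `r` makes `a` tend to infinity.

*Below the critical dimension* the signed triangles, with one vertex in each of three blocks of
about `n / 3` vertices, have mean of order `n³ r³ / d²` in the geometric graph and mean zero in the
Erdős–Rényi graph. Their variance is computed by contracting the latent points one at a time, with
`E ⟨u, x⟩⟨x, v⟩ = ⟨u, v⟩ / d`: two triangles without a common edge are uncorrelated, a common edge
costs `p r⁴ / d³`, and equal triangles cost `p³` (`integral_trianglePairMoment_le`). Chebyshev's
inequality under both laws gives `rggTV_ge_signedTriangles`.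

*Above the critical dimension* the total variation distance is bounded by the second moment of the
likelihood ratio, truncated to an event `A` of the latent points (`rggTV_le_truncated`). Given two
independent copies `x`, `y` of the latent points, with Gram matrices `S`, `S'`, this second moment is
the mean over `A × A` of `∏ (1 + λ S_ij S'_ij)`, where `λ = r² / (p (1 - p))`. The event `A` consists
of the points for which a few polynomials in the entries of `S` are at most a large constant times
their mean (`typicalPoints`). The product is expanded to third order inside the exponential, by
`1 + u ≤ exp (u - u²/2 + u³/3)`, and `x` is fixed.

* The linear term `λ ∑ S_ij S'_ij` is a quadratic form in `y`. By Jensen's inequality over the radii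
  of Gaussian vectors, its exponential moment is at most the one for Gaussian vectors, which is a
  power of a determinant (`integral_sphere_exp_gram_le`). Its leading term `λ² ∑ S_ij² / (2d)` is
  cancelled by the mean of the quadratic term, and the rest is controlled by `tr S⁴`.
* The centered quadratic term `-(λ²/2) ∑ S_ij² (S'_ij² - 1/d)` is a sum of martingale differences.
  A one-sided bound holds for its exponential moment without a restriction on its size, so that a
  predictable compensator turns it into a supermartingale
  (`integral_latent_exp_compensated_le_one`).
* The cubic term is bounded on `A × A`.

Hölder's inequality combines the parts, with an exponent close to one on the linear term. With
`ν = n λ / d ^ (4/3)` the truncated second moment is at most `exp (C κ ν²)`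
(`integral_typical_prod_le_exp`), where `κ` is the constant in the definition of `A`, and `ν → 0`
when `d` exceeds the critical dimension. The complement of `A` has probability `O(1/κ)`, and `κ` is
arbitrary.
-/

/-! ### The uniform measure on the sphere and the standard Gaussian measure -/

instance sphereUniform_isProbabilityMeasure (d : ℕ) [NeZero d] :
    IsProbabilityMeasure (sphereUniform d) := by
  have : Nontrivial (EuclideanSpace ℝ (Fin d)) := by
    have : Nonempty (Fin d) := ⟨0⟩
    infer_instance
  constructor
  rw [sphereUniform, Measure.smul_apply, smul_eq_mul]
  refine ENNReal.inv_mul_cancel ?_ (measure_ne_top _ _)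
  rw [Ne, Measure.measure_univ_eq_zero]
  exact Measure.toSphere_ne_zero _

/-- The density of the standard Gaussian measure, identified through its characteristic function. -/
theorem stdGaussian_eq_withDensity (d : ℕ) :
    stdGaussian (EuclideanSpace ℝ (Fin d)) =
      (volume : Measure (EuclideanSpace ℝ (Fin d))).withDensity
        (fun x => ENNReal.ofReal ((2 * Real.pi) ^ (-(d : ℝ) / 2) * Real.exp (-‖x‖ ^ 2 / 2))) := by
  set E := EuclideanSpace ℝ (Fin d)
  have hint : Integrable (fun x : E =>
      (2 * Real.pi) ^ (-(d : ℝ) / 2) * Real.exp (-‖x‖ ^ 2 / 2)) := by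
    have h := GaussianFourier.integrable_cexp_neg_mul_sq_norm_add (V := E) (b := (1 / 2 : ℂ))
      (by norm_num) 0 0
    refine (h.norm.congr ?_).const_mul _
    refine Eventually.of_forall fun x => ?_
    simp only [Complex.norm_exp]
    congr 1
    simp [← Complex.ofReal_pow]
    ring
  have : IsFiniteMeasure ((volume : Measure E).withDensity
      (fun x => ENNReal.ofReal ((2 * Real.pi) ^ (-(d : ℝ) / 2) * Real.exp (-‖x‖ ^ 2 / 2)))) :=
    isFiniteMeasure_withDensity_ofReal hint.2
  apply Measure.ext_of_charFun
  ext t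
  rw [charFun_stdGaussian, charFun_apply, integral_withDensity_eq_integral_toReal_smul
    (by fun_prop) (by simp)]
  have h := GaussianFourier.integral_cexp_neg_mul_sq_norm_add (V := E) (b := (1 / 2 : ℂ))
      (by norm_num) Complex.I t
  have h2 : ∀ x : E, (ENNReal.ofReal ((2 * Real.pi) ^ (-(d : ℝ) / 2)
        * Real.exp (-‖x‖ ^ 2 / 2))).toReal • Complex.exp ((inner ℝ x t : ℝ) * Complex.I)
      = (((2 * Real.pi) ^ (-(d : ℝ) / 2) : ℝ) : ℂ) *
        Complex.exp (-(1 / 2) * ‖x‖ ^ 2 + Complex.I * (inner ℝ t x : ℝ)) := by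
    intro x
    rw [ENNReal.toReal_ofReal (by positivity), Complex.real_smul, Complex.ofReal_mul, mul_assoc,
      Complex.ofReal_exp, ← Complex.exp_add, real_inner_comm]
    congr 2
    push_cast
    ring
  simp_rw [h2]
  rw [integral_const_mul, h]
  have h3 : ((Real.pi : ℂ) / (1 / 2)) ^ ((Module.finrank ℝ E : ℂ) / 2)
      = (((2 * Real.pi) ^ ((d : ℝ) / 2) : ℝ) : ℂ) := by
    rw [Complex.ofReal_cpow (by positivity)]
    simp [E]
    ring_nf
  rw [h3, ← mul_assoc, ← Complex.ofReal_mul, ← Real.rpow_add (by positivity),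
    show -(d : ℝ) / 2 + (d : ℝ) / 2 = 0 by ring, Real.rpow_zero, Complex.ofReal_one, one_mul,
    Complex.I_sq]
  congr 1
  ring

theorem lintegral_polar (d : ℕ) [NeZero d] (F : EuclideanSpace ℝ (Fin d) → ENNReal)
    (hF : Measurable F) :
    ∫⁻ x, F x = ∫⁻ z : UnitSphere d × Set.Ioi (0 : ℝ), F (z.2.1 • z.1.1)
      ∂((volume : Measure (EuclideanSpace ℝ (Fin d))).toSphere.prod
        (Measure.volumeIoiPow (d - 1))) := by
  have : Nontrivial (EuclideanSpace ℝ (Fin d)) := by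
    have : Nonempty (Fin d) := ⟨0⟩
    infer_instance
  have h := (volume : Measure (EuclideanSpace ℝ (Fin d))).measurePreserving_homeomorphUnitSphereProd
  simp only [finrank_euclideanSpace, Fintype.card_fin] at h
  have h2 := h.symm (homeomorphUnitSphereProd (EuclideanSpace ℝ (Fin d))).toMeasurableEquiv
  have h3 := h2.lintegral_comp (f := fun x => F x.1) (hF.comp measurable_subtype_coe)
  have h4 : ∫⁻ x, F x = ∫⁻ x : ({0}ᶜ : Set (EuclideanSpace ℝ (Fin d))), F x.1
      ∂(Measure.comap Subtype.val volume) := by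
    rw [lintegral_subtype_comap (measurableSet_singleton _).compl F, restrict_compl_singleton]
  rw [h4, ← h3]
  rfl

/-- A standard Gaussian vector is a uniform point of the sphere, scaled by an independent positive
radius. -/
theorem exists_radial_law (d : ℕ) [NeZero d] :
    ∃ ν : Measure ℝ, IsProbabilityMeasure ν ∧ (∀ᵐ ρ ∂ν, 0 < ρ) ∧
      ((sphereUniform d).prod ν).map (fun z => z.2 • (z.1 : EuclideanSpace ℝ (Fin d))) =
        stdGaussian (EuclideanSpace ℝ (Fin d)) := by
  set E := EuclideanSpace ℝ (Fin d)
  set A : ENNReal := (volume : Measure E).toSphere Set.univ with hA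
  have : Nontrivial (EuclideanSpace ℝ (Fin d)) := by
    have : Nonempty (Fin d) := ⟨0⟩
    infer_instance
  have hA0 : A ≠ 0 := by
    rw [hA, Ne, Measure.measure_univ_eq_zero]
    exact Measure.toSphere_ne_zero _
  have hAt : A ≠ ⊤ := measure_ne_top _ _
  set w : ℝ → ENNReal := fun ρ =>
    ENNReal.ofReal ((2 * Real.pi) ^ (-(d : ℝ) / 2) * Real.exp (-ρ ^ 2 / 2)) with hw
  have hwm : Measurable w := by fun_prop
  set ν : Measure ℝ := (A • (Measure.volumeIoiPow (d - 1)).withDensity (fun ρ => w ρ.1)).map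
    Subtype.val with hν
  have : SFinite ν := by rw [hν]; infer_instance
  have key : ∀ F : E → ENNReal, Measurable F →
      ∫⁻ x, F x ∂(stdGaussian E) = ∫⁻ z, F (z.2 • (z.1 : E)) ∂((sphereUniform d).prod ν) := by
    intro F hF
    have hsm : Measurable (fun z : UnitSphere d × ℝ => F (z.2 • (z.1 : E))) :=
      hF.comp (by fun_prop)
    have hsm2 : Measurable (fun z : UnitSphere d × Set.Ioi (0:ℝ) => F (z.2.1 • (z.1 : E))) :=
      hF.comp (by fun_prop)
    rw [stdGaussian_eq_withDensity, lintegral_withDensity_eq_lintegral_mul _ (by fun_prop) hF,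
      lintegral_polar d _ (by fun_prop), lintegral_prod _ (by fun_prop),
      lintegral_prod _ hsm.aemeasurable, sphereUniform, lintegral_smul_measure, smul_eq_mul,
      ← lintegral_const_mul' _ _ (ENNReal.inv_ne_top.2 hA0)]
    refine lintegral_congr fun x => ?_
    rw [hν, lintegral_map (by fun_prop) measurable_subtype_coe, lintegral_smul_measure,
      smul_eq_mul, ← mul_assoc, ENNReal.inv_mul_cancel hA0 hAt, one_mul,
      lintegral_withDensity_eq_lintegral_mul _ (by fun_prop) (by fun_prop)]
    refine lintegral_congr fun ρ => ?_
    have : ‖ρ.1 • (x : E)‖ = ρ.1 := by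
      rw [norm_smul, mem_sphere_zero_iff_norm.mp x.2, mul_one, Real.norm_of_nonneg ρ.2.le]
    simp [hw, this]
  refine ⟨ν, ⟨?_⟩, ?_, ?_⟩
  · have h := key (fun _ => 1) measurable_const
    simp only [lintegral_const, measure_univ, mul_one] at h
    rw [← Set.univ_prod_univ, Measure.prod_prod, measure_univ, one_mul] at h
    rw [one_mul] at h
    exact h.symm
  · rw [hν, ae_map_iff measurable_subtype_coe.aemeasurable
      (measurableSet_lt measurable_const measurable_id : MeasurableSet {ρ : ℝ | 0 < ρ})]
    exact Eventually.of_forall fun x => x.2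
  · refine Measure.ext_of_lintegral _ fun F hF => ?_
    rw [lintegral_map hF (by fun_prop), key F hF]

/-- The law of the norm of a standard Gaussian vector of `ℝ^d`. -/
noncomputable def radialLaw (d : ℕ) : Measure ℝ :=
  (stdGaussian (EuclideanSpace ℝ (Fin d))).map norm

instance radialLaw_isProbabilityMeasure (d : ℕ) : IsProbabilityMeasure (radialLaw d) :=
  Measure.isProbabilityMeasure_map measurable_norm.aemeasurable

theorem sphereUniform_prod_radialLaw_map (d : ℕ) [NeZero d] :
    ((sphereUniform d).prod (radialLaw d)).map
        (fun z => z.2 • (z.1 : EuclideanSpace ℝ (Fin d))) =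
      stdGaussian (EuclideanSpace ℝ (Fin d)) := by
  obtain ⟨ν, hν, hpos, hmap⟩ := exists_radial_law d
  suffices h : radialLaw d = ν by rw [h, hmap]
  rw [radialLaw, ← hmap, Measure.map_map measurable_norm (by fun_prop)]
  have h1 : (norm ∘ fun z : UnitSphere d × ℝ => z.2 • (z.1 : EuclideanSpace ℝ (Fin d)))
      =ᵐ[(sphereUniform d).prod ν] Prod.snd := by
    have h2 : ∀ᵐ z ∂((sphereUniform d).prod ν), 0 < z.2 :=
      Measure.quasiMeasurePreserving_snd.ae hpos
    filter_upwards [h2] with z hz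
    rw [Function.comp_apply, norm_smul, mem_sphere_zero_iff_norm.mp z.1.2, mul_one,
      Real.norm_of_nonneg hz.le]
  rw [Measure.map_congr h1, Measure.map_snd_prod, measure_univ, one_smul]

theorem integral_stdGaussian_polar (d : ℕ) [NeZero d] (f : EuclideanSpace ℝ (Fin d) → ℝ)
    (hf : Measurable f) :
    ∫ x, f x ∂(stdGaussian (EuclideanSpace ℝ (Fin d))) =
      ∫ z, f (z.2 • (z.1 : EuclideanSpace ℝ (Fin d))) ∂((sphereUniform d).prod (radialLaw d)) := by
  rw [← sphereUniform_prod_radialLaw_map, integral_map (by fun_prop)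
    hf.aestronglyMeasurable]

theorem stdGaussian_map_inner (d : ℕ) (v : EuclideanSpace ℝ (Fin d)) (hv : ‖v‖ = 1) :
    (stdGaussian (EuclideanSpace ℝ (Fin d))).map (fun x => (inner ℝ v x : ℝ)) =
      gaussianReal 0 1 := by
  have h := IsGaussian.map_eq_gaussianReal (μ := stdGaussian (EuclideanSpace ℝ (Fin d)))
    (innerSL ℝ v)
  rw [integral_strongDual_stdGaussian, variance_dual_stdGaussian, innerSL_apply_norm, hv] at h
  simpa using h

theorem integral_inner_pow_stdGaussian (d k : ℕ) (v : EuclideanSpace ℝ (Fin d)) (hv : ‖v‖ = 1) :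
    ∫ x, (inner ℝ v x : ℝ) ^ k ∂(stdGaussian (EuclideanSpace ℝ (Fin d))) =
      ∫ t, t ^ k ∂(gaussianReal 0 1) := by
  rw [← stdGaussian_map_inner d v hv, integral_map (by fun_prop)
    (by fun_prop : Continuous fun t : ℝ => t ^ k).aestronglyMeasurable]

theorem integral_inner_pow_mul_radial (d k : ℕ) [NeZero d] (v : EuclideanSpace ℝ (Fin d)) :
    (∫ x, (inner ℝ v (x : EuclideanSpace ℝ (Fin d)) : ℝ) ^ k ∂(sphereUniform d)) *
      ∫ ρ, ρ ^ k ∂(radialLaw d) =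
    ∫ x, (inner ℝ v x : ℝ) ^ k ∂(stdGaussian (EuclideanSpace ℝ (Fin d))) := by
  rw [integral_stdGaussian_polar _ _ (by fun_prop), ← integral_prod_mul]
  refine integral_congr_ae (Eventually.of_forall fun z => ?_)
  simp only [inner_smul_right, mul_pow]
  ring

theorem integrable_pow_gaussianReal (k : ℕ) :
    Integrable (fun t : ℝ => t ^ k) (gaussianReal 0 1) := by
  have h := (memLp_id_gaussianReal (μ := 0) (v := 1) k).integrable_norm_pow'
  refine (integrable_norm_iff (by fun_prop)).1 (h.congr (Eventually.of_forall fun t => ?_))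
  simp

theorem integral_sq_gaussianReal : ∫ t, t ^ 2 ∂(gaussianReal 0 1) = 1 := by
  have h := variance_id_gaussianReal (μ := 0) (v := 1)
  rw [variance_eq_integral (by fun_prop)] at h
  simpa using h

theorem stdGaussian_eq_map_pi (d : ℕ) :
    stdGaussian (EuclideanSpace ℝ (Fin d)) =
      (Measure.pi (fun _ : Fin d => gaussianReal 0 1)).map (WithLp.toLp 2) :=
  map_pi_eq_stdGaussian.symm

/-- The variance of the square of a standard Gaussian variable. -/
noncomputable def gaussianSqVar : ℝ := Var[fun t : ℝ => t ^ 2; gaussianReal 0 1]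

theorem gaussianSqVar_nonneg : 0 ≤ gaussianSqVar := variance_nonneg _ _

theorem memLp_sq_gaussianReal : MemLp (fun t : ℝ => t ^ 2) 2 (gaussianReal 0 1) := by
  rw [memLp_two_iff_integrable_sq (by fun_prop)]
  refine (integrable_pow_gaussianReal 4).congr (Eventually.of_forall fun t => ?_)
  simp only
  ring

theorem integrable_radialLaw_pow (d k : ℕ) : Integrable (fun ρ : ℝ => ρ ^ k) (radialLaw d) := by
  rw [radialLaw, integrable_map_measure (by fun_prop) (by fun_prop)]
  exact (IsGaussian.memLp_id (stdGaussian (EuclideanSpace ℝ (Fin d))) k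
    (by simp)).integrable_norm_pow'

theorem integral_radialLaw_sq (d : ℕ) : ∫ ρ, ρ ^ 2 ∂(radialLaw d) = d := by
  rw [radialLaw, integral_map (by fun_prop) (by fun_prop), stdGaussian_eq_map_pi,
    integral_map (by fun_prop) (by fun_prop)]
  simp_rw [EuclideanSpace.real_norm_sq_eq]
  rw [integral_finsetSum]
  · have : ∀ i : Fin d, ∫ a, (WithLp.toLp 2 a : EuclideanSpace ℝ (Fin d)) i ^ 2
        ∂(Measure.pi (fun _ : Fin d => gaussianReal 0 1)) = 1 := by
      intro i
      have h := integral_comp_eval (μ := fun _ : Fin d => gaussianReal 0 1) (i := i)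
        (f := fun t : ℝ => t ^ 2) (by fun_prop)
      simpa [integral_sq_gaussianReal] using h
    simp [this]
  · intro i _
    exact integrable_comp_eval (μ := fun _ : Fin d => gaussianReal 0 1) (i := i)
      (f := fun t : ℝ => t ^ 2) (integrable_pow_gaussianReal 2)

theorem integral_radialLaw_pow_four (d : ℕ) :
    ∫ ρ, ρ ^ 4 ∂(radialLaw d) = d ^ 2 + d * gaussianSqVar := by
  have h0 := integral_radialLaw_sq d
  have hv : Var[fun ρ : ℝ => ρ ^ 2; radialLaw d] = d * gaussianSqVar := by
    rw [radialLaw, variance_map (by fun_prop) (by fun_prop), stdGaussian_eq_map_pi,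
      variance_map (by fun_prop) (by fun_prop)]
    have h1 : ((fun ρ : ℝ => ρ ^ 2) ∘ norm) ∘ (WithLp.toLp 2 : (Fin d → ℝ) → EuclideanSpace ℝ (Fin d))
        = ∑ i : Fin d, fun a : Fin d → ℝ => (fun t : ℝ => t ^ 2) (a i) := by
      ext a
      simp [EuclideanSpace.real_norm_sq_eq]
    rw [h1, variance_sum_pi (μ := fun _ : Fin d => gaussianReal 0 1)
      (X := fun _ => fun t : ℝ => t ^ 2) fun _ => memLp_sq_gaussianReal]
    simp [gaussianSqVar]
  rw [variance_eq_sub] at hv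
  · rw [h0] at hv
    have h2 : ∫ ρ, ρ ^ 4 ∂(radialLaw d) = (radialLaw d)[(fun ρ : ℝ => ρ ^ 2) ^ 2] := by
      refine integral_congr_ae (Eventually.of_forall fun ρ => ?_)
      simp only [Pi.pow_apply]
      ring
    rw [h2]
    linarith
  · rw [memLp_two_iff_integrable_sq (by fun_prop)]
    refine (integrable_radialLaw_pow d 4).congr (Eventually.of_forall fun t => ?_)
    simp only
    ring

theorem radialLaw_nonneg (d : ℕ) : ∀ᵐ ρ ∂(radialLaw d), 0 ≤ ρ := by
  rw [radialLaw, ae_map_iff (by fun_prop)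
    (measurableSet_le measurable_const measurable_id : MeasurableSet {ρ : ℝ | 0 ≤ ρ})]
  exact Eventually.of_forall fun x => norm_nonneg x

/-- The mean radius is at least `√d (1 - V / (2d))`, as the polynomial
`u - (3/2) u² + (1/2) u⁴ = (1/2) u (u - 1)² (u + 2)` is nonnegative for `u ≥ 0`. -/
theorem integral_radialLaw_ge (d : ℕ) [NeZero d] :
    Real.sqrt d * (1 - gaussianSqVar / (2 * d)) ≤ ∫ ρ, ρ ∂(radialLaw d) := by
  have hd : (0 : ℝ) < d := Nat.cast_pos.2 (NeZero.pos d)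
  have hs : 0 < Real.sqrt d := Real.sqrt_pos.2 hd
  have hsq : Real.sqrt d ^ 2 = d := Real.sq_sqrt hd.le
  have h1 : ∫ ρ, (Real.sqrt d * (3 / 2 * (ρ ^ 2 / d) - 1 / 2 * (ρ ^ 4 / d ^ 2))) ∂(radialLaw d) ≤
      ∫ ρ, ρ ∂(radialLaw d) := by
    refine integral_mono_ae ?_ (by simpa using integrable_radialLaw_pow d 1) ?_
    · exact ((((integrable_radialLaw_pow d 2).div_const _).const_mul _).sub
        (((integrable_radialLaw_pow d 4).div_const _).const_mul _)).const_mul _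
    · filter_upwards [radialLaw_nonneg d] with ρ hρ
      set u := ρ / Real.sqrt d with hu
      have hρu : ρ = Real.sqrt d * u := by rw [hu]; field_simp
      have hu0 : 0 ≤ u := by positivity
      have e1 : ρ ^ 2 / d = u ^ 2 := by rw [hu, div_pow, hsq]
      have e2 : ρ ^ 4 / (d : ℝ) ^ 2 = u ^ 4 := by
        rw [← hsq, hu, div_pow, ← pow_mul]
      rw [e1, e2]
      refine le_of_le_of_eq (mul_le_mul_of_nonneg_left ?_ hs.le) hρu.symm
      nlinarith [mul_nonneg (mul_nonneg hu0 (sq_nonneg (u - 1))) (by linarith : 0 ≤ u + 2)]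
  refine le_trans (le_of_eq ?_) h1
  rw [integral_const_mul, integral_sub, integral_const_mul, integral_const_mul, integral_div,
    integral_div, integral_radialLaw_sq, integral_radialLaw_pow_four]
  · field_simp
    ring
  · exact ((integrable_radialLaw_pow d 2).div_const _).const_mul _
  · exact ((integrable_radialLaw_pow d 4).div_const _).const_mul _

theorem integral_radialLaw_pos (d : ℕ) [NeZero d] : 0 < ∫ ρ, ρ ∂(radialLaw d) := by
  rw [integral_pos_iff_support_of_nonneg_ae (radialLaw_nonneg d)
    (by simpa using integrable_radialLaw_pow d 1)]
  rw [pos_iff_ne_zero]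
  intro h
  have h2 := integral_radialLaw_sq d
  have h3 : ∫ ρ, ρ ^ 2 ∂(radialLaw d) = 0 := by
    refine integral_eq_zero_of_ae ?_
    have : ∀ᵐ ρ ∂(radialLaw d), ρ = 0 := by
      rw [ae_iff]
      exact h
    filter_upwards [this] with ρ hρ
    simp [hρ]
  rw [h3] at h2
  exact NeZero.ne d (by exact_mod_cast h2.symm)

/-- Jensen's inequality for the even moments of the radius. -/
theorem pow_le_integral_radialLaw_pow (d k : ℕ) :
    (d : ℝ) ^ k ≤ ∫ ρ, ρ ^ (2 * k) ∂(radialLaw d) := by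
  have h := (convexOn_pow (𝕜 := ℝ) k).map_integral_le (μ := radialLaw d) (f := fun ρ : ℝ => ρ ^ 2)
    (by fun_prop) isClosed_Ici (Eventually.of_forall fun ρ => sq_nonneg ρ)
    (integrable_radialLaw_pow d 2) ?_
  · rw [integral_radialLaw_sq] at h
    simpa [Function.comp_def, ← pow_mul] using h
  · simpa [Function.comp_def, ← pow_mul] using integrable_radialLaw_pow d (2 * k)

/-! ### Moments of the uniform measure on the sphere -/

theorem integral_sphere_inner (d : ℕ) [NeZero d] (v : EuclideanSpace ℝ (Fin d)) :
    ∫ x, (inner ℝ v (x : EuclideanSpace ℝ (Fin d)) : ℝ) ∂(sphereUniform d) = 0 := by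
  have h := integral_inner_pow_mul_radial d 1 v
  simp only [pow_one] at h
  have h2 : ∫ x, (inner ℝ v x : ℝ) ∂(stdGaussian (EuclideanSpace ℝ (Fin d))) = 0 := by
    simpa using integral_strongDual_stdGaussian (innerSL ℝ v)
  rw [h2] at h
  exact (mul_eq_zero.1 h).resolve_right (integral_radialLaw_pos d).ne'

theorem norm_coe_unitSphere {d : ℕ} (x : UnitSphere d) :
    ‖(x : EuclideanSpace ℝ (Fin d))‖ = 1 := mem_sphere_zero_iff_norm.mp x.2

theorem integral_sphere_inner_sq (d : ℕ) [NeZero d] (v : EuclideanSpace ℝ (Fin d)) :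
    ∫ x, (inner ℝ v (x : EuclideanSpace ℝ (Fin d)) : ℝ) ^ 2 ∂(sphereUniform d) = ‖v‖ ^ 2 / d := by
  have hd : (d : ℝ) ≠ 0 := Nat.cast_ne_zero.2 (NeZero.ne d)
  rcases eq_or_ne v 0 with rfl | hv
  · simp
  have hn : ‖v‖ ≠ 0 := norm_ne_zero_iff.2 hv
  have h := integral_inner_pow_mul_radial d 2 (‖v‖⁻¹ • v)
  rw [integral_radialLaw_sq, integral_inner_pow_stdGaussian _ _ _ (by simp [norm_smul, hn]),
    integral_sq_gaussianReal] at h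
  simp only [real_inner_smul_left, mul_pow, integral_const_mul] at h
  field_simp at h ⊢
  exact h

theorem integrable_of_continuous_compact {α : Type*} [TopologicalSpace α] [CompactSpace α]
    [MeasurableSpace α] [OpensMeasurableSpace α] {μ : Measure α} [IsFiniteMeasure μ]
    {f : α → ℝ} (hf : Continuous f) : Integrable f μ := by
  obtain ⟨C, hC⟩ := isCompact_univ.exists_bound_of_continuousOn hf.continuousOn
  exact Integrable.of_bound (hf.measurable.aestronglyMeasurable) C
    (Eventually.of_forall fun x => hC x trivial)

theorem integral_sphere_inner_mul_inner (d : ℕ) [NeZero d] (v w : EuclideanSpace ℝ (Fin d)) :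
    ∫ x, (inner ℝ v (x : EuclideanSpace ℝ (Fin d)) : ℝ) *
      inner ℝ (x : EuclideanSpace ℝ (Fin d)) w ∂(sphereUniform d) = inner ℝ v w / d := by
  have h1 := integral_sphere_inner_sq d (v + w)
  have h2 := integral_sphere_inner_sq d (v - w)
  have h3 : ∀ x : UnitSphere d, (inner ℝ v (x : EuclideanSpace ℝ (Fin d)) : ℝ) *
      inner ℝ (x : EuclideanSpace ℝ (Fin d)) w =
      1 / 4 * ((inner ℝ (v + w) (x : EuclideanSpace ℝ (Fin d)) : ℝ) ^ 2 -
        (inner ℝ (v - w) (x : EuclideanSpace ℝ (Fin d)) : ℝ) ^ 2) := by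
    intro x
    rw [inner_add_left, inner_sub_left, real_inner_comm w]
    ring
  simp_rw [h3]
  rw [integral_const_mul, integral_sub, h1, h2, norm_add_sq_real, norm_sub_sq_real]
  · ring
  · exact integrable_of_continuous_compact (by fun_prop)
  · exact integrable_of_continuous_compact (by fun_prop)

/-- The even moments of a coordinate on the sphere are at most Gaussian, since the radius of a
Gaussian vector is independent of its direction. -/
theorem integral_sphere_inner_pow_le (d k : ℕ) [NeZero d] (v : EuclideanSpace ℝ (Fin d))
    (hv : ‖v‖ = 1) :
    ∫ x, (inner ℝ v (x : EuclideanSpace ℝ (Fin d)) : ℝ) ^ (2 * k) ∂(sphereUniform d) ≤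
      (∫ t, t ^ (2 * k) ∂(gaussianReal 0 1)) / d ^ k := by
  have hd : (0 : ℝ) < d := Nat.cast_pos.2 (NeZero.pos d)
  have h := integral_inner_pow_mul_radial d (2 * k) v
  rw [integral_inner_pow_stdGaussian _ _ _ hv] at h
  rw [le_div_iff₀ (by positivity), ← h]
  refine mul_le_mul_of_nonneg_left (pow_le_integral_radialLaw_pow d k) ?_
  refine integral_nonneg fun x => ?_
  rw [pow_mul]
  positivity

/-! ### Exponential moments of Gaussian quadratic forms -/

theorem integrable_exp_sq_gaussianReal {b : ℝ} (hb : b < 1) :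
    Integrable (fun t : ℝ => Real.exp (b * t ^ 2 / 2)) (gaussianReal 0 1) := by
  rw [gaussianReal_of_var_ne_zero _ one_ne_zero, integrable_withDensity_iff
    (measurable_gaussianPDF 0 1) (Eventually.of_forall fun x => gaussianPDF_lt_top)]
  have h := (integrable_exp_neg_mul_sq (b := (1 - b) / 2) (by linarith)).const_mul
    (Real.sqrt (2 * Real.pi))⁻¹
  refine h.congr (Eventually.of_forall fun t => ?_)
  simp only [toReal_gaussianPDF, gaussianPDFReal, NNReal.coe_one, mul_one, sub_zero]
  rw [mul_left_comm, ← Real.exp_add]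
  congr 2
  ring

theorem integral_exp_sq_gaussianReal {b : ℝ} (hb : b < 1) :
    ∫ t, Real.exp (b * t ^ 2 / 2) ∂(gaussianReal 0 1) = (Real.sqrt (1 - b))⁻¹ := by
  rw [integral_gaussianReal_eq_integral_smul one_ne_zero]
  have h : ∀ t : ℝ, gaussianPDFReal 0 1 t • Real.exp (b * t ^ 2 / 2) =
      (Real.sqrt (2 * Real.pi))⁻¹ * Real.exp (-((1 - b) / 2) * t ^ 2) := by
    intro t
    simp only [gaussianPDFReal, NNReal.coe_one, mul_one, sub_zero, smul_eq_mul]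
    rw [mul_assoc, ← Real.exp_add]
    congr 2
    ring
  simp_rw [h]
  rw [integral_const_mul, integral_gaussian, ← Real.sqrt_inv, ← Real.sqrt_mul (by positivity),
    ← Real.sqrt_inv]
  congr 1
  have : 1 - b ≠ 0 := by linarith
  field_simp

theorem inv_sqrt_one_sub_le {b : ℝ} (hb : |b| ≤ 1 / 2) :
    (Real.sqrt (1 - b))⁻¹ ≤ Real.exp (b / 2 + b ^ 2 / 4 + |b| ^ 3) := by
  have hb2 := abs_le.1 hb
  have hpos : 0 < 1 - b := by linarith
  have h := Real.abs_log_sub_add_sum_range_le (x := b) (by linarith) 2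
  have h1 : |b| ^ 3 / (1 - |b|) ≤ 2 * |b| ^ 3 := by
    rw [div_le_iff₀ (by linarith)]
    nlinarith [pow_nonneg (abs_nonneg b) 3]
  simp only [Finset.sum_range_succ, Finset.sum_range_zero] at h
  norm_num at h
  have h2 := (abs_le.1 h).1
  have h3 : (Real.sqrt (1 - b))⁻¹ = Real.exp (-(Real.log (1 - b)) / 2) := by
    rw [neg_div, Real.exp_neg, ← Real.log_sqrt hpos.le, Real.exp_log (Real.sqrt_pos.2 hpos)]
  rw [h3]
  refine Real.exp_le_exp.2 ?_
  linarith

theorem inv_sqrt_one_sub_le_of_nonpos {b : ℝ} (hb : b ≤ 0) :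
    (Real.sqrt (1 - b))⁻¹ ≤ Real.exp (b / 2 + b ^ 2 / 4) := by
  have hpos : 0 < 1 - b := by linarith
  have h3 : (Real.sqrt (1 - b))⁻¹ = Real.exp (-(Real.log (1 - b)) / 2) := by
    rw [neg_div, Real.exp_neg, ← Real.log_sqrt hpos.le, Real.exp_log (Real.sqrt_pos.2 hpos)]
  rw [h3]
  refine Real.exp_le_exp.2 ?_
  have h := Real.le_log_one_add_of_nonneg (x := -b) (by linarith)
  have h4 : -b - b ^ 2 / 2 ≤ 2 * -b / (-b + 2) := by
    rw [le_div_iff₀ (by linarith)]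
    nlinarith [pow_nonneg (neg_nonneg.2 hb) 3]
  rw [show (1 : ℝ) + -b = 1 - b by ring] at h
  linarith

section Matrix

variable {ι : Type*} [Fintype ι] [DecidableEq ι] {B : Matrix ι ι ℝ}

theorem Matrix.IsHermitian.trace_pow_eq_sum_eigenvalues_pow (hB : B.IsHermitian) (k : ℕ) :
    (B ^ k).trace = ∑ a, hB.eigenvalues a ^ k := by
  conv_lhs => rw [hB.spectral_theorem, ← map_pow, Unitary.conjStarAlgAut_apply,
    Matrix.trace_mul_cycle]
  simp [Matrix.diagonal_pow, Matrix.trace]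

theorem Matrix.IsHermitian.quadratic_form_eigenvectorBasis (hB : B.IsHermitian) (x : ι → ℝ) :
    ∑ i, ∑ j, B i j * (∑ a, x a • hB.eigenvectorBasis a : EuclideanSpace ℝ ι) i *
      (∑ a, x a • hB.eigenvectorBasis a : EuclideanSpace ℝ ι) j =
      ∑ a, hB.eigenvalues a * x a ^ 2 := by
  set g : EuclideanSpace ℝ ι := ∑ a, x a • hB.eigenvectorBasis a with hg
  have h1 : B.mulVec (WithLp.ofLp g) =
      WithLp.ofLp (∑ a, (hB.eigenvalues a * x a) • hB.eigenvectorBasis a) := by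
    rw [hg]
    simp only [WithLp.ofLp_sum, WithLp.ofLp_smul, Matrix.mulVec_sum, Matrix.mulVec_smul,
      hB.mulVec_eigenvectorBasis]
    refine Finset.sum_congr rfl fun a _ => ?_
    rw [smul_smul, mul_comm]
  have h2 : ∑ i, ∑ j, B i j * g i * g j = inner ℝ g
      (∑ a, (hB.eigenvalues a * x a) • hB.eigenvectorBasis a) := by
    rw [PiLp.inner_apply]
    refine Finset.sum_congr rfl fun i _ => ?_
    rw [← h1]
    simp only [Matrix.mulVec, dotProduct, RCLike.inner_apply, conj_trivial, Finset.sum_mul]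
    refine Finset.sum_congr rfl fun j _ => ?_
    ring
  rw [h2, hg, sum_inner]
  simp only [inner_sum, real_inner_smul_left, real_inner_smul_right,
    orthonormal_iff_ite.1 hB.eigenvectorBasis.orthonormal]
  refine Finset.sum_congr rfl fun a _ => ?_
  simp
  ring

theorem stdGaussian_eq_map_eigenvectorBasis (hB : B.IsHermitian) :
    stdGaussian (EuclideanSpace ℝ ι) =
      (Measure.pi fun _ : ι => gaussianReal 0 1).map
        (fun x => ∑ a, x a • hB.eigenvectorBasis a) :=
  stdGaussian_eq_map_pi_orthonormalBasis hB.eigenvectorBasis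

theorem exp_quadratic_form_eigenvectorBasis (hB : B.IsHermitian) (x : ι → ℝ) :
    Real.exp ((∑ i, ∑ j, B i j * (∑ a, x a • hB.eigenvectorBasis a : EuclideanSpace ℝ ι) i *
      (∑ a, x a • hB.eigenvectorBasis a : EuclideanSpace ℝ ι) j) / 2) =
      ∏ a, Real.exp (hB.eigenvalues a * x a ^ 2 / 2) := by
  rw [hB.quadratic_form_eigenvectorBasis, Finset.sum_div, Real.exp_sum]

theorem integrable_exp_quadratic_form (hB : B.IsHermitian) (hlt : ∀ a, hB.eigenvalues a < 1) :
    Integrable (fun g : EuclideanSpace ℝ ι => Real.exp ((∑ i, ∑ j, B i j * g i * g j) / 2))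
      (stdGaussian (EuclideanSpace ℝ ι)) := by
  have hm : Continuous fun x : ι → ℝ => ∑ a, x a • hB.eigenvectorBasis a := by fun_prop
  rw [stdGaussian_eq_map_eigenvectorBasis hB, integrable_map_measure (by fun_prop)
    hm.measurable.aemeasurable]
  simp only [Function.comp_def, exp_quadratic_form_eigenvectorBasis hB]
  exact Integrable.fintype_prod (f := fun a t => Real.exp (hB.eigenvalues a * t ^ 2 / 2))
    fun a => integrable_exp_sq_gaussianReal (hlt a)

theorem integral_exp_quadratic_form (hB : B.IsHermitian) (hlt : ∀ a, hB.eigenvalues a < 1) :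
    ∫ g, Real.exp ((∑ i, ∑ j, B i j * g i * g j) / 2) ∂(stdGaussian (EuclideanSpace ℝ ι)) =
      ∏ a, (Real.sqrt (1 - hB.eigenvalues a))⁻¹ := by
  have hm : Continuous fun x : ι → ℝ => ∑ a, x a • hB.eigenvectorBasis a := by fun_prop
  rw [stdGaussian_eq_map_eigenvectorBasis hB, integral_map hm.measurable.aemeasurable
    (by fun_prop)]
  simp only [exp_quadratic_form_eigenvectorBasis hB]
  rw [integral_fintype_prod_eq_prod (f := fun a t => Real.exp (hB.eigenvalues a * t ^ 2 / 2))]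
  exact Finset.prod_congr rfl fun a _ => integral_exp_sq_gaussianReal (hlt a)

end Matrix

/-- Exchanging rows and columns preserves a product of identical measures. -/
theorem measurePreserving_transpose {ι κ X : Type*} [Fintype ι] [Fintype κ] [MeasurableSpace X]
    (μ : Measure X) [IsProbabilityMeasure μ] :
    MeasurePreserving (fun (z : ι → κ → X) (k : κ) (i : ι) => z i k)
      (Measure.pi fun _ : ι => Measure.pi fun _ : κ => μ)
      (Measure.pi fun _ : κ => Measure.pi fun _ : ι => μ) := by
  have h1 := Measure.infinitePi_map_curry_symm (fun (_ : ι) (_ : κ) => μ)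
  have h2 := Measure.infinitePi_map_curry (fun (_ : κ) (_ : ι) => μ)
  have h3 := Measure.infinitePi_map_piCongrLeft (X := fun _ : κ × ι => X)
    (fun _ : κ × ι => μ) (Equiv.prodComm ι κ)
  refine ⟨by fun_prop, ?_⟩
  simp only [Measure.infinitePi_eq_pi] at h1 h2 h3
  rw [← h2, ← h3, ← h1, Measure.map_map (by fun_prop) (by fun_prop),
    Measure.map_map (by fun_prop) (by fun_prop)]
  rfl

section Rows

variable {ι : Type*} [Fintype ι] (d : ℕ)

theorem pi_stdGaussian_eq_map :
    Measure.pi (fun _ : ι => stdGaussian (EuclideanSpace ℝ (Fin d))) =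
      (Measure.pi fun _ : Fin d => Measure.pi fun _ : ι => gaussianReal 0 1).map
        (fun z i => WithLp.toLp 2 (fun k => z k i)) := by
  have h := (measurePreserving_transpose (ι := Fin d) (κ := ι) (gaussianReal 0 1)).map_eq
  have : (fun (z : Fin d → ι → ℝ) (i : ι) =>
      (WithLp.toLp 2 (fun k => z k i) : EuclideanSpace ℝ (Fin d))) =
      (fun (z : ι → Fin d → ℝ) i => WithLp.toLp 2 (z i)) ∘
      (fun (z : Fin d → ι → ℝ) (k : ι) (i : Fin d) => z i k) := rfl
  rw [this, ← Measure.map_map (by fun_prop) (by fun_prop), h,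
    Measure.pi_map_pi (f := fun (_ : ι) (y : Fin d → ℝ) => (WithLp.toLp 2 y : EuclideanSpace ℝ (Fin d)))
      (by fun_prop)]
  simp_rw [← stdGaussian_eq_map_pi]

theorem exp_gram_form_eq_prod (B : Matrix ι ι ℝ) (z : Fin d → ι → ℝ) :
    Real.exp ((∑ i, ∑ j, B i j * inner ℝ (WithLp.toLp 2 (fun k => z k i) : EuclideanSpace ℝ (Fin d))
      (WithLp.toLp 2 (fun k => z k j) : EuclideanSpace ℝ (Fin d))) / 2) =
      ∏ k, Real.exp ((∑ i, ∑ j, B i j * z k i * z k j) / 2) := by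
  rw [← Real.exp_sum, ← Finset.sum_div]
  congr 2
  rw [Finset.sum_comm]
  simp only [PiLp.inner_apply, RCLike.inner_apply, conj_trivial, Finset.mul_sum]
  rw [Finset.sum_comm' (t' := Finset.univ) (s' := fun _ => Finset.univ) (by simp)]
  conv_rhs => rw [Finset.sum_comm]
  refine Finset.sum_congr rfl fun i _ => ?_
  conv_rhs => rw [Finset.sum_comm]
  refine Finset.sum_congr rfl fun j _ => Finset.sum_congr rfl fun k _ => ?_
  ring

variable [DecidableEq ι] {B : Matrix ι ι ℝ}

theorem integrable_exp_gram_form (hB : B.IsHermitian) (hlt : ∀ a, hB.eigenvalues a < 1) :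
    Integrable (fun g : ι → EuclideanSpace ℝ (Fin d) =>
        Real.exp ((∑ i, ∑ j, B i j * inner ℝ (g i) (g j)) / 2))
      (Measure.pi fun _ : ι => stdGaussian (EuclideanSpace ℝ (Fin d))) := by
  have hm : Measurable fun (z : Fin d → ι → ℝ) (i : ι) =>
      (WithLp.toLp 2 (fun k => z k i) : EuclideanSpace ℝ (Fin d)) :=
    (by fun_prop : Continuous _).measurable
  rw [pi_stdGaussian_eq_map, integrable_map_measure (by fun_prop) hm.aemeasurable]
  simp only [Function.comp_def, exp_gram_form_eq_prod]
  refine Integrable.fintype_prod (f := fun (_ : Fin d) (y : ι → ℝ) =>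
    Real.exp ((∑ i, ∑ j, B i j * y i * y j) / 2)) fun k => ?_
  have h := integrable_exp_quadratic_form hB hlt
  rw [← map_pi_eq_stdGaussian, integrable_map_measure (by fun_prop) (by fun_prop)] at h
  exact h

theorem integral_exp_gram_form (hB : B.IsHermitian) (hlt : ∀ a, hB.eigenvalues a < 1) :
    ∫ g : ι → EuclideanSpace ℝ (Fin d),
        Real.exp ((∑ i, ∑ j, B i j * inner ℝ (g i) (g j)) / 2)
      ∂(Measure.pi fun _ : ι => stdGaussian (EuclideanSpace ℝ (Fin d))) =
      (∏ a, (Real.sqrt (1 - hB.eigenvalues a))⁻¹) ^ d := by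
  have hm : Measurable fun (z : Fin d → ι → ℝ) (i : ι) =>
      (WithLp.toLp 2 (fun k => z k i) : EuclideanSpace ℝ (Fin d)) :=
    (by fun_prop : Continuous _).measurable
  rw [pi_stdGaussian_eq_map, integral_map hm.aemeasurable (by fun_prop)]
  simp only [exp_gram_form_eq_prod]
  rw [integral_fintype_prod_eq_prod (f := fun (_ : Fin d) (y : ι → ℝ) =>
    Real.exp ((∑ i, ∑ j, B i j * y i * y j) / 2))]
  have h := integral_exp_quadratic_form hB hlt
  rw [← map_pi_eq_stdGaussian, integral_map (by fun_prop) (by fun_prop)] at h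
  rw [← h]
  simp

end Rows

/-! ### Comparison of spherical and Gaussian exponential moments -/

theorem integral_pi_mul_of_ne {ι : Type*} [Fintype ι] [DecidableEq ι] (ν : Measure ℝ)
    [IsProbabilityMeasure ν] {i j : ι} (hij : i ≠ j) :
    ∫ ρ : ι → ℝ, ρ i * ρ j ∂(Measure.pi fun _ => ν) = (∫ ρ, ρ ∂ν) ^ 2 := by
  have h := integral_fintype_prod_eq_prod (𝕜 := ℝ)
    (fun (k : ι) (ρ : ℝ) => if k = i ∨ k = j then ρ else 1) (μ := fun _ => ν)
  have h1 : ∀ ρ : ι → ℝ, ∏ k, (if k = i ∨ k = j then ρ k else 1) = ρ i * ρ j := by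
    intro ρ
    rw [← Finset.prod_filter, ← Finset.prod_pair hij]
    congr 1
    ext k
    simp
  simp only [h1] at h
  rw [h]
  have h2 : ∀ k, ∫ ρ, (if k = i ∨ k = j then ρ else 1) ∂ν =
      if k = i ∨ k = j then ∫ ρ, ρ ∂ν else 1 := by
    intro k
    split_ifs <;> simp
  simp_rw [h2]
  rw [← Finset.prod_filter, sq, ← Finset.prod_pair (f := fun _ => ∫ ρ, ρ ∂ν) hij]
  congr 1
  ext k
  simp

theorem integrable_pi_mul_of_ne {ι : Type*} [Fintype ι] [DecidableEq ι] {ν : Measure ℝ}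
    [IsProbabilityMeasure ν] (hν : Integrable (fun ρ => ρ) ν) {i j : ι} (hij : i ≠ j) :
    Integrable (fun ρ : ι → ℝ => ρ i * ρ j) (Measure.pi fun _ => ν) := by
  have h := Integrable.fintype_prod (𝕜 := ℝ)
    (f := fun (k : ι) (ρ : ℝ) => if k = i ∨ k = j then ρ else 1) (μ := fun _ => ν) (fun k => by
      split_ifs
      · exact hν
      · exact integrable_const _)
  refine h.congr (Eventually.of_forall fun ρ => ?_)
  simp only
  rw [← Finset.prod_filter, ← Finset.prod_pair hij]
  congr 1
  ext k
  simp

theorem pi_stdGaussian_eq_map_polar (ι : Type*) [Fintype ι] (d : ℕ) [NeZero d] :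
    Measure.pi (fun _ : ι => stdGaussian (EuclideanSpace ℝ (Fin d))) =
      ((Measure.pi fun _ : ι => sphereUniform d).prod (Measure.pi fun _ : ι => radialLaw d)).map
        (fun z i => z.2 i • (z.1 i : EuclideanSpace ℝ (Fin d))) := by
  simp_rw [← sphereUniform_prod_radialLaw_map]
  rw [← Measure.pi_map_pi (f := fun (_ : ι) (z : UnitSphere d × ℝ) =>
    z.2 • (z.1 : EuclideanSpace ℝ (Fin d))) (fun i => by fun_prop),
    ← (measurePreserving_arrowProdEquivProdArrow (UnitSphere d) ℝ ι
      (fun _ => sphereUniform d) (fun _ => radialLaw d)).map_eq,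
    Measure.map_map (by fun_prop) (by fun_prop)]
  rfl

/-- The radii of independent Gaussian vectors are averaged inside the exponential; the vanishing
diagonal makes the exponent affine in each radius. -/
theorem integral_sphere_exp_gram_le {ι : Type*} [Fintype ι] [DecidableEq ι] (d : ℕ) [NeZero d]
    {B : Matrix ι ι ℝ} (hB : B.IsHermitian) (hdiag : ∀ i, B i i = 0)
    (hlt : ∀ a, hB.eigenvalues a < 1) :
    ∫ x : ι → UnitSphere d, Real.exp ((∫ ρ, ρ ∂(radialLaw d)) ^ 2 *
        (∑ i, ∑ j, B i j * inner ℝ (x i : EuclideanSpace ℝ (Fin d)) (x j)) / 2)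
      ∂(Measure.pi fun _ : ι => sphereUniform d) ≤
      (∏ a, (Real.sqrt (1 - hB.eigenvalues a))⁻¹) ^ d := by
  have hint := integrable_exp_gram_form d hB hlt
  have hm : Measurable fun (z : (ι → UnitSphere d) × (ι → ℝ)) (i : ι) =>
      z.2 i • (z.1 i : EuclideanSpace ℝ (Fin d)) := (by fun_prop : Continuous _).measurable
  rw [← integral_exp_gram_form d hB hlt, pi_stdGaussian_eq_map_polar,
    integral_map hm.aemeasurable (by fun_prop)]
  rw [pi_stdGaussian_eq_map_polar, integrable_map_measure (by fun_prop) hm.aemeasurable] at hint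
  simp only [Function.comp_def] at hint
  rw [integral_prod _ hint]
  refine integral_mono_ae (integrable_of_continuous_compact (by fun_prop)) hint.integral_prod_left ?_
  filter_upwards [hint.prod_right_ae] with x hx
  have hterm : ∀ i j, Integrable (fun ρ : ι → ℝ => B i j *
      inner ℝ (ρ i • (x i : EuclideanSpace ℝ (Fin d))) (ρ j • (x j : EuclideanSpace ℝ (Fin d))))
      (Measure.pi fun _ : ι => radialLaw d) ∧
      ∫ ρ : ι → ℝ, B i j * inner ℝ (ρ i • (x i : EuclideanSpace ℝ (Fin d)))
        (ρ j • (x j : EuclideanSpace ℝ (Fin d))) ∂(Measure.pi fun _ : ι => radialLaw d) =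
      (∫ ρ, ρ ∂(radialLaw d)) ^ 2 * (B i j * inner ℝ (x i : EuclideanSpace ℝ (Fin d)) (x j)) := by
    intro i j
    rcases eq_or_ne i j with rfl | hij
    · simp [hdiag]
    · have e : ∀ ρ : ι → ℝ, B i j * inner ℝ (ρ i • (x i : EuclideanSpace ℝ (Fin d)))
          (ρ j • (x j : EuclideanSpace ℝ (Fin d))) =
          (B i j * inner ℝ (x i : EuclideanSpace ℝ (Fin d)) (x j)) * (ρ i * ρ j) := by
        intro ρ
        rw [real_inner_smul_left, real_inner_smul_right]
        ring
      simp only [e]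
      have h1 := integrable_pi_mul_of_ne (ι := ι) (ν := radialLaw d)
        (by simpa using integrable_radialLaw_pow d 1) hij
      refine ⟨h1.const_mul _, ?_⟩
      rw [integral_const_mul, integral_pi_mul_of_ne _ hij]
      ring
  have hf : Integrable (fun ρ : ι → ℝ => (∑ i, ∑ j, B i j *
      inner ℝ (ρ i • (x i : EuclideanSpace ℝ (Fin d))) (ρ j • (x j : EuclideanSpace ℝ (Fin d)))) / 2)
      (Measure.pi fun _ : ι => radialLaw d) :=
    (integrable_finsetSum _ fun i _ => integrable_finsetSum _ fun j _ => (hterm i j).1).div_const _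
  have hJ := convexOn_exp.map_integral_le (μ := Measure.pi fun _ : ι => radialLaw d)
    (by fun_prop) isClosed_univ (Eventually.of_forall fun _ => Set.mem_univ _) hf hx
  refine le_trans (le_of_eq ?_) hJ
  rw [integral_div, integral_finsetSum _ fun i _ => integrable_finsetSum _ fun j _ => (hterm i j).1]
  congr 2
  rw [Finset.mul_sum]
  refine Finset.sum_congr rfl fun i _ => ?_
  rw [integral_finsetSum _ fun j _ => (hterm i j).1, Finset.mul_sum]
  exact Finset.sum_congr rfl fun j _ => (hterm i j).2.symm

theorem sum_rotate {α β γ : Type*} [Fintype α] [Fintype β] [Fintype γ] (f : α → β → γ → ℝ) :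
    ∑ i, ∑ a, ∑ b, f i a b = ∑ a, ∑ b, ∑ i, f i a b := by
  rw [Finset.sum_comm]
  exact Finset.sum_congr rfl fun a _ => Finset.sum_comm

/-- A quadratic form on the sphere has Gaussian lower tails, with no restriction on `θ ≥ 0`. -/
theorem integral_sphere_exp_neg_le {ι : Type*} [Fintype ι] [DecidableEq ι] (d : ℕ) [NeZero d]
    (w : ι → ℝ) (hw : ∀ i, 0 ≤ w i) (y : ι → UnitSphere d) (θ : ℝ) (hθ : 0 ≤ θ) :
    ∫ x, Real.exp (-θ * ∑ i, w i * (inner ℝ (y i : EuclideanSpace ℝ (Fin d)) (x : EuclideanSpace ℝ (Fin d)) : ℝ) ^ 2)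
      ∂(sphereUniform d) ≤
    Real.exp (-θ * (∑ i, w i) / d + θ ^ 2 / d ^ 2 * ∑ i, ∑ j, w i * w j *
      (inner ℝ (y i : EuclideanSpace ℝ (Fin d)) (y j : EuclideanSpace ℝ (Fin d)) : ℝ) ^ 2) := by
  have hd : (0 : ℝ) < d := Nat.cast_pos.2 (NeZero.pos d)
  set Q : EuclideanSpace ℝ (Fin d) → ℝ := fun g =>
    ∑ i, w i * (inner ℝ (y i : EuclideanSpace ℝ (Fin d)) g : ℝ) ^ 2 with hQ
  have hQ0 : ∀ g, 0 ≤ Q g := fun g =>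
    Finset.sum_nonneg fun i _ => mul_nonneg (hw i) (sq_nonneg _)
  have hQc : Continuous Q := by fun_prop
  have hQs : ∀ (ρ : ℝ) g, Q (ρ • g) = ρ ^ 2 * Q g := by
    intro ρ g
    simp only [hQ, Finset.mul_sum, inner_smul_right]
    refine Finset.sum_congr rfl fun i _ => ?_
    ring
  set Y : Matrix ι (Fin d) ℝ := Matrix.of fun i a => (y i : EuclideanSpace ℝ (Fin d)) a with hY
  set c : ℝ := -(2 * θ / d) with hc
  set B : Matrix (Fin d) (Fin d) ℝ := c • (Y.transpose * (Matrix.diagonal w * Y)) with hBdef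
  have hG : ∀ i j, (Y * Y.transpose) i j =
      (inner ℝ (y i : EuclideanSpace ℝ (Fin d)) (y j : EuclideanSpace ℝ (Fin d)) : ℝ) := by
    intro i j
    rw [Matrix.mul_apply, PiLp.inner_apply]
    refine Finset.sum_congr rfl fun a _ => ?_
    simp [hY, mul_comm]
  have hB : B.IsHermitian := by
    rw [Matrix.IsHermitian, Matrix.conjTranspose_eq_transpose_of_trivial, hBdef,
      Matrix.transpose_smul, Matrix.transpose_mul, Matrix.transpose_mul,
      Matrix.transpose_transpose, Matrix.diagonal_transpose, Matrix.mul_assoc]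
  have hBab : ∀ a b, B a b = c * ∑ i, (y i : EuclideanSpace ℝ (Fin d)) a *
      (w i * (y i : EuclideanSpace ℝ (Fin d)) b) := by
    intro a b
    rw [hBdef, Matrix.smul_apply, Matrix.mul_apply, smul_eq_mul]
    simp [hY, Matrix.diagonal_mul]
  have hBQ : ∀ g : EuclideanSpace ℝ (Fin d), ∑ a, ∑ b, B a b * g a * g b = c * Q g := by
    intro g
    simp only [hQ, hBab, PiLp.inner_apply, sq, Finset.sum_mul_sum]
    simp only [Finset.mul_sum, Finset.sum_mul]
    rw [sum_rotate fun i a b => c * (w i * (inner ℝ ((y i : EuclideanSpace ℝ (Fin d)) a) (g a) *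
      inner ℝ ((y i : EuclideanSpace ℝ (Fin d)) b) (g b)))]
    refine Finset.sum_congr rfl fun a _ => Finset.sum_congr rfl fun b _ =>
      Finset.sum_congr rfl fun i _ => ?_
    simp
    ring
  have hneg : ∀ a, hB.eigenvalues a ≤ 0 := by
    intro a
    have h := hB.quadratic_form_eigenvectorBasis (Pi.single a 1)
    have h1 := hQ0 (∑ b, (Pi.single a 1 : Fin d → ℝ) b • hB.eigenvectorBasis b)
    have h2 : 0 ≤ 2 * θ / d := by positivity
    have h3 : ∑ b, hB.eigenvalues b * (Pi.single a 1 : Fin d → ℝ) b ^ 2 = hB.eigenvalues a := by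
      rw [Finset.sum_eq_single a] <;> simp +contextual
    rw [hBQ, h3] at h
    rw [← h, hc]
    nlinarith
  have htr : ∑ a, hB.eigenvalues a = c * ∑ i, w i := by
    have h := hB.trace_pow_eq_sum_eigenvalues_pow 1
    simp only [pow_one] at h
    rw [← h, hBdef, Matrix.trace_smul, Matrix.trace_mul_comm, Matrix.mul_assoc, smul_eq_mul,
      Matrix.trace]
    congr 1
    refine Finset.sum_congr rfl fun i _ => ?_
    rw [Matrix.diag_apply, Matrix.diagonal_mul, hG, real_inner_self_eq_norm_sq,
      norm_coe_unitSphere]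
    ring
  have htr2 : ∑ a, hB.eigenvalues a ^ 2 = c ^ 2 * ∑ i, ∑ j, w i * w j *
      (inner ℝ (y i : EuclideanSpace ℝ (Fin d)) (y j : EuclideanSpace ℝ (Fin d)) : ℝ) ^ 2 := by
    rw [← hB.trace_pow_eq_sum_eigenvalues_pow 2, sq B, hBdef, smul_mul_smul_comm,
      Matrix.trace_smul, smul_eq_mul, ← sq]
    congr 1
    have e : Y.transpose * (Matrix.diagonal w * Y) * (Y.transpose * (Matrix.diagonal w * Y)) =
        Y.transpose * (Matrix.diagonal w * (Y * Y.transpose) * (Matrix.diagonal w * Y)) := by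
      simp only [Matrix.mul_assoc]
    have e2 : Matrix.diagonal w * (Y * Y.transpose) * (Matrix.diagonal w * Y) * Y.transpose =
        Matrix.diagonal w * (Y * Y.transpose) * (Matrix.diagonal w * (Y * Y.transpose)) := by
      simp only [Matrix.mul_assoc]
    rw [e, Matrix.trace_mul_comm, e2, Matrix.trace]
    refine Finset.sum_congr rfl fun i _ => ?_
    rw [Matrix.diag_apply, Matrix.mul_apply]
    refine Finset.sum_congr rfl fun j _ => ?_
    rw [Matrix.diagonal_mul, Matrix.diagonal_mul, hG, hG, real_inner_comm (y i).1]
    ring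
  have hE := integral_exp_quadratic_form hB fun a => (hneg a).trans_lt one_pos
  have hJ : ∫ x : UnitSphere d, Real.exp (-θ * Q x) ∂(sphereUniform d) ≤
      ∫ g, Real.exp (-(θ / d) * Q g) ∂(stdGaussian (EuclideanSpace ℝ (Fin d))) := by
    rw [integral_stdGaussian_polar _ _ (by fun_prop)]
    have hle1 : ∀ g, Real.exp (-(θ / d) * Q g) ≤ 1 := fun g => by
      rw [Real.exp_le_one_iff]
      have : 0 ≤ θ / d := by positivity
      nlinarith [hQ0 g]
    have hint : Integrable (fun z : UnitSphere d × ℝ =>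
        Real.exp (-(θ / d) * Q (z.2 • (z.1 : EuclideanSpace ℝ (Fin d)))))
        ((sphereUniform d).prod (radialLaw d)) := by
      refine Integrable.of_bound (by fun_prop) 1 (Eventually.of_forall fun z => ?_)
      rw [Real.norm_of_nonneg (Real.exp_nonneg _)]
      exact hle1 _
    rw [integral_prod _ hint]
    refine integral_mono_ae (integrable_of_continuous_compact (by fun_prop))
      hint.integral_prod_left ?_
    filter_upwards [hint.prod_right_ae] with x hx
    have hf : Integrable (fun ρ : ℝ => -(θ / d) * Q (ρ • (x : EuclideanSpace ℝ (Fin d))))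
        (radialLaw d) := by
      simp only [hQs]
      exact ((integrable_radialLaw_pow d 2).mul_const _).const_mul _
    have hJ := convexOn_exp.map_integral_le (μ := radialLaw d)
      (by fun_prop) isClosed_univ (Eventually.of_forall fun _ => Set.mem_univ _) hf hx
    refine le_trans (le_of_eq ?_) hJ
    simp only [hQs]
    rw [integral_const_mul, integral_mul_const, integral_radialLaw_sq]
    congr 1
    field_simp
  refine hJ.trans ?_
  have hE2 : ∫ g, Real.exp (-(θ / d) * Q g) ∂(stdGaussian (EuclideanSpace ℝ (Fin d))) =
      ∏ a, (Real.sqrt (1 - hB.eigenvalues a))⁻¹ := by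
    rw [← hE]
    refine integral_congr_ae (Eventually.of_forall fun g => ?_)
    simp only [hBQ]
    congr 1
    ring
  rw [hE2]
  refine (Finset.prod_le_prod (fun a _ => by positivity)
    fun a _ => inv_sqrt_one_sub_le_of_nonpos (hneg a)).trans (le_of_eq ?_)
  rw [← Real.exp_sum, Finset.sum_add_distrib, ← Finset.sum_div, ← Finset.sum_div, htr, htr2]
  congr 1
  ring

/-! ### Independent uniform points of the sphere -/

/-- The law of independent uniform points of `S^{d-1}`, indexed by `ι`. -/
noncomputable abbrev latentLaw (ι : Type*) [Fintype ι] (d : ℕ) : Measure (ι → UnitSphere d) :=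
  Measure.pi fun _ : ι => sphereUniform d

/-- The Gram matrix of a family of points of the sphere. -/
noncomputable def gram {ι : Type*} {d : ℕ} (x : ι → UnitSphere d) (i j : ι) : ℝ :=
  inner ℝ (x i : EuclideanSpace ℝ (Fin d)) (x j : EuclideanSpace ℝ (Fin d))

section Gram

variable {ι : Type*} {d : ℕ}

theorem gram_comm (x : ι → UnitSphere d) (i j : ι) : gram x i j = gram x j i :=
  real_inner_comm _ _

theorem gram_self (x : ι → UnitSphere d) (i : ι) : gram x i i = 1 := by
  rw [gram, real_inner_self_eq_norm_sq, norm_coe_unitSphere, one_pow]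

theorem abs_gram_le_one (x : ι → UnitSphere d) (i j : ι) : |gram x i j| ≤ 1 := by
  have h := abs_real_inner_le_norm (x i : EuclideanSpace ℝ (Fin d)) (x j)
  rwa [norm_coe_unitSphere, norm_coe_unitSphere, one_mul] at h

@[fun_prop]
theorem continuous_gram (i j : ι) : Continuous fun x : ι → UnitSphere d => gram x i j := by
  unfold gram
  fun_prop

theorem gram_update_of_ne [DecidableEq ι] (x : ι → UnitSphere d) {i j k : ι} (y : UnitSphere d)
    (hi : i ≠ k) (hj : j ≠ k) : gram (Function.update x k y) i j = gram x i j := by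
  rw [gram, gram, Function.update_of_ne hi, Function.update_of_ne hj]

end Gram

/-- Resampling one coordinate preserves a product measure. -/
theorem measurePreserving_update {ι Ω : Type*} [Fintype ι] [DecidableEq ι] [MeasurableSpace Ω]
    (μ : Measure Ω) [IsProbabilityMeasure μ] (j : ι) :
    MeasurePreserving (fun z : (ι → Ω) × Ω => Function.update z.1 j z.2)
      ((Measure.pi fun _ : ι => μ).prod μ) (Measure.pi fun _ : ι => μ) := by
  have hm : Measurable (fun z : (ι → Ω) × Ω => Function.update z.1 j z.2) := by
    refine measurable_pi_iff.2 fun i => ?_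
    rcases eq_or_ne i j with rfl | h
    · simpa using measurable_snd
    · simp only [Function.update_of_ne h]
      fun_prop
  refine ⟨hm, (Measure.pi_eq fun s hs => ?_).symm⟩
  rw [Measure.map_apply hm (MeasurableSet.univ_pi hs)]
  have : (fun z : (ι → Ω) × Ω => Function.update z.1 j z.2) ⁻¹' (Set.univ.pi s) =
      (Set.univ.pi (Function.update s j Set.univ)) ×ˢ s j := by
    ext ⟨x, y⟩
    simp only [Set.mem_preimage, Set.mem_pi, Set.mem_univ, true_imp_iff, Set.mem_prod]
    constructor
    · intro h
      refine ⟨fun i => ?_, by simpa using h j⟩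
      rcases eq_or_ne i j with rfl | hi
      · simp
      · simpa [hi] using h i
    · rintro ⟨h, hy⟩ i
      rcases eq_or_ne i j with rfl | hi
      · simpa using hy
      · simpa [hi] using h i
  rw [this, Measure.prod_prod, Measure.pi_pi, ← Finset.mul_prod_erase _ _ (Finset.mem_univ j),
    ← Finset.mul_prod_erase _ (fun i => μ (s i)) (Finset.mem_univ j)]
  simp only [Function.update_self, measure_univ, one_mul]
  rw [mul_comm]
  congr 1
  refine Finset.prod_congr rfl fun i hi => ?_
  rw [Function.update_of_ne (Finset.ne_of_mem_erase hi)]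

section Moments

variable {ι : Type*} [Fintype ι] [DecidableEq ι] {d : ℕ} [NeZero d]

theorem integral_latent_update {f : (ι → UnitSphere d) → ℝ} (hf : Continuous f) (j : ι) :
    ∫ x, f x ∂(latentLaw ι d) =
      ∫ x, ∫ y, f (Function.update x j y) ∂(sphereUniform d) ∂(latentLaw ι d) := by
  have h := measurePreserving_update (ι := ι) (sphereUniform d) j
  change ∫ x, f x ∂(Measure.pi fun _ : ι => sphereUniform d) = ∫ x, ∫ y,
    f (Function.update x j y) ∂(sphereUniform d) ∂(Measure.pi fun _ : ι => sphereUniform d)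
  rw [← h.map_eq, integral_map h.measurable.aemeasurable hf.measurable.aestronglyMeasurable,
    integral_prod, h.map_eq]
  refine integrable_of_continuous_compact (hf.comp ?_)
  exact continuous_fst.update j continuous_snd

/-- Averaging over a point `x j` contracts a path through it: `E ⟨a, x⟩⟨x, b⟩ = ⟨a, b⟩ / d`. -/
theorem integral_latent_contract {F : (ι → UnitSphere d) → ℝ} (hF : Continuous F) {j a b : ι}
    (hFj : ∀ x y, F (Function.update x j y) = F x) (ha : a ≠ j) (hb : b ≠ j) :
    ∫ x, F x * (gram x a j * gram x j b) ∂(latentLaw ι d) =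
      (∫ x, F x * gram x a b ∂(latentLaw ι d)) / d := by
  rw [integral_latent_update (by fun_prop) j, ← integral_div]
  refine integral_congr_ae (Eventually.of_forall fun x => ?_)
  simp only [hFj, gram, Function.update_self, Function.update_of_ne ha, Function.update_of_ne hb]
  rw [integral_const_mul, integral_sphere_inner_mul_inner]
  ring

theorem integral_latent_gram_sq {F : (ι → UnitSphere d) → ℝ} (hF : Continuous F) {i j : ι}
    (hFj : ∀ x y, F (Function.update x j y) = F x) (hij : i ≠ j) :
    ∫ x, F x * gram x i j ^ 2 ∂(latentLaw ι d) = (∫ x, F x ∂(latentLaw ι d)) / d := by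
  have h := integral_latent_contract hF hFj hij hij
  simp only [gram_self, mul_one] at h
  rw [← h]
  refine integral_congr_ae (Eventually.of_forall fun x => ?_)
  simp only [gram_comm x j i, sq]

/-- The even moments of a standard Gaussian variable. -/
noncomputable def gaussianEvenMoment (k : ℕ) : ℝ := ∫ t, t ^ (2 * k) ∂(gaussianReal 0 1)

theorem gaussianEvenMoment_nonneg (k : ℕ) : 0 ≤ gaussianEvenMoment k := by
  refine integral_nonneg fun t => ?_
  simp only [Pi.zero_apply]
  rw [pow_mul]
  positivity

theorem integral_latent_gram_pow_le {F : (ι → UnitSphere d) → ℝ} (hF : Continuous F)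
    (hF0 : ∀ x, 0 ≤ F x) {i j : ι} (hFj : ∀ x y, F (Function.update x j y) = F x) (hij : i ≠ j)
    (k : ℕ) :
    ∫ x, F x * gram x i j ^ (2 * k) ∂(latentLaw ι d) ≤
      (∫ x, F x ∂(latentLaw ι d)) * (gaussianEvenMoment k / d ^ k) := by
  rw [integral_latent_update (by fun_prop) j, ← integral_mul_const]
  simp only [hFj, integral_const_mul]
  refine integral_mono_of_nonneg (Eventually.of_forall fun x => ?_)
    (integrable_of_continuous_compact (by fun_prop)) (Eventually.of_forall fun x => ?_)
  · refine mul_nonneg (hF0 x) (integral_nonneg fun y => ?_)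
    simp only [Pi.zero_apply, pow_mul]
    positivity
  · refine mul_le_mul_of_nonneg_left ?_ (hF0 x)
    simp only [gram, Function.update_self, Function.update_of_ne hij]
    exact integral_sphere_inner_pow_le d k _ (norm_coe_unitSphere _)

end Moments

/-- The quadratic statistic is compensated, one point at a time, to a nonnegative supermartingale.
The weights are strictly triangular, so that the `k`-th summand involves the points up to `k`. -/
theorem integral_latent_exp_compensated_le_one {d : ℕ} [NeZero d] (θ : ℝ) (hθ : 0 ≤ θ) (n : ℕ) :
    ∀ w : Fin n → Fin n → ℝ, (∀ i k, 0 ≤ w i k) → (∀ i k, k ≤ i → w i k = 0) →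
    ∫ x, Real.exp (∑ k, (-θ * ∑ i, w i k * (gram x i k ^ 2 - 1 / d) -
        θ ^ 2 / d ^ 2 * ∑ i, ∑ j, w i k * w j k * gram x i j ^ 2)) ∂(latentLaw (Fin n) d) ≤ 1 := by
  induction n with
  | zero =>
    intro w _ _
    simp
  | succ n ih =>
    intro w hw hw0
    have hlast : ∀ k, w (Fin.last n) k = 0 := fun k => hw0 _ _ (Fin.le_last k)
    have hd : (0 : ℝ) < d := Nat.cast_pos.2 (NeZero.pos d)
    have hmp := (measurePreserving_piFinSuccAbove (fun _ : Fin (n + 1) => sphereUniform d)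
      (Fin.last n)).symm
    rw [← hmp.integral_comp']
    have hsnoc : ∀ z : UnitSphere d × (Fin n → UnitSphere d),
        (MeasurableEquiv.piFinSuccAbove (fun _ => UnitSphere d) (Fin.last n)).symm z =
          Fin.snoc (α := fun _ => UnitSphere d) z.2 z.1 := by
      intro z
      simp [MeasurableEquiv.piFinSuccAbove, Fin.insertNthEquiv, Fin.insertNth_last']
    have hcont : Continuous fun z : UnitSphere d × (Fin n → UnitSphere d) =>
        Fin.snoc (α := fun _ => UnitSphere d) z.2 z.1 := by fun_prop
    simp only [hsnoc]
    rw [integral_prod_symm _ (integrable_of_continuous_compact (by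
      have h2 : ∀ i k, Continuous fun z : UnitSphere d × (Fin n → UnitSphere d) =>
          gram (Fin.snoc (α := fun _ => UnitSphere d) z.2 z.1) i k := fun i k =>
        (continuous_gram i k).comp hcont
      fun_prop))]
    refine le_trans (integral_mono_of_nonneg
      (Eventually.of_forall fun x => integral_nonneg fun y => Real.exp_nonneg _)
      (integrable_of_continuous_compact (f := fun x : Fin n → UnitSphere d =>
        Real.exp (∑ k : Fin n, (-θ * ∑ i : Fin n, w i.castSucc k.castSucc * (gram x i k ^ 2 - 1 / d) -
        θ ^ 2 / d ^ 2 * ∑ i : Fin n, ∑ j : Fin n, w i.castSucc k.castSucc * w j.castSucc k.castSucc *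
          gram x i j ^ 2))) (by fun_prop)) (Eventually.of_forall fun x => ?_))
      (ih (fun i k => w i.castSucc k.castSucc) (fun i k => hw _ _)
        (fun i k h => hw0 _ _ (Fin.castSucc_le_castSucc_iff.2 h)))
    simp only [Fin.sum_univ_castSucc, hlast, zero_mul, mul_zero, add_zero, Finset.sum_const_zero]
    have hg1 : ∀ (y : UnitSphere d) (i j : Fin n),
        gram (Fin.snoc (α := fun _ => UnitSphere d) x y) i.castSucc j.castSucc = gram x i j := by
      intro y i j
      simp [gram]
    have hg2 : ∀ (y : UnitSphere d) (i : Fin n),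
        gram (Fin.snoc (α := fun _ => UnitSphere d) x y) i.castSucc (Fin.last n) =
          inner ℝ (x i : EuclideanSpace ℝ (Fin d)) (y : EuclideanSpace ℝ (Fin d)) := by
      intro y i
      simp [gram]
    simp only [hg1, hg2, Real.exp_add]
    rw [integral_const_mul]
    refine mul_le_of_le_one_right (Real.exp_nonneg _) ?_
    have hb := integral_sphere_exp_neg_le d (fun i : Fin n => w i.castSucc (Fin.last n))
      (fun i => hw _ _) x θ hθ
    set W : ℝ := ∑ i : Fin n, w i.castSucc (Fin.last n) with hW
    set V : ℝ := ∑ i : Fin n, ∑ j : Fin n, w i.castSucc (Fin.last n) * w j.castSucc (Fin.last n) *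
      (inner ℝ (x i : EuclideanSpace ℝ (Fin d)) (x j : EuclideanSpace ℝ (Fin d)) : ℝ) ^ 2 with hV
    have he : ∀ y : UnitSphere d, Real.exp (-θ * ∑ i : Fin n, w i.castSucc (Fin.last n) *
        ((inner ℝ (x i : EuclideanSpace ℝ (Fin d)) (y : EuclideanSpace ℝ (Fin d)) : ℝ) ^ 2 - 1 / d) -
        θ ^ 2 / d ^ 2 * ∑ i : Fin n, ∑ j : Fin n, w i.castSucc (Fin.last n) *
          w j.castSucc (Fin.last n) * gram x i j ^ 2) =
        Real.exp (-(-θ * W / d + θ ^ 2 / d ^ 2 * V)) * Real.exp (-θ * ∑ i : Fin n,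
          w i.castSucc (Fin.last n) *
          (inner ℝ (x i : EuclideanSpace ℝ (Fin d)) (y : EuclideanSpace ℝ (Fin d)) : ℝ) ^ 2) := by
      intro y
      rw [← Real.exp_add]
      congr 1
      simp only [mul_sub, Finset.sum_sub_distrib, hV, hW, gram, ← Finset.sum_mul]
      ring
    simp only [he]
    rw [integral_const_mul]
    calc _ ≤ Real.exp (-(-θ * W / d + θ ^ 2 / d ^ 2 * V)) *
        Real.exp (-θ * W / d + θ ^ 2 / d ^ 2 * V) :=
          mul_le_mul_of_nonneg_left hb (Real.exp_nonneg _)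
      _ = 1 := by rw [← Real.exp_add, neg_add_cancel, Real.exp_zero]

/-! ### Graph probabilities -/

instance SimpleGraph.measurableSingletonClass {V : Type*} [Countable V] :
    MeasurableSingletonClass (SimpleGraph V) where
  measurableSet_singleton G := by
    have h : ({G} : Set (SimpleGraph V)) = SimpleGraph.edgeSet ⁻¹' {G.edgeSet} := by
      ext H
      simp
    rw [h]
    exact SimpleGraph.measurableEmbedding_edgeSet.measurable (measurableSet_singleton _)

/-- The pairs `i < j` of vertices. -/
def vertexPairs (n : ℕ) : Finset (Fin n × Fin n) := {e : Fin n × Fin n | e.1 < e.2}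

theorem mem_vertexPairs {n : ℕ} {e : Fin n × Fin n} : e ∈ vertexPairs n ↔ e.1 < e.2 := by
  simp [vertexPairs]

open Classical in
/-- The probability of the graph `G`, if the pairs `e` are connected independently with
probabilities `q e`. -/
noncomputable def graphWeight {n : ℕ} (q : Fin n × Fin n → ℝ) (G : SimpleGraph (Fin n)) : ℝ :=
  ∏ e ∈ vertexPairs n, if G.Adj e.1 e.2 then q e else 1 - q e

open Classical in
/-- A sum over graphs of a product over pairs factorizes. -/
theorem sum_graph_prod {n : ℕ} (a b : Fin n × Fin n → ℝ) :
    ∑ G : SimpleGraph (Fin n), ∏ e ∈ vertexPairs n, (if G.Adj e.1 e.2 then a e else b e) =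
      ∏ e ∈ vertexPairs n, (a e + b e) := by
  rw [Finset.prod_add]
  refine Finset.sum_bij' (fun G _ => (vertexPairs n).filter fun e => G.Adj e.1 e.2)
    (fun t _ => SimpleGraph.fromRel fun u v => (u, v) ∈ t) (by simp) (by simp) ?_ ?_ ?_
  · intro G _
    ext u v
    simp only [SimpleGraph.fromRel_adj, Finset.mem_filter, mem_vertexPairs]
    constructor
    · rintro ⟨_, h | h⟩
      · exact h.2
      · exact h.2.symm
    · intro h
      refine ⟨h.ne, ?_⟩
      rcases lt_or_gt_of_ne h.ne with h' | h'
      · exact Or.inl ⟨h', h⟩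
      · exact Or.inr ⟨h', h.symm⟩
  · intro t ht
    rw [Finset.mem_powerset] at ht
    ext ⟨u, v⟩
    simp only [SimpleGraph.fromRel_adj, Finset.mem_filter]
    constructor
    · rintro ⟨h1, _, h | h⟩
      · exact h
      · exact absurd (mem_vertexPairs.1 (ht h)) (mem_vertexPairs.1 h1).le.not_gt
    · intro h
      exact ⟨ht h, (mem_vertexPairs.1 (ht h)).ne, Or.inl h⟩
  · intro G _
    rw [Finset.prod_ite, ← Finset.filter_not]

theorem sum_graphWeight {n : ℕ} (q : Fin n × Fin n → ℝ) :
    ∑ G : SimpleGraph (Fin n), graphWeight q G = 1 := by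
  unfold graphWeight
  rw [sum_graph_prod]
  simp

theorem graphWeight_nonneg {n : ℕ} {q : Fin n × Fin n → ℝ} (hq : ∀ e, 0 ≤ q e ∧ q e ≤ 1)
    (G : SimpleGraph (Fin n)) : 0 ≤ graphWeight q G := by
  refine Finset.prod_nonneg fun e _ => ?_
  split_ifs
  · exact (hq e).1
  · exact sub_nonneg.2 (hq e).2

theorem graphWeight_const_pos {n : ℕ} {p : ℝ} (hp : 0 < p) (hp1 : p < 1)
    (G : SimpleGraph (Fin n)) : 0 < graphWeight (fun _ => p) G := by
  refine Finset.prod_pos fun e _ => ?_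
  split_ifs
  · exact hp
  · exact sub_pos.2 hp1

/-- The probabilities of connection of a linear kernel, given the latent points. -/
noncomputable def linearEdgeProb {n d : ℕ} (p r : ℝ) (x : Fin n → UnitSphere d)
    (e : Fin n × Fin n) : ℝ := p + r * gram x e.1 e.2

@[fun_prop]
theorem continuous_linearEdgeProb {n d : ℕ} (p r : ℝ) (e : Fin n × Fin n) :
    Continuous fun x : Fin n → UnitSphere d => linearEdgeProb p r x e := by
  unfold linearEdgeProb
  fun_prop

@[fun_prop]
theorem continuous_graphWeight {n d : ℕ} (p r : ℝ) (G : SimpleGraph (Fin n)) :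
    Continuous fun x : Fin n → UnitSphere d => graphWeight (linearEdgeProb p r x) G := by
  unfold graphWeight
  refine continuous_finsetProd _ fun e _ => ?_
  split_ifs <;> fun_prop

theorem linearEdgeProb_mem {n d : ℕ} {p r : ℝ} (hp : p ≤ 1 / 2) (hr : 0 ≤ r)
    (hrp : r ≤ p) (x : Fin n → UnitSphere d) (e : Fin n × Fin n) :
    0 ≤ linearEdgeProb p r x e ∧ linearEdgeProb p r x e ≤ 2 * p ∧ linearEdgeProb p r x e ≤ 1 := by
  have h := abs_le.1 (abs_gram_le_one x e.1 e.2)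
  unfold linearEdgeProb
  refine ⟨?_, ?_, ?_⟩ <;> nlinarith

/-- The probability of the graph `G` in the random geometric graph with linear kernel. -/
noncomputable def linearGraphProb (n d : ℕ) (p r : ℝ) (G : SimpleGraph (Fin n)) : ℝ :=
  ∫ x, graphWeight (linearEdgeProb p r x) G ∂(latentLaw (Fin n) d)

theorem linearGraphProb_nonneg {n d : ℕ} {p r : ℝ} (hp : p ≤ 1 / 2) (hr : 0 ≤ r) (hrp : r ≤ p)
    (G : SimpleGraph (Fin n)) : 0 ≤ linearGraphProb n d p r G :=
  integral_nonneg fun x => graphWeight_nonneg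
    (fun e => ⟨(linearEdgeProb_mem hp hr hrp x e).1, (linearEdgeProb_mem hp hr hrp x e).2.2⟩) G

section Law

variable {n d : ℕ} {p r : ℝ} {K : RGGKernel}

theorem rggCondProb_eq (hK : ∀ t : Set.Icc (-1 : ℝ) 1, (K t : ℝ) = p + r * t)
    (x : Fin n → UnitSphere d) (G : SimpleGraph (Fin n)) :
    rggCondProb K x G = ENNReal.ofReal (graphWeight (linearEdgeProb p r x) G) := by
  have h : ∀ e : Fin n × Fin n, (K (sphereInner (x e.1) (x e.2)) : ℝ) = linearEdgeProb p r x e :=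
    fun e => hK _
  have h01 : ∀ e : Fin n × Fin n, 0 ≤ linearEdgeProb p r x e ∧ linearEdgeProb p r x e ≤ 1 :=
    fun e => by rw [← h e]; exact (K (sphereInner (x e.1) (x e.2))).2
  rw [rggCondProb, graphWeight, ENNReal.ofReal_prod_of_nonneg]
  · refine Finset.prod_congr rfl fun e _ => ?_
    rw [h e]
    split_ifs <;> rfl
  · intro e _
    split_ifs
    · exact (h01 e).1
    · exact sub_nonneg.2 (h01 e).2

theorem linearEdgeProb_mem_of_kernel (hK : ∀ t : Set.Icc (-1 : ℝ) 1, (K t : ℝ) = p + r * t)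
    (x : Fin n → UnitSphere d) (e : Fin n × Fin n) :
    0 ≤ linearEdgeProb p r x e ∧ linearEdgeProb p r x e ≤ 1 := by
  have h : (K (sphereInner (x e.1) (x e.2)) : ℝ) = linearEdgeProb p r x e := hK _
  rw [← h]
  exact (K (sphereInner (x e.1) (x e.2))).2

open Classical in
theorem rggLaw_real [NeZero d] (hK : ∀ t : Set.Icc (-1 : ℝ) 1, (K t : ℝ) = p + r * t)
    (S : Set (SimpleGraph (Fin n))) :
    (rggLaw n d K).real S = ∑ G : SimpleGraph (Fin n), if G ∈ S then linearGraphProb n d p r G else 0 := by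
  have h1 : ∀ G : SimpleGraph (Fin n),
      ∫⁻ x, rggCondProb K x G ∂(latentLaw (Fin n) d) =
        ENNReal.ofReal (linearGraphProb n d p r G) := by
    intro G
    simp only [rggCondProb_eq hK]
    rw [linearGraphProb, ofReal_integral_eq_lintegral_ofReal
      (integrable_of_continuous_compact (by fun_prop))]
    exact Eventually.of_forall fun x => graphWeight_nonneg (linearEdgeProb_mem_of_kernel hK x) G
  have h0 : ∀ G : SimpleGraph (Fin n), 0 ≤ linearGraphProb n d p r G := fun G =>
    integral_nonneg fun x => graphWeight_nonneg (linearEdgeProb_mem_of_kernel hK x) G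
  rw [Measure.real, rggLaw, Measure.finsetSum_apply, ENNReal.toReal_sum]
  · refine Finset.sum_congr rfl fun G _ => ?_
    rw [Measure.smul_apply, h1, smul_eq_mul, Measure.dirac_apply' _ (Set.toFinite S).measurableSet]
    by_cases hG : G ∈ S
    · simp [hG, ENNReal.toReal_ofReal (h0 G)]
    · simp [hG]
  · intro G _
    rw [Measure.smul_apply, h1, smul_eq_mul, Measure.dirac_apply' _ (Set.toFinite S).measurableSet]
    refine ENNReal.mul_ne_top ENNReal.ofReal_ne_top ?_
    by_cases hG : G ∈ S <;> simp [hG]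

theorem edgeDensity_eq [NeZero d] (hK : ∀ t : Set.Icc (-1 : ℝ) 1, (K t : ℝ) = p + r * t) :
    (edgeDensity d K : ℝ) = p := by
  change ∫ x, ∫ y, (K (sphereInner x y) : ℝ) ∂(sphereUniform d) ∂(sphereUniform d) = p
  simp only [hK]
  have : ∀ x : UnitSphere d, ∫ y, (p + r * (sphereInner x y : ℝ)) ∂(sphereUniform d) = p := by
    intro x
    have h := integral_sphere_inner d (x : EuclideanSpace ℝ (Fin d))
    simp only [sphereInner]
    rw [integral_add (integrable_const _) (integrable_of_continuous_compact (by fun_prop)),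
      integral_const_mul, h]
    simp
  simp [this]

theorem card_filter_vertexPairs (G : SimpleGraph (Fin n))
    [DecidablePred fun e : Fin n × Fin n => G.Adj e.1 e.2] :
    ((vertexPairs n).filter fun e => G.Adj e.1 e.2).card = G.edgeSet.ncard := by
  rw [← Set.ncard_coe_finset]
  refine Set.ncard_congr (fun e _ => s(e.1, e.2)) ?_ ?_ ?_
  · intro e he
    simpa using (Finset.mem_filter.1 (Finset.mem_coe.1 he)).2
  · rintro ⟨a, b⟩ ⟨a', b'⟩ h h' heq
    simp only [Finset.coe_filter, Set.mem_ofPred_eq, mem_vertexPairs] at h h'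
    rcases Sym2.eq_iff.1 heq with h2 | h2
    · exact Prod.ext h2.1 h2.2
    · exfalso
      simp only at h2
      rw [h2.1, h2.2] at h
      exact absurd h.1 h'.1.le.not_gt
  · intro e he
    induction e with
    | _ u v =>
      have hadj : G.Adj u v := by simpa using he
      rcases lt_or_gt_of_ne hadj.ne with h | h
      · exact ⟨(u, v), by simp [mem_vertexPairs, h, hadj], rfl⟩
      · exact ⟨(v, u), by simp [mem_vertexPairs, h, hadj.symm], Sym2.eq_swap⟩

theorem card_vertexPairs (n : ℕ) : (vertexPairs n).card = n.choose 2 := by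
  have h := card_filter_vertexPairs (⊤ : SimpleGraph (Fin n))
  have h2 : ∀ e ∈ vertexPairs n, (⊤ : SimpleGraph (Fin n)).Adj e.1 e.2 := fun e he => by
    simpa using (mem_vertexPairs.1 he).ne
  rw [Finset.filter_true_of_mem h2, SimpleGraph.edgeSet_top, Sym2.ncard_diagSet_compl] at h
  simpa using h

open Classical in
theorem binomialRandom_real (q : unitInterval) (hq : (q : ℝ) = p) (S : Set (SimpleGraph (Fin n))) :
    (SimpleGraph.binomialRandom (Fin n) q).real S =
      ∑ G : SimpleGraph (Fin n), if G ∈ S then graphWeight (fun _ => p) G else 0 := by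
  rw [← Finset.sum_filter]
  have hS : S = ((Finset.univ.filter fun G => G ∈ S : Finset (SimpleGraph (Fin n))) :
      Set (SimpleGraph (Fin n))) := by ext; simp
  conv_lhs => rw [hS]
  rw [← sum_measureReal_singleton]
  refine Finset.sum_congr rfl fun G _ => ?_
  rw [Measure.real, SimpleGraph.binomialRandom_singleton, graphWeight, Finset.prod_ite,
    Finset.prod_const, Finset.prod_const, card_filter_vertexPairs, Finset.filter_not,
    Finset.card_sdiff_of_subset (Finset.filter_subset _ _), card_filter_vertexPairs, card_vertexPairs]
  simp [hq]

end Law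

/-! ### Total variation distance -/

theorem tvDist_le_of_forall {Ω : Type*} [MeasurableSpace Ω] {μ ν : Measure Ω} {c : ℝ}
    (h : ∀ S : Set Ω, |μ.real S - ν.real S| ≤ c) : tvDist μ ν ≤ c :=
  have : Nonempty {S : Set Ω // MeasurableSet S} := ⟨⟨∅, MeasurableSet.empty⟩⟩
  ciSup_le fun S => h S

theorem tvDist_nonneg {Ω : Type*} [MeasurableSpace Ω] (μ ν : Measure Ω) : 0 ≤ tvDist μ ν :=
  Real.iSup_nonneg fun _ => abs_nonneg _

theorem le_tvDist {Ω : Type*} [MeasurableSpace Ω] {μ ν : Measure Ω} {c : ℝ}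
    (h : ∀ S : Set Ω, |μ.real S - ν.real S| ≤ c) {S : Set Ω} (hS : MeasurableSet S) :
    |μ.real S - ν.real S| ≤ tvDist μ ν :=
  le_ciSup (f := fun S : {S : Set Ω // MeasurableSet S} => |μ.real S - ν.real S|)
    ⟨c, by rintro _ ⟨S, rfl⟩; exact h S⟩ ⟨S, hS⟩

section Linear

variable {n d : ℕ} [NeZero d] {p r : ℝ} {K : RGGKernel}

theorem sum_linearGraphProb : ∑ G : SimpleGraph (Fin n), linearGraphProb n d p r G = 1 := by
  unfold linearGraphProb
  rw [← integral_finsetSum]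
  · simp [sum_graphWeight]
  · exact fun G _ => integrable_of_continuous_compact (by fun_prop)

open Classical in
theorem rgg_real_sub_real (hK : ∀ t : Set.Icc (-1 : ℝ) 1, (K t : ℝ) = p + r * t)
    (S : Set (SimpleGraph (Fin n))) :
    (rggLaw n d K).real S - (SimpleGraph.binomialRandom (Fin n) (edgeDensity d K)).real S =
      ∑ G : SimpleGraph (Fin n), (if G ∈ S then
        linearGraphProb n d p r G - graphWeight (fun _ => p) G else 0) := by
  rw [rggLaw_real hK, binomialRandom_real _ (edgeDensity_eq hK), ← Finset.sum_sub_distrib]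
  refine Finset.sum_congr rfl fun G _ => ?_
  split_ifs <;> simp

theorem rggTV_le_sum (hK : ∀ t : Set.Icc (-1 : ℝ) 1, (K t : ℝ) = p + r * t) :
    rggTV n d K ≤ ∑ G : SimpleGraph (Fin n),
      |linearGraphProb n d p r G - graphWeight (fun _ => p) G| := by
  classical
  refine tvDist_le_of_forall fun S => ?_
  rw [rgg_real_sub_real hK]
  refine (Finset.abs_sum_le_sum_abs _ _).trans (Finset.sum_le_sum fun G _ => ?_)
  split_ifs
  · exact le_rfl
  · simp

theorem abs_rgg_real_sub_real_le_one (hp2 : p ≤ 1 / 2) (hr : 0 ≤ r) (hrp : r ≤ p)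
    (hK : ∀ t : Set.Icc (-1 : ℝ) 1, (K t : ℝ) = p + r * t) (S : Set (SimpleGraph (Fin n))) :
    |(rggLaw n d K).real S -
      (SimpleGraph.binomialRandom (Fin n) (edgeDensity d K)).real S| ≤ 1 := by
  classical
  have h1 : 0 ≤ (rggLaw n d K).real S ∧ (rggLaw n d K).real S ≤ 1 := by
    refine ⟨measureReal_nonneg, ?_⟩
    rw [rggLaw_real hK, ← sum_linearGraphProb (n := n) (d := d) (p := p) (r := r)]
    refine Finset.sum_le_sum fun G _ => ?_
    split_ifs
    · exact le_rfl
    · exact linearGraphProb_nonneg hp2 hr hrp G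
  have h2 : (SimpleGraph.binomialRandom (Fin n) (edgeDensity d K)).real S ≤ 1 := measureReal_le_one
  have h3 : 0 ≤ (SimpleGraph.binomialRandom (Fin n) (edgeDensity d K)).real S := measureReal_nonneg
  rw [abs_le]
  constructor <;> linarith

theorem rggTV_le_one (hp2 : p ≤ 1 / 2) (hr : 0 ≤ r) (hrp : r ≤ p)
    (hK : ∀ t : Set.Icc (-1 : ℝ) 1, (K t : ℝ) = p + r * t) : rggTV n d K ≤ 1 :=
  tvDist_le_of_forall (abs_rgg_real_sub_real_le_one hp2 hr hrp hK)

open Classical in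
/-- Chebyshev's inequality, applied to a statistic `T` under both laws. -/
theorem rggTV_ge_of_statistic (hp : 0 < p) (hp2 : p ≤ 1 / 2) (hr : 0 ≤ r) (hrp : r ≤ p)
    (hK : ∀ t : Set.Icc (-1 : ℝ) 1, (K t : ℝ) = p + r * t) (T : SimpleGraph (Fin n) → ℝ)
    {m : ℝ} (hm : 0 < m) :
    1 - (∑ G, linearGraphProb n d p r G * (T G - m) ^ 2) / (m / 2) ^ 2 -
      (∑ G, graphWeight (fun _ => p) G * T G ^ 2) / (m / 2) ^ 2 ≤ rggTV n d K := by
  set S : Set (SimpleGraph (Fin n)) := {G | m / 2 ≤ T G}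
  have h := le_tvDist (abs_rgg_real_sub_real_le_one (n := n) (d := d) hp2 hr hrp hK)
    (Set.toFinite S).measurableSet
  refine le_trans ?_ ((le_abs_self _).trans h)
  rw [rggLaw_real hK, binomialRandom_real _ (edgeDensity_eq hK)]
  have hm2 : 0 < (m / 2) ^ 2 := by positivity
  have h1 : 1 - (∑ G, linearGraphProb n d p r G * (T G - m) ^ 2) / (m / 2) ^ 2 ≤
      ∑ G : SimpleGraph (Fin n), if G ∈ S then linearGraphProb n d p r G else 0 := by
    rw [← sum_linearGraphProb (n := n) (d := d) (p := p) (r := r), Finset.sum_div,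
      ← Finset.sum_sub_distrib]
    refine Finset.sum_le_sum fun G _ => ?_
    have h0 := linearGraphProb_nonneg (n := n) (d := d) hp2 hr hrp G
    split_ifs with hG
    · have : 0 ≤ linearGraphProb n d p r G * (T G - m) ^ 2 / (m / 2) ^ 2 := by positivity
      linarith
    · rw [sub_nonpos, le_div_iff₀ hm2]
      refine mul_le_mul_of_nonneg_left ?_ h0
      have : T G < m / 2 := not_le.1 hG
      nlinarith
  have h2 : (∑ G : SimpleGraph (Fin n), if G ∈ S then graphWeight (fun _ => p) G else 0) ≤
      (∑ G, graphWeight (fun _ => p) G * T G ^ 2) / (m / 2) ^ 2 := by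
    rw [Finset.sum_div]
    refine Finset.sum_le_sum fun G _ => ?_
    have h0 : 0 ≤ graphWeight (fun _ => p) G :=
      (graphWeight_const_pos hp (by linarith) G).le
    split_ifs with hG
    · rw [le_div_iff₀ hm2]
      refine mul_le_mul_of_nonneg_left ?_ h0
      have : m / 2 ≤ T G := hG
      nlinarith
    · positivity
  linarith

/-! ### The truncated second moment -/

open Classical in
/-- The mean, under the Erdős–Rényi law, of a product of two likelihood ratios of product form. -/
theorem sum_graphWeight_mul_div {n : ℕ} {p : ℝ} (hp : 0 < p) (hp1 : p < 1)
    (q q' : Fin n × Fin n → ℝ) :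
    ∑ G : SimpleGraph (Fin n), graphWeight q G * graphWeight q' G / graphWeight (fun _ => p) G =
      ∏ e ∈ vertexPairs n, (1 + (q e - p) * (q' e - p) / (p * (1 - p))) := by
  have h : ∀ G : SimpleGraph (Fin n),
      graphWeight q G * graphWeight q' G / graphWeight (fun _ => p) G =
      ∏ e ∈ vertexPairs n, (if G.Adj e.1 e.2 then q e * q' e / p
        else (1 - q e) * (1 - q' e) / (1 - p)) := by
    intro G
    unfold graphWeight
    rw [← Finset.prod_mul_distrib, ← Finset.prod_div_distrib]
    refine Finset.prod_congr rfl fun e _ => ?_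
    split_ifs <;> rfl
  simp only [h]
  rw [sum_graph_prod]
  refine Finset.prod_congr rfl fun e _ => ?_
  have h1 : 1 - p ≠ 0 := by linarith
  field_simp
  ring

/-- The second moment method, truncated to an event `A` of the latent points: the mass of the
complement of `A` is dropped, and the rest is compared in `L²` of the Erdős–Rényi law. -/
theorem rggTV_le_truncated (hp : 0 < p) (hp2 : p < 1 / 2) (hr : 0 ≤ r) (hrp : r ≤ p)
    (hK : ∀ t : Set.Icc (-1 : ℝ) 1, (K t : ℝ) = p + r * t)
    {A : Set (Fin n → UnitSphere d)} (hA : MeasurableSet A) {M : ℝ}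
    (hM : ∀ x ∈ A, ∫ y in A, ∏ e ∈ vertexPairs n,
      (1 + r ^ 2 / (p * (1 - p)) * (gram x e.1 e.2 * gram y e.1 e.2)) ∂(latentLaw (Fin n) d) ≤ M) :
    rggTV n d K ≤ (1 - (latentLaw (Fin n) d).real A) +
      Real.sqrt (M * (latentLaw (Fin n) d).real A - 2 * (latentLaw (Fin n) d).real A + 1) := by
  set π := latentLaw (Fin n) d
  set L : SimpleGraph (Fin n) → ℝ := fun G => ∫ x in A, graphWeight (linearEdgeProb p r x) G ∂π
    with hL
  set w : SimpleGraph (Fin n) → ℝ := fun G => graphWeight (fun _ => p) G with hw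
  have hw0 : ∀ G, 0 < w G := fun G => graphWeight_const_pos hp (by linarith) G
  have hint : ∀ G, Integrable (fun x => graphWeight (linearEdgeProb p r x) G) π := fun G =>
    integrable_of_continuous_compact (by fun_prop)
  have hW0 : ∀ x G, 0 ≤ graphWeight (linearEdgeProb (n := n) (d := d) p r x) G := fun x G =>
    graphWeight_nonneg (fun e => ⟨(linearEdgeProb_mem hp2.le hr hrp x e).1,
      (linearEdgeProb_mem hp2.le hr hrp x e).2.2⟩) G
  have hsumL : ∑ G, L G = π.real A := by
    rw [hL, ← integral_finsetSum _ fun G _ => (hint G).integrableOn]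
    simp [sum_graphWeight]
  have hle : ∀ G, L G ≤ linearGraphProb n d p r G := fun G =>
    setIntegral_le_integral (hint G) (Eventually.of_forall fun x => hW0 x G)
  refine (rggTV_le_sum hK).trans ?_
  have h1 : ∑ G : SimpleGraph (Fin n), |linearGraphProb n d p r G - graphWeight (fun _ => p) G| ≤
      ∑ G, (linearGraphProb n d p r G - L G) + ∑ G, |L G - w G| := by
    rw [← Finset.sum_add_distrib]
    refine Finset.sum_le_sum fun G _ => ?_
    calc _ ≤ |linearGraphProb n d p r G - L G| + |L G - w G| := abs_sub_le _ _ _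
      _ = _ := by rw [abs_of_nonneg (sub_nonneg.2 (hle G))]
  refine h1.trans (add_le_add (le_of_eq ?_) ?_)
  · rw [Finset.sum_sub_distrib, sum_linearGraphProb, hsumL]
  have h2 : ∑ G, L G ^ 2 / w G ≤ M * π.real A := by
    have h3 : ∀ G, L G ^ 2 / w G = ∫ x in A, (∫ y in A, graphWeight (linearEdgeProb p r x) G *
        graphWeight (linearEdgeProb p r y) G / w G ∂π) ∂π := by
      intro G
      simp only [integral_div, integral_const_mul, integral_mul_const, hL, sq]
    simp only [h3]
    have hc : ∀ G, Continuous fun x : Fin n → UnitSphere d =>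
        ∫ y in A, graphWeight (linearEdgeProb p r x) G *
        graphWeight (linearEdgeProb p r y) G / w G ∂π := by
      intro G
      simp only [integral_div, integral_const_mul]
      fun_prop
    rw [← integral_finsetSum _ fun G _ => (integrable_of_continuous_compact (hc G)).integrableOn]
    calc _ ≤ ∫ x in A, M ∂π := by
          refine setIntegral_mono_on (integrable_of_continuous_compact
            (by fun_prop)).integrableOn (integrable_const M).integrableOn hA fun x hx => ?_
          rw [← integral_finsetSum _ fun G _ =>
            (integrable_of_continuous_compact (by fun_prop)).integrableOn]
          refine le_of_eq_of_le ?_ (hM x hx)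
          refine integral_congr_ae (Eventually.of_forall fun y => ?_)
          simp only [hw]
          rw [sum_graphWeight_mul_div hp (by linarith)]
          refine Finset.prod_congr rfl fun e _ => ?_
          simp only [linearEdgeProb]
          ring
      _ = M * π.real A := by simp [mul_comm]
  have h4 : (∑ G, |L G - w G|) ^ 2 ≤ M * π.real A - 2 * π.real A + 1 := by
    have h5 := Finset.sum_sq_le_sum_mul_sum_of_sq_le_mul Finset.univ
      (r := fun G => |L G - w G|) (f := fun G => (L G - w G) ^ 2 / w G) (g := w)
      (fun G _ => div_nonneg (sq_nonneg _) (hw0 G).le) (fun G _ => (hw0 G).le)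
      (fun G _ => by rw [sq_abs, div_mul_cancel₀ _ (hw0 G).ne'])
    refine h5.trans ?_
    rw [sum_graphWeight, mul_one]
    have h6 : ∀ G, (L G - w G) ^ 2 / w G = L G ^ 2 / w G - 2 * L G + w G := by
      intro G
      have := (hw0 G).ne'
      field_simp
      ring
    simp only [h6]
    rw [Finset.sum_add_distrib, Finset.sum_sub_distrib, ← Finset.mul_sum, hsumL, sum_graphWeight]
    linarith
  exact Real.le_sqrt_of_sq_le h4

end Linear

/-! ### Moments of signed triangles -/

section SignedEdges

variable {n : ℕ}

open Classical in
/-- The indicator of the edge `e`, centered by `p`. -/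
noncomputable def signedEdge (p : ℝ) (G : SimpleGraph (Fin n)) (e : Fin n × Fin n) : ℝ :=
  if G.Adj e.1 e.2 then 1 - p else -p

/-- The moment of order `t` of a signed edge of probability `q`. -/
def signedMoment (p q : ℝ) (t : ℕ) : ℝ := q * (1 - p) ^ t + (1 - q) * (-p) ^ t

/-- The mean of the product of the signed edges `e` and `e'`, for independent edges. -/
noncomputable def pairMoment (p : ℝ) (q : Fin n × Fin n → ℝ) (e e' : Fin n × Fin n) : ℝ :=
  if e = e' then signedMoment p (q e) 2 else (q e - p) * (q e' - p)

theorem signedMoment_one (p q : ℝ) : signedMoment p q 1 = q - p := by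
  unfold signedMoment
  ring

theorem signedMoment_two_mem {p q : ℝ} (hp : 0 ≤ p) (hp2 : p ≤ 1) (hq : 0 ≤ q) (hq1 : q ≤ 1)
    (hq2 : q ≤ 2 * p) : 0 ≤ signedMoment p q 2 ∧ signedMoment p q 2 ≤ 3 * p := by
  unfold signedMoment
  constructor
  · have : 0 ≤ 1 - q := by linarith
    positivity
  · nlinarith [mul_nonneg hp hq, mul_nonneg hp (sub_nonneg.2 hp2), mul_nonneg hq (sub_nonneg.2 hp2),
      mul_nonneg hq hp]

theorem sum_graphWeight_mul_signedEdge_pow (p : ℝ) (q : Fin n × Fin n → ℝ)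
    {D : Finset (Fin n × Fin n)} (hD : D ⊆ vertexPairs n) (t : Fin n × Fin n → ℕ) :
    ∑ G : SimpleGraph (Fin n), graphWeight q G * ∏ e ∈ D, signedEdge p G e ^ t e =
      ∏ e ∈ D, signedMoment p (q e) (t e) := by
  classical
  have h : ∀ G : SimpleGraph (Fin n), graphWeight q G * ∏ e ∈ D, signedEdge p G e ^ t e =
      ∏ e ∈ vertexPairs n, (if G.Adj e.1 e.2 then q e * (if e ∈ D then (1 - p) ^ t e else 1)
        else (1 - q e) * (if e ∈ D then (-p) ^ t e else 1)) := by
    intro G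
    have h1 : ∏ e ∈ D, signedEdge p G e ^ t e =
        ∏ e ∈ vertexPairs n, (if e ∈ D then signedEdge p G e ^ t e else 1) := by
      rw [Finset.prod_ite_mem, Finset.inter_eq_right.2 hD]
    rw [h1, graphWeight, ← Finset.prod_mul_distrib]
    refine Finset.prod_congr rfl fun e _ => ?_
    unfold signedEdge
    split_ifs <;> simp
  simp only [h]
  have h2 := sum_graph_prod (n := n)
    (fun e => q e * (if e ∈ D then (1 - p) ^ t e else 1))
    (fun e => (1 - q e) * (if e ∈ D then (-p) ^ t e else 1))
  refine h2.trans ?_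
  have h3 : ∏ e ∈ D, signedMoment p (q e) (t e) =
      ∏ e ∈ vertexPairs n, (if e ∈ D then signedMoment p (q e) (t e) else 1) := by
    rw [Finset.prod_ite_mem, Finset.inter_eq_right.2 hD]
  rw [h3]
  refine Finset.prod_congr rfl fun e _ => ?_
  unfold signedMoment
  split_ifs <;> ring

theorem prod_pair_pow {α : Type*} [DecidableEq α] (e e' : α) (f : α → ℝ) :
    ∏ u ∈ ({e, e'} : Finset α), f u ^ (if e = e' then 2 else 1) = f e * f e' := by
  by_cases h : e = e'
  · simp [h, sq]
  · simp [h, Finset.prod_pair h]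

theorem prod_pair_signedMoment (p : ℝ) (q : Fin n × Fin n → ℝ) (e e' : Fin n × Fin n) :
    ∏ u ∈ ({e, e'} : Finset (Fin n × Fin n)), signedMoment p (q u) (if e = e' then 2 else 1) =
      pairMoment p q e e' := by
  unfold pairMoment
  by_cases h : e = e'
  · simp [h]
  · simp [h, Finset.prod_pair h, signedMoment_one]

/-- The mixed moment of three pairs of signed edges without edges in common. -/
theorem sum_graphWeight_mul_six (p : ℝ) (q : Fin n × Fin n → ℝ) {e₁ e₁' e₂ e₂' e₃ e₃' : Fin n × Fin n}
    (hv : ({e₁, e₁'} ∪ {e₂, e₂'} ∪ {e₃, e₃'} : Finset (Fin n × Fin n)) ⊆ vertexPairs n)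
    (h12 : Disjoint ({e₁, e₁'} : Finset (Fin n × Fin n)) {e₂, e₂'})
    (h13 : Disjoint ({e₁, e₁'} : Finset (Fin n × Fin n)) {e₃, e₃'})
    (h23 : Disjoint ({e₂, e₂'} : Finset (Fin n × Fin n)) {e₃, e₃'}) :
    ∑ G : SimpleGraph (Fin n), graphWeight q G *
      ((signedEdge p G e₁ * signedEdge p G e₁') * (signedEdge p G e₂ * signedEdge p G e₂') *
        (signedEdge p G e₃ * signedEdge p G e₃')) =
      pairMoment p q e₁ e₁' * pairMoment p q e₂ e₂' * pairMoment p q e₃ e₃' := by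
  set t : Fin n × Fin n → ℕ := fun u => if u ∈ ({e₁, e₁'} : Finset (Fin n × Fin n)) then
      (if e₁ = e₁' then 2 else 1) else if u ∈ ({e₂, e₂'} : Finset (Fin n × Fin n)) then
      (if e₂ = e₂' then 2 else 1) else (if e₃ = e₃' then 2 else 1) with ht
  have t1 : ∀ u ∈ ({e₁, e₁'} : Finset (Fin n × Fin n)), t u = if e₁ = e₁' then 2 else 1 :=
    fun u hu => if_pos hu
  have t2 : ∀ u ∈ ({e₂, e₂'} : Finset (Fin n × Fin n)), t u = if e₂ = e₂' then 2 else 1 := by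
    intro u hu
    rw [ht]
    simp only
    rw [if_neg (Finset.disjoint_right.1 h12 hu), if_pos hu]
  have t3 : ∀ u ∈ ({e₃, e₃'} : Finset (Fin n × Fin n)), t u = if e₃ = e₃' then 2 else 1 := by
    intro u hu
    rw [ht]
    simp only
    rw [if_neg (Finset.disjoint_right.1 h13 hu), if_neg (Finset.disjoint_right.1 h23 hu)]
  have hsplit : ∀ f : Fin n × Fin n → ℕ → ℝ,
      ∏ u ∈ ({e₁, e₁'} ∪ {e₂, e₂'} ∪ {e₃, e₃'} : Finset (Fin n × Fin n)), f u (t u) =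
      (∏ u ∈ ({e₁, e₁'} : Finset (Fin n × Fin n)), f u (if e₁ = e₁' then 2 else 1)) *
      (∏ u ∈ ({e₂, e₂'} : Finset (Fin n × Fin n)), f u (if e₂ = e₂' then 2 else 1)) *
      (∏ u ∈ ({e₃, e₃'} : Finset (Fin n × Fin n)), f u (if e₃ = e₃' then 2 else 1)) := by
    intro f
    rw [Finset.prod_union (Finset.disjoint_union_left.2 ⟨h13, h23⟩), Finset.prod_union h12]
    rw [Finset.prod_congr rfl fun u hu => by rw [t1 u hu],
      Finset.prod_congr (s₁ := {e₂, e₂'}) rfl fun u hu => by rw [t2 u hu],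
      Finset.prod_congr (s₁ := {e₃, e₃'}) rfl fun u hu => by rw [t3 u hu]]
  have h := sum_graphWeight_mul_signedEdge_pow p q hv t
  rw [hsplit fun u k => signedMoment p (q u) k] at h
  simp only [prod_pair_signedMoment] at h
  rw [← h]
  refine Finset.sum_congr rfl fun G _ => ?_
  rw [hsplit fun u k => signedEdge p G u ^ k]
  simp only [prod_pair_pow]

theorem sum_graphWeight_mul_three (p : ℝ) (q : Fin n × Fin n → ℝ) {e₁ e₂ e₃ : Fin n × Fin n}
    (hv : ({e₁, e₂, e₃} : Finset (Fin n × Fin n)) ⊆ vertexPairs n)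
    (h12 : e₁ ≠ e₂) (h13 : e₁ ≠ e₃) (h23 : e₂ ≠ e₃) :
    ∑ G : SimpleGraph (Fin n), graphWeight q G *
      (signedEdge p G e₁ * signedEdge p G e₂ * signedEdge p G e₃) =
      (q e₁ - p) * (q e₂ - p) * (q e₃ - p) := by
  have h := sum_graphWeight_mul_signedEdge_pow p q hv (fun _ => 1)
  have h3 : ∀ f : Fin n × Fin n → ℝ, ∏ u ∈ ({e₁, e₂, e₃} : Finset (Fin n × Fin n)), f u =
      f e₁ * f e₂ * f e₃ := by
    intro f
    rw [Finset.prod_insert (by simp [h12, h13]), Finset.prod_pair h23, mul_assoc]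
  simpa only [h3, pow_one, signedMoment_one] using h

end SignedEdges

section Triangles

variable {n d : ℕ} [NeZero d]

theorem integral_latent_triangle {F : (Fin n → UnitSphere d) → ℝ} (hF : Continuous F)
    {u v w : Fin n} (hv : ∀ x y, F (Function.update x v y) = F x)
    (hw : ∀ x y, F (Function.update x w y) = F x) (huv : u ≠ v) (hvw : v ≠ w) (huw : u ≠ w) :
    ∫ x, F x * (gram x u v * gram x v w * gram x u w) ∂(latentLaw (Fin n) d) =
      (∫ x, F x ∂(latentLaw (Fin n) d)) / d ^ 2 := by
  have h1 := integral_latent_contract (F := fun x => F x * gram x u w) (by fun_prop) (j := v)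
    (a := u) (b := w) (fun x y => by rw [hv, gram_update_of_ne x y huv hvw.symm]) huv hvw.symm
  have h2 := integral_latent_gram_sq hF hw huw
  have e1 : ∀ x : Fin n → UnitSphere d, F x * (gram x u v * gram x v w * gram x u w) =
      F x * gram x u w * (gram x u v * gram x v w) := fun x => by ring
  have e2 : ∀ x : Fin n → UnitSphere d, F x * gram x u w * gram x u w = F x * gram x u w ^ 2 :=
    fun x => by ring
  simp only [e1]
  rw [h1]
  simp only [e2]
  rw [h2, div_div, sq]

theorem integral_latent_two_paths {F : (Fin n → UnitSphere d) → ℝ} (hF : Continuous F)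
    {u v w w' : Fin n} (hw : ∀ x y, F (Function.update x w y) = F x)
    (hw' : ∀ x y, F (Function.update x w' y) = F x) (huw : u ≠ w) (hvw : v ≠ w)
    (huw' : u ≠ w') (hvw' : v ≠ w') (hww' : w ≠ w') :
    ∫ x, F x * ((gram x u w * gram x w v) * (gram x u w' * gram x w' v)) ∂(latentLaw (Fin n) d) =
      (∫ x, F x * gram x u v ^ 2 ∂(latentLaw (Fin n) d)) / d ^ 2 := by
  have h1 := integral_latent_contract (F := fun x => F x * (gram x u w' * gram x w' v))
    (by fun_prop) (j := w) (a := u) (b := v) (fun x y => by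
      rw [hw, gram_update_of_ne x y huw hww'.symm, gram_update_of_ne x y hww'.symm hvw]) huw hvw
  have h2 := integral_latent_contract (F := fun x => F x * gram x u v)
    (by fun_prop) (j := w') (a := u) (b := v) (fun x y => by
      rw [hw', gram_update_of_ne x y huw' hvw']) huw' hvw'
  have e1 : ∀ x : Fin n → UnitSphere d,
      F x * ((gram x u w * gram x w v) * (gram x u w' * gram x w' v)) =
      F x * (gram x u w' * gram x w' v) * (gram x u w * gram x w v) := fun x => by ring
  have e2 : ∀ x : Fin n → UnitSphere d, F x * (gram x u w' * gram x w' v) * gram x u v =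
      F x * gram x u v * (gram x u w' * gram x w' v) := fun x => by ring
  have e3 : ∀ x : Fin n → UnitSphere d, F x * gram x u v * gram x u v = F x * gram x u v ^ 2 :=
    fun x => by ring
  simp only [e1]
  rw [h1]
  simp only [e2]
  rw [h2]
  simp only [e3]
  rw [div_div, sq]

theorem integral_latent_gram_sq_one {i j : Fin n} (hij : i ≠ j) :
    ∫ x, gram x i j ^ 2 ∂(latentLaw (Fin n) d) = 1 / d := by
  have h := integral_latent_gram_sq (F := fun _ : Fin n → UnitSphere d => (1 : ℝ))
    continuous_const (fun _ _ => rfl) hij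
  simpa using h

end Triangles

/-! ### The signed triangle count -/

section Moments

variable {n d : ℕ} {p r : ℝ}

/-- The mean, given the latent points, of the product of two signed triangles `u v w`, `u' v' w'`. -/
noncomputable def trianglePairMoment (p r : ℝ) (x : Fin n → UnitSphere d)
    (u v w u' v' w' : Fin n) : ℝ :=
  pairMoment p (linearEdgeProb p r x) (u, v) (u', v') *
    pairMoment p (linearEdgeProb p r x) (v, w) (v', w') *
    pairMoment p (linearEdgeProb p r x) (u, w) (u', w')

theorem continuous_pairMoment (p r : ℝ) (e e' : Fin n × Fin n) :
    Continuous fun x : Fin n → UnitSphere d => pairMoment p (linearEdgeProb p r x) e e' := by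
  unfold pairMoment signedMoment
  split_ifs <;> fun_prop

theorem pairMoment_self_mem (hp2 : p ≤ 1 / 2) (hr : 0 ≤ r) (hrp : r ≤ p)
    (x : Fin n → UnitSphere d) (e : Fin n × Fin n) :
    0 ≤ signedMoment p (linearEdgeProb p r x e) 2 ∧
      signedMoment p (linearEdgeProb p r x e) 2 ≤ 3 * p := by
  obtain ⟨h1, h2, h3⟩ := linearEdgeProb_mem hp2 hr hrp x e
  exact signedMoment_two_mem (by linarith) (by linarith) h1 h3 h2

theorem pairMoment_of_ne (x : Fin n → UnitSphere d) {e e' : Fin n × Fin n} (h : e ≠ e') :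
    pairMoment p (linearEdgeProb p r x) e e' = r ^ 2 * (gram x e.1 e.2 * gram x e'.1 e'.2) := by
  rw [pairMoment, if_neg h, linearEdgeProb, linearEdgeProb]
  ring

theorem pairMoment_self (x : Fin n → UnitSphere d) (e : Fin n × Fin n) :
    pairMoment p (linearEdgeProb p r x) e e = signedMoment p (linearEdgeProb p r x e) 2 := by
  rw [pairMoment, if_pos rfl]

variable [NeZero d]

/-- Two triangles with one common edge `u v`. -/
theorem integral_common_edge_le (hp2 : p ≤ 1 / 2) (hr : 0 ≤ r) (hrp : r ≤ p) {u v w w' : Fin n}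
    (huv : u ≠ v) (huw : u ≠ w) (hvw : v ≠ w) (huw' : u ≠ w') (hvw' : v ≠ w') (hww' : w ≠ w')
    {e : Fin n × Fin n} (he : e = (u, v) ∨ e = (v, u)) :
    ∫ x, signedMoment p (linearEdgeProb p r x e) 2 *
      ((gram x u w * gram x w v) * (gram x u w' * gram x w' v)) ∂(latentLaw (Fin n) d) ≤
      3 * p / d ^ 3 := by
  have hd : (0 : ℝ) < d := Nat.cast_pos.2 (NeZero.pos d)
  have hupd : ∀ k, u ≠ k → v ≠ k → ∀ (x : Fin n → UnitSphere d) y,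
      signedMoment p (linearEdgeProb p r (Function.update x k y) e) 2 =
      signedMoment p (linearEdgeProb p r x e) 2 := by
    intro k h1 h2 x y
    unfold linearEdgeProb
    rcases he with rfl | rfl
    · simp only [gram_update_of_ne x y h1 h2]
    · simp only [gram_update_of_ne x y h2 h1]
  have hc : Continuous fun x : Fin n → UnitSphere d =>
      signedMoment p (linearEdgeProb p r x e) 2 := by
    unfold signedMoment
    fun_prop
  rw [integral_latent_two_paths hc (hupd w huw hvw) (hupd w' huw' hvw') huw hvw huw' hvw' hww']
  have h : ∫ x, signedMoment p (linearEdgeProb p r x e) 2 * gram x u v ^ 2 ∂(latentLaw (Fin n) d) ≤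
      3 * p * (1 / d) := by
    rw [← integral_latent_gram_sq_one (d := d) huv, ← integral_const_mul]
    refine integral_mono (integrable_of_continuous_compact (by fun_prop))
      (integrable_of_continuous_compact (by fun_prop)) fun x => ?_
    exact mul_le_mul_of_nonneg_right (pairMoment_self_mem hp2 hr hrp x e).2 (sq_nonneg _)
  calc _ ≤ 3 * p * (1 / d) / d ^ 2 := by gcongr
    _ = 3 * p / d ^ 3 := by field_simp

/-- Two triangles with at most one common vertex, which is then `u`. -/
theorem integral_two_triangles {u v w u' v' w' : Fin n} (huv : u ≠ v) (hvw : v ≠ w) (huw : u ≠ w)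
    (huv' : u' ≠ v') (hvw' : v' ≠ w') (huw' : u' ≠ w') (h1 : u' ≠ v) (h2 : v' ≠ v) (h3 : w' ≠ v)
    (h4 : u' ≠ w) (h5 : v' ≠ w) (h6 : w' ≠ w) :
    ∫ x, (gram x u' v' * gram x v' w' * gram x u' w') *
      (gram x u v * gram x v w * gram x u w) ∂(latentLaw (Fin n) d) = 1 / d ^ 4 := by
  rw [integral_latent_triangle (F := fun x => gram x u' v' * gram x v' w' * gram x u' w')
    (by fun_prop) (fun x y => by
      rw [gram_update_of_ne x y h1 h2, gram_update_of_ne x y h2 h3, gram_update_of_ne x y h1 h3])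
    (fun x y => by
      rw [gram_update_of_ne x y h4 h5, gram_update_of_ne x y h5 h6, gram_update_of_ne x y h4 h6])
    huv hvw huw]
  have h := integral_latent_triangle (d := d) (F := fun _ : Fin n → UnitSphere d => (1 : ℝ))
    continuous_const (fun _ _ => rfl) (fun _ _ => rfl) huv' hvw' huw'
  simp only [one_mul] at h
  rw [h]
  simp only [integral_const, probReal_univ, smul_eq_mul, mul_one]
  rw [div_div]
  congr 1
  ring

open Classical in
/-- Two triangles whose vertices can coincide only in corresponding positions: the product of their
means, and a correction for common edges. -/
theorem integral_trianglePairMoment_le (hp2 : p ≤ 1 / 2) (hr : 0 ≤ r) (hrp : r ≤ p)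
    {u v w u' v' w' : Fin n} (huv : u ≠ v) (hvw : v ≠ w) (huw : u ≠ w)
    (huv' : u' ≠ v') (hvw' : v' ≠ w') (huw' : u' ≠ w') (h1 : u' ≠ v) (h2 : u' ≠ w)
    (h3 : v' ≠ u) (h4 : v' ≠ w) (h5 : w' ≠ u) (h6 : w' ≠ v) :
    ∫ x, trianglePairMoment p r x u v w u' v' w' ∂(latentLaw (Fin n) d) ≤
      r ^ 6 / d ^ 4 + (if u = u' ∧ v = v' ∧ w = w' then 27 * p ^ 3 else 0) +
      ((if u = u' ∧ v = v' then 3 * p * r ^ 4 / d ^ 3 else 0) +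
       (if v = v' ∧ w = w' then 3 * p * r ^ 4 / d ^ 3 else 0) +
       (if u = u' ∧ w = w' then 3 * p * r ^ 4 / d ^ 3 else 0)) := by
  have hd : (0 : ℝ) < d := Nat.cast_pos.2 (NeZero.pos d)
  have hp : 0 ≤ p := hr.trans hrp
  have hA : 0 ≤ r ^ 6 / (d : ℝ) ^ 4 := by positivity
  have hB : 0 ≤ 3 * p * r ^ 4 / (d : ℝ) ^ 3 := by positivity
  have hC : 0 ≤ 27 * p ^ 3 := by positivity
  unfold trianglePairMoment
  -- With at most one common vertex, no edge is shared and the integral factorizes.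
  have hfree : ∀ {f : (Fin n → UnitSphere d) → ℝ}, (∀ x, f x = r ^ 6 *
      ((gram x u' v' * gram x v' w' * gram x u' w') *
      (gram x u v * gram x v w * gram x u w))) → v ≠ v' → w ≠ w' →
      ∫ x, f x ∂(latentLaw (Fin n) d) = r ^ 6 / d ^ 4 := by
    intro f hf hv hw
    simp only [hf]
    rw [integral_const_mul, integral_two_triangles huv hvw huw huv' hvw' huw' h1 hv.symm h6 h2 h4
      hw.symm]
    ring
  by_cases hu : u = u' <;> by_cases hv : v = v' <;> by_cases hw : w = w'
  · subst hu hv hw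
    simp only [pairMoment_self, and_self, if_true]
    have : ∫ x, signedMoment p (linearEdgeProb p r x (u, v)) 2 *
        signedMoment p (linearEdgeProb p r x (v, w)) 2 *
        signedMoment p (linearEdgeProb p r x (u, w)) 2 ∂(latentLaw (Fin n) d) ≤ 27 * p ^ 3 := by
      have hle : ∫ x, signedMoment p (linearEdgeProb p r x (u, v)) 2 *
          signedMoment p (linearEdgeProb p r x (v, w)) 2 *
          signedMoment p (linearEdgeProb p r x (u, w)) 2 ∂(latentLaw (Fin n) d) ≤
          ∫ _ : Fin n → UnitSphere d, (3 * p) * (3 * p) * (3 * p) ∂(latentLaw (Fin n) d) := by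
        refine integral_mono (integrable_of_continuous_compact (by
          unfold signedMoment
          fun_prop)) (integrable_const _) fun x => ?_
        have k1 := pairMoment_self_mem hp2 hr hrp x (u, v)
        have k2 := pairMoment_self_mem hp2 hr hrp x (v, w)
        have k3 := pairMoment_self_mem hp2 hr hrp x (u, w)
        exact mul_le_mul (mul_le_mul k1.2 k2.2 k2.1 (by positivity)) k3.2 k3.1 (by positivity)
      refine hle.trans (le_of_eq ?_)
      simp
      ring
    linarith
  · subst hu hv
    have e : ∀ x : Fin n → UnitSphere d, pairMoment p (linearEdgeProb p r x) (u, v) (u, v) *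
        pairMoment p (linearEdgeProb p r x) (v, w) (v, w') *
        pairMoment p (linearEdgeProb p r x) (u, w) (u, w') =
        r ^ 4 * (signedMoment p (linearEdgeProb p r x (u, v)) 2 *
          ((gram x u w * gram x w v) * (gram x u w' * gram x w' v))) := by
      intro x
      rw [pairMoment_self, pairMoment_of_ne x (by simp [hw]), pairMoment_of_ne x (by simp [hw]),
        gram_comm x w v, gram_comm x w' v]
      ring
    simp only [e, integral_const_mul, hw, and_self, and_false, if_true, if_false]
    have := integral_common_edge_le (d := d) hp2 hr hrp huv huw hvw huw' hvw' hw
      (e := (u, v)) (Or.inl rfl)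
    have := mul_le_mul_of_nonneg_left this (by positivity : 0 ≤ r ^ 4)
    have e2 : r ^ 4 * (3 * p / (d : ℝ) ^ 3) = 3 * p * r ^ 4 / d ^ 3 := by ring
    linarith
  · subst hu hw
    have e : ∀ x : Fin n → UnitSphere d, pairMoment p (linearEdgeProb p r x) (u, v) (u, v') *
        pairMoment p (linearEdgeProb p r x) (v, w) (v', w) *
        pairMoment p (linearEdgeProb p r x) (u, w) (u, w) =
        r ^ 4 * (signedMoment p (linearEdgeProb p r x (u, w)) 2 *
          ((gram x u v * gram x v w) * (gram x u v' * gram x v' w))) := by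
      intro x
      rw [pairMoment_self, pairMoment_of_ne x (by simp [hv]), pairMoment_of_ne x (by simp [hv])]
      ring
    simp only [e, integral_const_mul, hv, and_self, and_false, false_and, if_true, if_false]
    have := integral_common_edge_le (d := d) hp2 hr hrp huw huv hvw.symm huv' hvw'.symm hv
      (e := (u, w)) (Or.inl rfl)
    have := mul_le_mul_of_nonneg_left this (by positivity : 0 ≤ r ^ 4)
    have e2 : r ^ 4 * (3 * p / (d : ℝ) ^ 3) = 3 * p * r ^ 4 / d ^ 3 := by ring
    linarith
  · have := hfree (f := fun x => pairMoment p (linearEdgeProb p r x) (u, v) (u', v') *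
        pairMoment p (linearEdgeProb p r x) (v, w) (v', w') *
        pairMoment p (linearEdgeProb p r x) (u, w) (u', w')) (fun x => by
      rw [pairMoment_of_ne x (by simp [hv]), pairMoment_of_ne x (by simp [hv]),
        pairMoment_of_ne x (by simp [hw])]
      ring) hv hw
    rw [this]
    simp only [hv, hw, and_false, if_false]
    linarith
  · subst hv hw
    have e : ∀ x : Fin n → UnitSphere d, pairMoment p (linearEdgeProb p r x) (u, v) (u', v) *
        pairMoment p (linearEdgeProb p r x) (v, w) (v, w) *
        pairMoment p (linearEdgeProb p r x) (u, w) (u', w) =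
        r ^ 4 * (signedMoment p (linearEdgeProb p r x (v, w)) 2 *
          ((gram x v u * gram x u w) * (gram x v u' * gram x u' w))) := by
      intro x
      rw [pairMoment_self, pairMoment_of_ne x (by simp [hu]), pairMoment_of_ne x (by simp [hu]),
        gram_comm x v u, gram_comm x v u']
      ring
    simp only [e, integral_const_mul, hu, and_self, false_and, if_true, if_false]
    have := integral_common_edge_le (d := d) hp2 hr hrp hvw huv.symm huw.symm huv'.symm huw'.symm hu
      (e := (v, w)) (Or.inl rfl)
    have := mul_le_mul_of_nonneg_left this (by positivity : 0 ≤ r ^ 4)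
    have e2 : r ^ 4 * (3 * p / (d : ℝ) ^ 3) = 3 * p * r ^ 4 / d ^ 3 := by ring
    linarith
  · subst hv
    have e : ∀ x : Fin n → UnitSphere d, pairMoment p (linearEdgeProb p r x) (u, v) (u', v) *
        pairMoment p (linearEdgeProb p r x) (v, w) (v, w') *
        pairMoment p (linearEdgeProb p r x) (u, w) (u', w') = r ^ 6 *
        ((gram x v u' * gram x u' w' * gram x v w') * (gram x v u * gram x u w * gram x v w)) := by
      intro x
      rw [pairMoment_of_ne x (by simp [hu]), pairMoment_of_ne x (by simp [hw]),
        pairMoment_of_ne x (by simp [hw]), gram_comm x v u, gram_comm x v u']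
      ring
    simp only [e, integral_const_mul, hu, hw, and_false, false_and, if_false]
    rw [integral_two_triangles huv.symm huw hvw huv'.symm huw' hvw' h3 (Ne.symm hu) h5 hvw h2
      (Ne.symm hw)]
    rw [mul_one_div]
    linarith
  · subst hw
    have e : ∀ x : Fin n → UnitSphere d, pairMoment p (linearEdgeProb p r x) (u, v) (u', v') *
        pairMoment p (linearEdgeProb p r x) (v, w) (v', w) *
        pairMoment p (linearEdgeProb p r x) (u, w) (u', w) = r ^ 6 *
        ((gram x w u' * gram x u' v' * gram x w v') * (gram x w u * gram x u v * gram x w v)) := by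
      intro x
      rw [pairMoment_of_ne x (by simp [hu]), pairMoment_of_ne x (by simp [hv]),
        pairMoment_of_ne x (by simp [hu]), gram_comm x w u, gram_comm x w u', gram_comm x w v,
        gram_comm x w v']
      ring
    simp only [e, integral_const_mul, hu, hv, and_false, false_and, if_false]
    rw [integral_two_triangles huw.symm huv hvw.symm huw'.symm huv' hvw'.symm huw.symm (Ne.symm hu) h3
      hvw.symm h1 (Ne.symm hv)]
    rw [mul_one_div]
    linarith
  · have := hfree (f := fun x => pairMoment p (linearEdgeProb p r x) (u, v) (u', v') *
        pairMoment p (linearEdgeProb p r x) (v, w) (v', w') *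
        pairMoment p (linearEdgeProb p r x) (u, w) (u', w')) (fun x => by
      rw [pairMoment_of_ne x (by simp [hv]), pairMoment_of_ne x (by simp [hv]),
        pairMoment_of_ne x (by simp [hw])]
      ring) hv hw
    rw [this]
    simp only [hu, hv, hw, and_false, if_false]
    linarith

end Moments

section Detection

variable {n N d : ℕ} {p r : ℝ} {a b c : Fin N → Fin n}

/-- The signed number of triangles with one vertex in each of the three families `a`, `b`, `c`. -/
noncomputable def signedTriangles (p : ℝ) (a b c : Fin N → Fin n) (G : SimpleGraph (Fin n)) : ℝ :=
  ∑ t : Fin N × Fin N × Fin N, signedEdge p G (a t.1, b t.2.1) *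
    signedEdge p G (b t.2.1, c t.2.2) * signedEdge p G (a t.1, c t.2.2)

theorem sum_linearGraphProb_mul [NeZero d] (f : SimpleGraph (Fin n) → ℝ) :
    ∑ G : SimpleGraph (Fin n), linearGraphProb n d p r G * f G =
      ∫ x, ∑ G : SimpleGraph (Fin n), graphWeight (linearEdgeProb p r x) G * f G
        ∂(latentLaw (Fin n) d) := by
  rw [integral_finsetSum _ fun G _ => integrable_of_continuous_compact (by fun_prop)]
  exact Finset.sum_congr rfl fun G _ => (integral_mul_const _ _).symm

theorem linearGraphProb_zero [NeZero d] (G : SimpleGraph (Fin n)) :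
    linearGraphProb n d p 0 G = graphWeight (fun _ => p) G := by
  have h : ∀ x : Fin n → UnitSphere d, linearEdgeProb p 0 x = fun _ => p := fun x => by
    ext e
    simp [linearEdgeProb]
  simp [linearGraphProb, h]

theorem sum_linearGraphProb_mul_signedTriangles [NeZero d] (hab : ∀ i j, a i < b j)
    (hbc : ∀ j k, b j < c k) :
    ∑ G : SimpleGraph (Fin n), linearGraphProb n d p r G * signedTriangles p a b c G =
      N ^ 3 * r ^ 3 / d ^ 2 := by
  have hac : ∀ i k, a i < c k := fun i k => (hab i i).trans (hbc i k)
  rw [sum_linearGraphProb_mul]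
  have h : ∀ x : Fin n → UnitSphere d, ∑ G : SimpleGraph (Fin n),
      graphWeight (linearEdgeProb p r x) G * signedTriangles p a b c G =
      ∑ t : Fin N × Fin N × Fin N, r ^ 3 * (gram x (a t.1) (b t.2.1) *
        gram x (b t.2.1) (c t.2.2) * gram x (a t.1) (c t.2.2)) := by
    intro x
    simp only [signedTriangles, Finset.mul_sum]
    rw [Finset.sum_comm]
    refine Finset.sum_congr rfl fun t _ => ?_
    rw [sum_graphWeight_mul_three p _ (e₁ := (a t.1, b t.2.1)) (e₂ := (b t.2.1, c t.2.2))
      (e₃ := (a t.1, c t.2.2))]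
    · simp only [linearEdgeProb]
      ring
    · intro e he
      simp only [Finset.mem_insert, Finset.mem_singleton] at he
      rcases he with rfl | rfl | rfl
      · exact mem_vertexPairs.2 (hab _ _)
      · exact mem_vertexPairs.2 (hbc _ _)
      · exact mem_vertexPairs.2 (hac _ _)
    · simp [(hab t.1 t.2.1).ne]
    · simp [(hbc t.2.1 t.2.2).ne]
    · simp [(hab t.1 t.2.1).ne']
  simp only [h]
  rw [integral_finsetSum _ fun t _ => integrable_of_continuous_compact (by fun_prop)]
  have h2 : ∀ t : Fin N × Fin N × Fin N, ∫ x, r ^ 3 * (gram x (a t.1) (b t.2.1) *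
        gram x (b t.2.1) (c t.2.2) * gram x (a t.1) (c t.2.2)) ∂(latentLaw (Fin n) d) =
        r ^ 3 / d ^ 2 := by
    intro t
    have := integral_latent_triangle (d := d) (F := fun _ : Fin n → UnitSphere d => r ^ 3)
      continuous_const (fun _ _ => rfl) (fun _ _ => rfl) (hab t.1 t.2.1).ne (hbc t.2.1 t.2.2).ne
      (hac t.1 t.2.2).ne
    rw [this]
    simp
  simp only [h2]
  simp
  ring

/-- The second moment of the signed triangle count. The blocks `a < b < c` keep the vertices of two
triangles in corresponding positions, so that their edges are either equal or different. -/
theorem sum_linearGraphProb_mul_signedTriangles_sq_le [NeZero d] (hp2 : p ≤ 1 / 2) (hr : 0 ≤ r)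
    (hrp : r ≤ p) (ha : Function.Injective a) (hb : Function.Injective b)
    (hc : Function.Injective c) (hab : ∀ i j, a i < b j) (hbc : ∀ j k, b j < c k) :
    ∑ G : SimpleGraph (Fin n), linearGraphProb n d p r G * signedTriangles p a b c G ^ 2 ≤
      (N ^ 3 * r ^ 3 / d ^ 2) ^ 2 + 27 * N ^ 3 * p ^ 3 + 9 * N ^ 4 * p * r ^ 4 / d ^ 3 := by
  classical
  have hac : ∀ i k, a i < c k := fun i k => (hab i i).trans (hbc i k)
  rw [sum_linearGraphProb_mul]
  have h : ∀ x : Fin n → UnitSphere d, ∑ G : SimpleGraph (Fin n),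
      graphWeight (linearEdgeProb p r x) G * signedTriangles p a b c G ^ 2 =
      ∑ t : Fin N × Fin N × Fin N, ∑ t' : Fin N × Fin N × Fin N,
        trianglePairMoment p r x (a t.1) (b t.2.1) (c t.2.2) (a t'.1) (b t'.2.1) (c t'.2.2) := by
    intro x
    simp only [signedTriangles, sq, Finset.sum_mul_sum]
    simp only [Finset.mul_sum]
    rw [Finset.sum_comm]
    refine Finset.sum_congr rfl fun t _ => ?_
    rw [Finset.sum_comm]
    refine Finset.sum_congr rfl fun t' _ => ?_
    rw [trianglePairMoment, ← sum_graphWeight_mul_six]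
    · exact Finset.sum_congr rfl fun G _ => by ring
    · intro e he
      simp only [Finset.mem_union, Finset.mem_insert, Finset.mem_singleton] at he
      rcases he with (((rfl | rfl) | (rfl | rfl)) | (rfl | rfl))
      all_goals first
        | exact mem_vertexPairs.2 (hab _ _)
        | exact mem_vertexPairs.2 (hbc _ _)
        | exact mem_vertexPairs.2 (hac _ _)
    · simp [(hab _ _).ne']
    · simp [(hbc _ _).ne']
    · simp [(hab _ _).ne]
  simp only [h]
  have hint : ∀ t t' : Fin N × Fin N × Fin N, Integrable (fun x : Fin n → UnitSphere d =>
      trianglePairMoment p r x (a t.1) (b t.2.1) (c t.2.2) (a t'.1) (b t'.2.1) (c t'.2.2))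
      (latentLaw (Fin n) d) := fun t t' => integrable_of_continuous_compact
    (((continuous_pairMoment _ _ _ _).mul (continuous_pairMoment _ _ _ _)).mul
      (continuous_pairMoment _ _ _ _))
  rw [integral_finsetSum _ fun t _ => integrable_finsetSum _ fun t' _ => hint t t']
  simp only [integral_finsetSum _ fun t' _ => hint _ t']
  have hle : ∀ t t' : Fin N × Fin N × Fin N, _ := fun t t' =>
    integral_trianglePairMoment_le (d := d) hp2 hr hrp (hab t.1 t.2.1).ne (hbc t.2.1 t.2.2).ne
      (hac t.1 t.2.2).ne (hab t'.1 t'.2.1).ne (hbc t'.2.1 t'.2.2).ne (hac t'.1 t'.2.2).ne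
      (hab t'.1 t.2.1).ne (hac t'.1 t.2.2).ne (hab t.1 t'.2.1).ne' (hbc t'.2.1 t.2.2).ne
      (hac t.1 t'.2.2).ne' (hbc t.2.1 t'.2.2).ne'
  have hle' : ∀ t t' : Fin N × Fin N × Fin N, ∫ x, trianglePairMoment p r x (a t.1) (b t.2.1)
      (c t.2.2) (a t'.1) (b t'.2.1) (c t'.2.2) ∂(latentLaw (Fin n) d) ≤ r ^ 6 / d ^ 4 +
      (if t.1 = t'.1 then if t.2.1 = t'.2.1 then if t.2.2 = t'.2.2 then 27 * p ^ 3 else 0 else 0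
        else 0) +
      ((if t.1 = t'.1 then if t.2.1 = t'.2.1 then 3 * p * r ^ 4 / d ^ 3 else 0 else 0) +
       (if t.2.1 = t'.2.1 then if t.2.2 = t'.2.2 then 3 * p * r ^ 4 / d ^ 3 else 0 else 0) +
       (if t.1 = t'.1 then if t.2.2 = t'.2.2 then 3 * p * r ^ 4 / d ^ 3 else 0 else 0)) := by
    intro t t'
    refine (hle t t').trans (le_of_eq ?_)
    simp only [ha.eq_iff, hb.eq_iff, hc.eq_iff]
    by_cases h1 : t.1 = t'.1 <;> by_cases h2 : t.2.1 = t'.2.1 <;>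
      by_cases h3 : t.2.2 = t'.2.2 <;> simp [h1, h2, h3]
  refine (Finset.sum_le_sum fun t _ => Finset.sum_le_sum fun t' _ => hle' t t').trans (le_of_eq ?_)
  simp only [Finset.sum_add_distrib, Fintype.sum_prod_type]
  have hjk : ∀ j k : Fin N, ∑ _i' : Fin N, ∑ j' : Fin N, ∑ k' : Fin N,
      (if j = j' then if k = k' then 3 * p * r ^ 4 / d ^ 3 else 0 else 0) =
      N * (3 * p * r ^ 4 / (d : ℝ) ^ 3) := by
    intro j k
    simp [Finset.sum_ite_irrel]
  have hik : ∀ i k : Fin N, ∑ i' : Fin N, ∑ _j' : Fin N, ∑ k' : Fin N,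
      (if i = i' then if k = k' then 3 * p * r ^ 4 / d ^ 3 else 0 else 0) =
      N * (3 * p * r ^ 4 / (d : ℝ) ^ 3) := by
    intro i k
    simp [Finset.sum_ite_irrel]
  have hij : ∀ i j : Fin N, ∑ i' : Fin N, ∑ j' : Fin N, ∑ _k' : Fin N,
      (if i = i' then if j = j' then 3 * p * r ^ 4 / d ^ 3 else 0 else 0) =
      N * (3 * p * r ^ 4 / (d : ℝ) ^ 3) := by
    intro i j
    simp [Finset.sum_ite_irrel]
  simp only [hjk, hik, hij]
  simp [Finset.sum_ite_irrel]
  ring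

theorem sum_linearGraphProb_mul_signedTriangles_sub_sq_le [NeZero d] (hp2 : p ≤ 1 / 2)
    (hr : 0 ≤ r) (hrp : r ≤ p) (ha : Function.Injective a) (hb : Function.Injective b)
    (hc : Function.Injective c) (hab : ∀ i j, a i < b j) (hbc : ∀ j k, b j < c k) :
    ∑ G : SimpleGraph (Fin n), linearGraphProb n d p r G *
        (signedTriangles p a b c G - N ^ 3 * r ^ 3 / d ^ 2) ^ 2 ≤
      27 * N ^ 3 * p ^ 3 + 9 * N ^ 4 * p * r ^ 4 / d ^ 3 := by
  have h1 := sum_linearGraphProb_mul_signedTriangles (d := d) (p := p) (r := r) hab hbc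
  have h2 := sum_linearGraphProb_mul_signedTriangles_sq_le (d := d) hp2 hr hrp ha hb hc hab hbc
  have h3 := sum_linearGraphProb (n := n) (d := d) (p := p) (r := r)
  set m : ℝ := N ^ 3 * r ^ 3 / d ^ 2
  have h4 : ∀ G : SimpleGraph (Fin n), linearGraphProb n d p r G *
      (signedTriangles p a b c G - m) ^ 2 =
      linearGraphProb n d p r G * signedTriangles p a b c G ^ 2 -
        2 * m * (linearGraphProb n d p r G * signedTriangles p a b c G) +
        m ^ 2 * linearGraphProb n d p r G := fun G => by ring
  simp only [h4, Finset.sum_add_distrib, Finset.sum_sub_distrib, ← Finset.mul_sum]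
  rw [h1, h3]
  nlinarith

/-- The signed triangle count distinguishes the two graphs. -/
theorem rggTV_ge_signedTriangles [NeZero d] {K : RGGKernel} (hp : 0 < p) (hp2 : p ≤ 1 / 2)
    (hr : 0 < r) (hrp : r ≤ p) (hK : ∀ t : Set.Icc (-1 : ℝ) 1, (K t : ℝ) = p + r * t)
    (hN : 0 < N) (hNn : 3 * N ≤ n) :
    1 - (216 * (p ^ 3 * d ^ 4 / (N ^ 3 * r ^ 6)) + 36 * (p * d / (N ^ 2 * r ^ 2))) ≤
      rggTV n d K := by
  have hd : (0 : ℝ) < d := Nat.cast_pos.2 (NeZero.pos d)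
  have hN0 : (0 : ℝ) < N := Nat.cast_pos.2 hN
  -- Three consecutive blocks of `N` vertices.
  set a : Fin N → Fin n := fun i => ⟨i, by omega⟩ with ha
  set b : Fin N → Fin n := fun i => ⟨N + i, by omega⟩ with hb
  set c : Fin N → Fin n := fun i => ⟨2 * N + i, by omega⟩ with hc
  have ia : Function.Injective a := fun i j h => by
    simpa [ha, Fin.ext_iff] using h
  have ib : Function.Injective b := fun i j h => by
    simpa [hb, Fin.ext_iff] using h
  have ic : Function.Injective c := fun i j h => by
    simpa [hc, Fin.ext_iff] using h
  have hab : ∀ i j, a i < b j := fun i j => by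
    simp only [ha, hb, Fin.lt_def]; omega
  have hbc : ∀ i j, b i < c j := fun i j => by
    simp only [hc, hb, Fin.lt_def]; omega
  have h1 := sum_linearGraphProb_mul_signedTriangles_sub_sq_le (d := d) hp2 hr.le hrp ia ib ic
    hab hbc
  -- The Erdős–Rényi graph is the case `r = 0`.
  have h0 := sum_linearGraphProb_mul_signedTriangles_sub_sq_le (d := d) hp2 le_rfl hp.le ia ib ic
    hab hbc
  simp only [linearGraphProb_zero] at h0
  norm_num at h0
  have hm : 0 < (N : ℝ) ^ 3 * r ^ 3 / d ^ 2 := by positivity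
  refine le_trans ?_ (rggTV_ge_of_statistic hp hp2 hr.le hrp hK (signedTriangles p a b c) hm)
  have hm2 : 0 < ((N : ℝ) ^ 3 * r ^ 3 / d ^ 2 / 2) ^ 2 := by positivity
  have k1 := div_le_div_of_nonneg_right h1 hm2.le
  have k0 := div_le_div_of_nonneg_right h0 hm2.le
  have e : (27 * (N : ℝ) ^ 3 * p ^ 3 + 9 * N ^ 4 * p * r ^ 4 / d ^ 3) /
        ((N : ℝ) ^ 3 * r ^ 3 / d ^ 2 / 2) ^ 2 +
      27 * (N : ℝ) ^ 3 * p ^ 3 / ((N : ℝ) ^ 3 * r ^ 3 / d ^ 2 / 2) ^ 2 =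
      216 * (p ^ 3 * d ^ 4 / (N ^ 3 * r ^ 6)) + 36 * (p * d / (N ^ 2 * r ^ 2)) := by
    field_simp
    ring
  linarith

end Detection

/-! ### Typical latent points -/

section SumPairs

variable {n : ℕ}

theorem sum_vertexPairs (f : Fin n → Fin n → ℝ) :
    ∑ e ∈ vertexPairs n, f e.1 e.2 = ∑ k, ∑ i, if i < k then f i k else 0 := by
  rw [vertexPairs, Finset.sum_filter, Fintype.sum_prod_type, Finset.sum_comm]

theorem sum_sum_eq_two_mul_sum_vertexPairs {f : Fin n → Fin n → ℝ} (hf : ∀ i j, f i j = f j i)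
    (h0 : ∀ i, f i i = 0) : ∑ i, ∑ j, f i j = 2 * ∑ e ∈ vertexPairs n, f e.1 e.2 := by
  have h : ∀ i j, f i j = (if j < i then f j i else 0) + (if i < j then f i j else 0) := by
    intro i j
    rcases lt_trichotomy i j with h | h | h
    · simp [h, h.le]
    · simp [h, h0]
    · simp [h, h.le, hf i j]
  calc ∑ i, ∑ j, f i j = ∑ i, ∑ j, ((if j < i then f j i else 0) + (if i < j then f i j else 0)) :=
        Finset.sum_congr rfl fun i _ => Finset.sum_congr rfl fun j _ => h i j
    _ = (∑ i, ∑ j, if j < i then f j i else 0) + ∑ i, ∑ j, if i < j then f i j else 0 := by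
        simp only [Finset.sum_add_distrib]
    _ = 2 * ∑ e ∈ vertexPairs n, f e.1 e.2 := by
        rw [Finset.sum_comm (f := fun i j => if i < j then f i j else 0), sum_vertexPairs]
        ring

theorem card_vertexPairs_le (n : ℕ) : ((vertexPairs n).card : ℝ) ≤ n ^ 2 := by
  have h : (vertexPairs n).card ≤ (Finset.univ : Finset (Fin n × Fin n)).card :=
    Finset.card_le_univ _
  rw [Finset.card_univ, Fintype.card_prod, Fintype.card_fin] at h
  rw [sq]
  exact_mod_cast h

end SumPairs

section Energy

variable {n d : ℕ}

/-- The power sum of order `k` of the entries of the Gram matrix above the diagonal. -/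
noncomputable def gramPowerSum (k : ℕ) (x : Fin n → UnitSphere d) : ℝ :=
  ∑ e ∈ vertexPairs n, gram x e.1 e.2 ^ k

/-- The Gram matrix with the diagonal replaced by zero. -/
noncomputable def offGram (x : Fin n → UnitSphere d) : Matrix (Fin n) (Fin n) ℝ :=
  fun i j => if i = j then 0 else gram x i j

/-- The sum of the fourth powers of the products of two different entries in one column of the Gram
matrix, above the diagonal. -/
noncomputable def gramColumnSum (x : Fin n → UnitSphere d) : ℝ :=
  ∑ k, ∑ i, ∑ j, if i < k ∧ j < k ∧ i ≠ j then gram x i k ^ 4 * gram x j k ^ 4 else 0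

/-- The sum of the functions of the latent points that the second moment estimate needs bounded,
each divided by its order of magnitude. -/
noncomputable def latentEnergy (x : Fin n → UnitSphere d) : ℝ :=
  gramPowerSum 2 x / (n ^ 2 / d) + gramPowerSum 4 x / (n ^ 2 / d ^ 2) +
    gramPowerSum 6 x / (n ^ 2 / d ^ 3) + (offGram x ^ 4).trace / (n ^ 4 / d ^ 3 + n ^ 3 / d ^ 2) +
    gramColumnSum x / (n ^ 3 / d ^ 4)

/-- A bound for the mean of `latentEnergy`. -/
noncomputable def energyBound : ℝ :=
  gaussianEvenMoment 1 + gaussianEvenMoment 2 + gaussianEvenMoment 3 +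
    (1 + 2 * gaussianEvenMoment 2) + gaussianEvenMoment 2 ^ 2

theorem gramPowerSum_even_nonneg (k : ℕ) (x : Fin n → UnitSphere d) :
    0 ≤ gramPowerSum (2 * k) x :=
  Finset.sum_nonneg fun e _ => by rw [pow_mul]; positivity

theorem gramColumnSum_nonneg (x : Fin n → UnitSphere d) : 0 ≤ gramColumnSum x :=
  Finset.sum_nonneg fun k _ => Finset.sum_nonneg fun i _ => Finset.sum_nonneg fun j _ => by
    split_ifs <;> positivity

theorem offGram_comm (x : Fin n → UnitSphere d) (i j : Fin n) : offGram x i j = offGram x j i := by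
  simp only [offGram, gram_comm x i j, eq_comm (a := i)]

theorem offGram_self (x : Fin n → UnitSphere d) (i : Fin n) : offGram x i i = 0 := if_pos rfl

theorem offGram_isHermitian (x : Fin n → UnitSphere d) : (offGram x).IsHermitian := by
  ext i j
  simpa using offGram_comm x j i

theorem trace_offGram_sq (x : Fin n → UnitSphere d) :
    (offGram x ^ 2).trace = 2 * gramPowerSum 2 x := by
  have h : (offGram x ^ 2).trace = ∑ i, ∑ j, offGram x i j ^ 2 := by
    rw [sq, Matrix.trace]
    refine Finset.sum_congr rfl fun i _ => ?_
    rw [Matrix.diag_apply, Matrix.mul_apply]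
    exact Finset.sum_congr rfl fun j _ => by rw [offGram_comm x j i, sq]
  rw [h, sum_sum_eq_two_mul_sum_vertexPairs (fun i j => by rw [offGram_comm])
    (fun i => by rw [offGram_self]; norm_num), gramPowerSum]
  congr 1
  refine Finset.sum_congr rfl fun e he => ?_
  rw [offGram, if_neg (mem_vertexPairs.1 he).ne]

theorem trace_offGram_pow_four (x : Fin n → UnitSphere d) : (offGram x ^ 4).trace =
    ∑ i, ∑ k, ∑ j, ∑ l, offGram x i j * offGram x j k * (offGram x i l * offGram x l k) := by
  have h : offGram x ^ 4 = offGram x ^ 2 * offGram x ^ 2 := by rw [← pow_add]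
  rw [h, Matrix.trace]
  refine Finset.sum_congr rfl fun i _ => ?_
  rw [Matrix.diag_apply, Matrix.mul_apply]
  refine Finset.sum_congr rfl fun k _ => ?_
  rw [sq, Matrix.mul_apply, Matrix.mul_apply, Finset.sum_mul_sum]
  refine Finset.sum_congr rfl fun j _ => Finset.sum_congr rfl fun l _ => ?_
  rw [offGram_comm x k l, offGram_comm x l i]
  ring

theorem trace_offGram_pow_four_nonneg (x : Fin n → UnitSphere d) :
    0 ≤ (offGram x ^ 4).trace := by
  rw [(offGram_isHermitian x).trace_pow_eq_sum_eigenvalues_pow]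
  exact Finset.sum_nonneg fun a _ => by positivity

@[fun_prop]
theorem continuous_offGram (i j : Fin n) :
    Continuous fun x : Fin n → UnitSphere d => offGram x i j := by
  unfold offGram
  split_ifs <;> fun_prop

@[fun_prop]
theorem continuous_gramPowerSum (k : ℕ) :
    Continuous fun x : Fin n → UnitSphere d => gramPowerSum k x := by
  unfold gramPowerSum
  fun_prop

@[fun_prop]
theorem continuous_trace_offGram :
    Continuous fun x : Fin n → UnitSphere d => (offGram x ^ 4).trace := by
  simp only [trace_offGram_pow_four]
  fun_prop

@[fun_prop]
theorem continuous_gramColumnSum : Continuous fun x : Fin n → UnitSphere d => gramColumnSum x := by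
  unfold gramColumnSum
  refine continuous_finsetSum _ fun k _ => continuous_finsetSum _ fun i _ =>
    continuous_finsetSum _ fun j _ => ?_
  split_ifs <;> fun_prop

theorem continuous_latentEnergy : Continuous fun x : Fin n → UnitSphere d => latentEnergy x := by
  unfold latentEnergy
  fun_prop

theorem latentEnergy_nonneg (x : Fin n → UnitSphere d) : 0 ≤ latentEnergy x := by
  have h1 := gramPowerSum_even_nonneg 1 x
  have h2 := gramPowerSum_even_nonneg 2 x
  have h3 := gramPowerSum_even_nonneg 3 x
  have h4 := trace_offGram_pow_four_nonneg x
  have h5 := gramColumnSum_nonneg x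
  norm_num at h1 h2 h3
  unfold latentEnergy
  positivity

/-- The latent points of bounded energy. -/
def typicalPoints (n d : ℕ) (κ : ℝ) : Set (Fin n → UnitSphere d) := {x | latentEnergy x ≤ κ}

theorem measurableSet_typicalPoints (κ : ℝ) : MeasurableSet (typicalPoints n d κ) :=
  measurableSet_le continuous_latentEnergy.measurable measurable_const

variable [NeZero d]

theorem integral_gram_pow_le {i j : Fin n} (hij : i ≠ j) (k : ℕ) :
    ∫ x, gram x i j ^ (2 * k) ∂(latentLaw (Fin n) d) ≤ gaussianEvenMoment k / d ^ k := by
  have h := integral_latent_gram_pow_le (d := d) (F := fun _ : Fin n → UnitSphere d => (1 : ℝ))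
    continuous_const (fun _ => zero_le_one) (fun _ _ => rfl) hij k
  simpa using h

theorem integral_gramPowerSum_le (k : ℕ) :
    ∫ x, gramPowerSum (2 * k) x ∂(latentLaw (Fin n) d) ≤
      gaussianEvenMoment k * (n ^ 2 / d ^ k) := by
  unfold gramPowerSum
  rw [integral_finsetSum _ fun e _ => integrable_of_continuous_compact (by fun_prop)]
  have h0 : 0 ≤ gaussianEvenMoment k / (d : ℝ) ^ k := by
    have := gaussianEvenMoment_nonneg k
    positivity
  calc _ ≤ ∑ e ∈ vertexPairs n, gaussianEvenMoment k / (d : ℝ) ^ k :=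
        Finset.sum_le_sum fun e he => integral_gram_pow_le (mem_vertexPairs.1 he).ne k
    _ ≤ n ^ 2 * (gaussianEvenMoment k / (d : ℝ) ^ k) := by
        rw [Finset.sum_const, nsmul_eq_mul]
        exact mul_le_mul_of_nonneg_right (card_vertexPairs_le n) h0
    _ = _ := by ring

theorem integral_gram_pow_four_le {i j : Fin n} (hij : i ≠ j) :
    ∫ x, gram x i j ^ 4 ∂(latentLaw (Fin n) d) ≤ gaussianEvenMoment 2 / d ^ 2 :=
  integral_gram_pow_le hij 2

theorem integral_gram_sq_mul_gram_sq_le {a b a' b' : Fin n} (h : a ≠ b) (h' : a' ≠ b') :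
    ∫ x, gram x a b ^ 2 * gram x a' b' ^ 2 ∂(latentLaw (Fin n) d) ≤
      gaussianEvenMoment 2 / d ^ 2 := by
  have hle : ∫ x, gram x a b ^ 2 * gram x a' b' ^ 2 ∂(latentLaw (Fin n) d) ≤
      ∫ x, (gram x a b ^ 4 + gram x a' b' ^ 4) / 2 ∂(latentLaw (Fin n) d) := by
    refine integral_mono (integrable_of_continuous_compact (by fun_prop))
      (integrable_of_continuous_compact (by fun_prop)) fun x => ?_
    simp only
    nlinarith [sq_nonneg (gram x a b ^ 2 - gram x a' b' ^ 2)]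
  rw [integral_div, integral_add (integrable_of_continuous_compact (by fun_prop))
    (integrable_of_continuous_compact (by fun_prop))] at hle
  have h1 := integral_gram_pow_four_le (d := d) h
  have h2 := integral_gram_pow_four_le (d := d) h'
  linarith

/-- A closed walk `i j k l` of length four contributes at the order `d⁻³`, unless two opposite
vertices coincide. -/
theorem integral_offGram_walk_le (i j k l : Fin n) :
    ∫ x, offGram x i j * offGram x j k * (offGram x i l * offGram x l k) ∂(latentLaw (Fin n) d) ≤
      1 / d ^ 3 + (if i = k then gaussianEvenMoment 2 / d ^ 2 else 0) +
        (if j = l then gaussianEvenMoment 2 / (d : ℝ) ^ 2 else 0) := by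
  have h0 : 0 ≤ gaussianEvenMoment 2 / (d : ℝ) ^ 2 := by
    have := gaussianEvenMoment_nonneg 2
    positivity
  have h3 : (0 : ℝ) ≤ 1 / d ^ 3 := by positivity
  have hnn : 0 ≤ 1 / (d : ℝ) ^ 3 + (if i = k then gaussianEvenMoment 2 / d ^ 2 else 0) +
        (if j = l then gaussianEvenMoment 2 / (d : ℝ) ^ 2 else 0) := by
    split_ifs <;> positivity
  by_cases hij : i = j
  · refine le_trans (le_of_eq ?_) hnn
    simp [hij, offGram_self]
  by_cases hjk : j = k
  · refine le_trans (le_of_eq ?_) hnn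
    simp [hjk, offGram_self]
  by_cases hil : i = l
  · refine le_trans (le_of_eq ?_) hnn
    simp [hil, offGram_self]
  by_cases hlk : l = k
  · refine le_trans (le_of_eq ?_) hnn
    simp [hlk, offGram_self]
  simp only [offGram, hij, hjk, hil, hlk, if_false]
  by_cases hik : i = k
  · subst hik
    have e : ∀ x : Fin n → UnitSphere d, gram x i j * gram x j i * (gram x i l * gram x l i) =
        gram x i j ^ 2 * gram x i l ^ 2 := fun x => by
      rw [gram_comm x j i, gram_comm x l i]; ring
    simp only [e, if_true]
    have := integral_gram_sq_mul_gram_sq_le (d := d) hij hil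
    split_ifs <;> linarith
  by_cases hjl : j = l
  · subst hjl
    have e : ∀ x : Fin n → UnitSphere d, gram x i j * gram x j k * (gram x i j * gram x j k) =
        gram x i j ^ 2 * gram x j k ^ 2 := fun x => by ring
    simp only [e, if_true]
    have := integral_gram_sq_mul_gram_sq_le (d := d) hij hjk
    split_ifs
    linarith
  have h := integral_latent_two_paths (d := d) (F := fun _ : Fin n → UnitSphere d => (1 : ℝ))
    continuous_const (w := j) (w' := l) (u := i) (v := k) (fun _ _ => rfl) (fun _ _ => rfl)
    hij (Ne.symm hjk) hil (Ne.symm hlk) hjl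
  simp only [one_mul, integral_latent_gram_sq_one hik] at h
  rw [h, if_neg hik, if_neg hjl, div_div]
  refine le_of_eq ?_
  ring

theorem integral_trace_offGram_pow_four_le :
    ∫ x, (offGram x ^ 4).trace ∂(latentLaw (Fin n) d) ≤
      (1 + 2 * gaussianEvenMoment 2) * (n ^ 4 / d ^ 3 + n ^ 3 / d ^ 2) := by
  have hd : (0 : ℝ) < d := Nat.cast_pos.2 (NeZero.pos d)
  have hint : ∀ i k j l : Fin n, Integrable (fun x : Fin n → UnitSphere d =>
      offGram x i j * offGram x j k * (offGram x i l * offGram x l k)) (latentLaw (Fin n) d) :=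
    fun i k j l => integrable_of_continuous_compact (by fun_prop)
  simp only [trace_offGram_pow_four]
  rw [integral_finsetSum _ fun i _ => integrable_of_continuous_compact (by fun_prop)]
  simp only [integral_finsetSum _ fun k _ =>
      integrable_finsetSum _ fun j _ => integrable_finsetSum _ fun l _ => hint _ k j l,
    integral_finsetSum _ fun j _ => integrable_finsetSum _ fun l _ => hint _ _ j l,
    integral_finsetSum _ fun l _ => hint _ _ _ l]
  refine (Finset.sum_le_sum fun i _ => Finset.sum_le_sum fun k _ => Finset.sum_le_sum fun j _ =>
    Finset.sum_le_sum fun l _ => integral_offGram_walk_le i j k l).trans ?_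
  simp only [Finset.sum_add_distrib]
  have h2 := gaussianEvenMoment_nonneg 2
  have e1 : ∑ i : Fin n, ∑ k : Fin n, ∑ _j : Fin n, ∑ _l : Fin n,
      (if i = k then gaussianEvenMoment 2 / (d : ℝ) ^ 2 else 0) =
      n ^ 3 * (gaussianEvenMoment 2 / d ^ 2) := by
    simp [Finset.sum_ite_irrel]
    ring
  have e2 : ∑ _i : Fin n, ∑ _k : Fin n, ∑ j : Fin n, ∑ l : Fin n,
      (if j = l then gaussianEvenMoment 2 / (d : ℝ) ^ 2 else 0) =
      n ^ 3 * (gaussianEvenMoment 2 / d ^ 2) := by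
    simp
    ring
  have e0 : ∑ _i : Fin n, ∑ _k : Fin n, ∑ _j : Fin n, ∑ _l : Fin n, 1 / (d : ℝ) ^ 3 =
      (n : ℝ) ^ 4 / d ^ 3 := by
    simp
    ring
  rw [e0, e1, e2]
  have h4 : 0 ≤ gaussianEvenMoment 2 * ((n : ℝ) ^ 4 / d ^ 3) := by positivity
  have h5 : 0 ≤ (n : ℝ) ^ 3 / d ^ 2 := by positivity
  have e3 : (n : ℝ) ^ 3 * (gaussianEvenMoment 2 / d ^ 2) =
    gaussianEvenMoment 2 * ((n : ℝ) ^ 3 / d ^ 2) := by ring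
  rw [e3]
  linarith

theorem integral_gramColumnSum_le :
    ∫ x, gramColumnSum x ∂(latentLaw (Fin n) d) ≤
      gaussianEvenMoment 2 ^ 2 * (n ^ 3 / d ^ 4) := by
  have hd : (0 : ℝ) < d := Nat.cast_pos.2 (NeZero.pos d)
  have h2 := gaussianEvenMoment_nonneg 2
  have hc : ∀ k i j : Fin n, Continuous fun x : Fin n → UnitSphere d =>
      if i < k ∧ j < k ∧ i ≠ j then gram x i k ^ 4 * gram x j k ^ 4 else 0 := fun k i j => by
    split_ifs <;> fun_prop
  have hint : ∀ k i j : Fin n, Integrable (fun x : Fin n → UnitSphere d =>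
      if i < k ∧ j < k ∧ i ≠ j then gram x i k ^ 4 * gram x j k ^ 4 else 0)
      (latentLaw (Fin n) d) :=
    fun k i j => integrable_of_continuous_compact (hc k i j)
  unfold gramColumnSum
  rw [integral_finsetSum _ fun k _ =>
    integrable_finsetSum _ fun i _ => integrable_finsetSum _ fun j _ => hint k i j]
  simp only [integral_finsetSum _ fun i _ => integrable_finsetSum _ fun j _ => hint _ i j,
    integral_finsetSum _ fun j _ => hint _ _ j]
  have hle : ∀ k i j : Fin n, ∫ x, (if i < k ∧ j < k ∧ i ≠ j then gram x i k ^ 4 * gram x j k ^ 4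
      else 0) ∂(latentLaw (Fin n) d) ≤ gaussianEvenMoment 2 ^ 2 / d ^ 4 := by
    intro k i j
    split_ifs with h
    · have h1 := integral_latent_gram_pow_le (d := d)
        (F := fun x : Fin n → UnitSphere d => gram x i k ^ 4) (by fun_prop)
        (fun x => by positivity) (i := k) (j := j)
        (fun x y => by rw [gram_update_of_ne x y h.2.2 h.2.1.ne']) h.2.1.ne' 2
      simp only [gram_comm _ k j] at h1
      refine h1.trans ?_
      have h3 := integral_gram_pow_four_le (d := d) h.1.ne
      calc _ ≤ gaussianEvenMoment 2 / (d : ℝ) ^ 2 * (gaussianEvenMoment 2 / d ^ 2) := by gcongr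
        _ = _ := by ring
    · simp only [integral_zero]
      positivity
  refine (Finset.sum_le_sum fun k _ => Finset.sum_le_sum fun i _ => Finset.sum_le_sum fun j _ =>
    hle k i j).trans (le_of_eq ?_)
  simp
  ring

theorem integral_latentEnergy_le (hn : 0 < n) :
    ∫ x, latentEnergy x ∂(latentLaw (Fin n) d) ≤ energyBound := by
  have hd : (0 : ℝ) < d := Nat.cast_pos.2 (NeZero.pos d)
  have hn0 : (0 : ℝ) < n := Nat.cast_pos.2 hn
  unfold latentEnergy
  rw [integral_add (integrable_of_continuous_compact (by fun_prop))
      (integrable_of_continuous_compact (by fun_prop)),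
    integral_add (integrable_of_continuous_compact (by fun_prop))
      (integrable_of_continuous_compact (by fun_prop)),
    integral_add (integrable_of_continuous_compact (by fun_prop))
      (integrable_of_continuous_compact (by fun_prop)),
    integral_add (integrable_of_continuous_compact (by fun_prop))
      (integrable_of_continuous_compact (by fun_prop))]
  simp only [integral_div]
  have h1 := integral_gramPowerSum_le (n := n) (d := d) 1
  have h2 := integral_gramPowerSum_le (n := n) (d := d) 2
  have h3 := integral_gramPowerSum_le (n := n) (d := d) 3
  rw [pow_one] at h1
  unfold energyBound
  refine add_le_add (add_le_add (add_le_add (add_le_add ?_ ?_) ?_) ?_) ?_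
  · exact (div_le_iff₀ (by positivity)).2 h1
  · exact (div_le_iff₀ (by positivity)).2 h2
  · exact (div_le_iff₀ (by positivity)).2 h3
  · exact (div_le_iff₀ (by positivity)).2 integral_trace_offGram_pow_four_le
  · exact (div_le_iff₀ (by positivity)).2 integral_gramColumnSum_le

theorem one_sub_le_typicalPoints (hn : 0 < n) {κ : ℝ} (hκ : 0 < κ) :
    1 - energyBound / κ ≤ (latentLaw (Fin n) d).real (typicalPoints n d κ) := by
  have h1 := mul_meas_ge_le_integral_of_nonneg (μ := latentLaw (Fin n) d)
    (f := fun x => latentEnergy x) (Eventually.of_forall fun x => latentEnergy_nonneg x)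
    (integrable_of_continuous_compact continuous_latentEnergy) κ
  have h2 : (typicalPoints n d κ)ᶜ ⊆ {x | κ ≤ latentEnergy x} := fun x hx =>
    (not_le.1 (show ¬latentEnergy x ≤ κ from hx)).le
  have h3 := measureReal_mono (μ := latentLaw (Fin n) d) h2
  rw [probReal_compl_eq_one_sub (measurableSet_typicalPoints κ)] at h3
  have h4 := h1.trans (integral_latentEnergy_le hn)
  have h5 : (latentLaw (Fin n) d).real {x | κ ≤ latentEnergy x} ≤ energyBound / κ := by
    rw [le_div_iff₀ hκ, mul_comm]
    exact h4
  linarith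

theorem typicalPoints_bounds (hn : 0 < n) {κ : ℝ} {x : Fin n → UnitSphere d}
    (hx : x ∈ typicalPoints n d κ) :
    gramPowerSum 2 x ≤ κ * (n ^ 2 / d) ∧ gramPowerSum 4 x ≤ κ * (n ^ 2 / d ^ 2) ∧
      gramPowerSum 6 x ≤ κ * (n ^ 2 / d ^ 3) ∧
      (offGram x ^ 4).trace ≤ κ * (n ^ 4 / d ^ 3 + n ^ 3 / d ^ 2) ∧
      gramColumnSum x ≤ κ * (n ^ 3 / d ^ 4) := by
  have hd : (0 : ℝ) < d := Nat.cast_pos.2 (NeZero.pos d)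
  have hn0 : (0 : ℝ) < n := Nat.cast_pos.2 hn
  have hx' : latentEnergy x ≤ κ := hx
  unfold latentEnergy at hx'
  have h1 : 0 ≤ gramPowerSum 2 x / (n ^ 2 / d) :=
    div_nonneg (gramPowerSum_even_nonneg 1 x) (by positivity)
  have h2 : 0 ≤ gramPowerSum 4 x / (n ^ 2 / d ^ 2) :=
    div_nonneg (gramPowerSum_even_nonneg 2 x) (by positivity)
  have h3 : 0 ≤ gramPowerSum 6 x / (n ^ 2 / d ^ 3) :=
    div_nonneg (gramPowerSum_even_nonneg 3 x) (by positivity)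
  have h4 : 0 ≤ (offGram x ^ 4).trace / (n ^ 4 / d ^ 3 + n ^ 3 / d ^ 2) :=
    div_nonneg (trace_offGram_pow_four_nonneg x) (by positivity)
  have h5 : 0 ≤ gramColumnSum x / (n ^ 3 / d ^ 4) :=
    div_nonneg (gramColumnSum_nonneg x) (by positivity)
  refine ⟨?_, ?_, ?_, ?_, ?_⟩ <;> refine (div_le_iff₀ (by positivity)).1 ?_ <;> linarith

end Energy

/-! ### The exponent of the likelihood ratio -/

theorem log_one_add_le_cubic {u : ℝ} (hu : -1 < u) :
    Real.log (1 + u) ≤ u - u ^ 2 / 2 + u ^ 3 / 3 := by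
  set f : ℝ → ℝ := fun u => u - u ^ 2 / 2 + u ^ 3 / 3 - Real.log (1 + u) with hf
  have hder : ∀ v : ℝ, -1 < v → HasDerivAt f (v ^ 3 / (1 + v)) v := by
    intro v hv
    have h1 : (1 : ℝ) + v ≠ 0 := by linarith
    have h := ((((hasDerivAt_id v).sub (((hasDerivAt_id v).pow 2).div_const 2)).add
      (((hasDerivAt_id v).pow 3).div_const 3)).sub (((hasDerivAt_id v).const_add 1).log h1))
    refine h.congr_deriv ?_
    simp only [id]
    field_simp
    ring
  have h0 : f 0 = 0 := by simp [hf]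
  suffices 0 ≤ f u by
    simp only [hf] at this
    linarith
  rw [← h0]
  rcases le_total 0 u with h | h
  · refine monotoneOn_of_deriv_nonneg (convex_Icc 0 u) (fun v hv =>
      (hder v (by linarith [hv.1])).continuousAt.continuousWithinAt) (fun v hv => ?_) (fun v hv => ?_)
      (Set.left_mem_Icc.2 h) (Set.right_mem_Icc.2 h) h
    · rw [interior_Icc] at hv
      exact (hder v (by linarith [hv.1])).differentiableAt.differentiableWithinAt
    · rw [interior_Icc] at hv
      rw [(hder v (by linarith [hv.1])).deriv]
      have := hv.1
      positivity
  · refine antitoneOn_of_deriv_nonpos (convex_Icc u 0) (fun v hv =>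
      (hder v (by linarith [hv.1])).continuousAt.continuousWithinAt) (fun v hv => ?_) (fun v hv => ?_)
      (Set.left_mem_Icc.2 h) (Set.right_mem_Icc.2 h) h
    · rw [interior_Icc] at hv
      exact (hder v (by linarith [hv.1])).differentiableAt.differentiableWithinAt
    · rw [interior_Icc] at hv
      rw [(hder v (by linarith [hv.1])).deriv]
      refine div_nonpos_of_nonpos_of_nonneg ?_ (by linarith [hv.1])
      exact Odd.pow_nonpos (by decide) hv.2.le

theorem one_add_le_exp_cubic {u : ℝ} (hu : -1 < u) :
    1 + u ≤ Real.exp (u - u ^ 2 / 2 + u ^ 3 / 3) := by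
  rw [← Real.log_le_iff_le_exp (by linarith)]
  exact log_one_add_le_cubic hu

section Exponent

variable {n d : ℕ} {lam : ℝ}

/-- The expansion keeps the quadratic term, whose mean cancels the leading term of the exponential
moment of the linear one. -/
theorem prod_one_add_le_exp (h0 : 0 ≤ lam) (h1 : lam < 1) (x y : Fin n → UnitSphere d) :
    ∏ e ∈ vertexPairs n, (1 + lam * (gram x e.1 e.2 * gram y e.1 e.2)) ≤
      Real.exp (lam * ∑ e ∈ vertexPairs n, gram x e.1 e.2 * gram y e.1 e.2 -
        lam ^ 2 / 2 * ∑ e ∈ vertexPairs n, gram x e.1 e.2 ^ 2 * gram y e.1 e.2 ^ 2 +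
        lam ^ 3 / 3 * ∑ e ∈ vertexPairs n, gram x e.1 e.2 ^ 3 * gram y e.1 e.2 ^ 3) := by
  simp only [Finset.mul_sum]
  rw [← Finset.sum_sub_distrib, ← Finset.sum_add_distrib, Real.exp_sum]
  have hu : ∀ e : Fin n × Fin n, -1 < lam * (gram x e.1 e.2 * gram y e.1 e.2) := by
    intro e
    have h : |gram x e.1 e.2 * gram y e.1 e.2| ≤ 1 := by
      rw [abs_mul]
      exact mul_le_one₀ (abs_gram_le_one _ _ _) (abs_nonneg _) (abs_gram_le_one _ _ _)
    have := (abs_le.1 h).1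
    nlinarith
  refine Finset.prod_le_prod (fun e _ => by linarith [hu e]) fun e _ => ?_
  refine (one_add_le_exp_cubic (hu e)).trans (le_of_eq ?_)
  congr 1
  ring

theorem sum_gram_cube_le (x y : Fin n → UnitSphere d) :
    ∑ e ∈ vertexPairs n, gram x e.1 e.2 ^ 3 * gram y e.1 e.2 ^ 3 ≤
      (gramPowerSum 6 x + gramPowerSum 6 y) / 2 := by
  rw [gramPowerSum, gramPowerSum, ← Finset.sum_add_distrib, Finset.sum_div]
  refine Finset.sum_le_sum fun e _ => ?_
  nlinarith [sq_nonneg (gram x e.1 e.2 ^ 3 - gram y e.1 e.2 ^ 3)]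

/-- The exponential moment of the linear part of the exponent. -/
theorem integral_exp_linear_le [NeZero d] (x : Fin n → UnitSphere d) {c : ℝ}
    (hc : c ^ 4 * (offGram x ^ 4).trace ≤ 1 / 16) :
    ∫ y, Real.exp ((∫ ρ, ρ ∂(radialLaw d)) ^ 2 * c *
        ∑ e ∈ vertexPairs n, gram x e.1 e.2 * gram y e.1 e.2) ∂(latentLaw (Fin n) d) ≤
      Real.exp (d * (c ^ 2 * gramPowerSum 2 x / 2 +
        Real.sqrt (2 * c ^ 2 * gramPowerSum 2 x) *
        Real.sqrt (c ^ 4 * (offGram x ^ 4).trace))) := by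
  set B : Matrix (Fin n) (Fin n) ℝ := c • offGram x with hBdef
  have hB : B.IsHermitian := by
    ext i j
    simpa [hBdef] using Or.inl (offGram_comm x j i)
  have hdiag : ∀ i, B i i = 0 := fun i => by simp [hBdef, offGram_self]
  have htr1 : ∑ a, hB.eigenvalues a = 0 := by
    have h := hB.trace_pow_eq_sum_eigenvalues_pow 1
    simp only [pow_one] at h
    rw [← h, Matrix.trace]
    exact Finset.sum_eq_zero fun i _ => hdiag i
  have htr2 : ∑ a, hB.eigenvalues a ^ 2 = 2 * c ^ 2 * gramPowerSum 2 x := by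
    rw [← hB.trace_pow_eq_sum_eigenvalues_pow 2, hBdef, smul_pow, Matrix.trace_smul,
      trace_offGram_sq, smul_eq_mul]
    ring
  have htr4 : ∑ a, hB.eigenvalues a ^ 4 = c ^ 4 * (offGram x ^ 4).trace := by
    rw [← hB.trace_pow_eq_sum_eigenvalues_pow 4, hBdef, smul_pow, Matrix.trace_smul, smul_eq_mul]
  have hle : ∀ a, |hB.eigenvalues a| ≤ 1 / 2 := by
    intro a
    have h1 : hB.eigenvalues a ^ 4 ≤ ∑ a, hB.eigenvalues a ^ 4 :=
      Finset.single_le_sum (f := fun a => hB.eigenvalues a ^ 4) (fun a _ => by positivity)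
        (Finset.mem_univ a)
    rw [htr4] at h1
    have h2 : |hB.eigenvalues a| ^ 4 ≤ (1 / 2) ^ 4 := by
      rw [Even.pow_abs (by decide)]
      linarith
    exact le_of_pow_le_pow_left₀ (by norm_num) (by norm_num) h2
  have h := integral_sphere_exp_gram_le d hB hdiag (fun a => by linarith [(abs_le.1 (hle a)).2])
  have hlhs : ∀ y : Fin n → UnitSphere d, (∫ ρ, ρ ∂(radialLaw d)) ^ 2 * (∑ i, ∑ j, B i j *
      inner ℝ (y i : EuclideanSpace ℝ (Fin d)) (y j)) / 2 = (∫ ρ, ρ ∂(radialLaw d)) ^ 2 * c *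
        ∑ e ∈ vertexPairs n, gram x e.1 e.2 * gram y e.1 e.2 := by
    intro y
    have h1 : ∑ i, ∑ j, B i j * gram y i j =
        2 * ∑ e ∈ vertexPairs n, B e.1 e.2 * gram y e.1 e.2 :=
      sum_sum_eq_two_mul_sum_vertexPairs (f := fun i j => B i j * gram y i j)
      (fun i j => by rw [hBdef, Matrix.smul_apply, Matrix.smul_apply, offGram_comm x i j,
        gram_comm y i j])
      (fun i => by rw [hdiag, zero_mul])
    have h2 : ∑ e ∈ vertexPairs n, B e.1 e.2 * gram y e.1 e.2 =
        c * ∑ e ∈ vertexPairs n, gram x e.1 e.2 * gram y e.1 e.2 := by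
      rw [Finset.mul_sum]
      refine Finset.sum_congr rfl fun e he => ?_
      rw [hBdef, Matrix.smul_apply, offGram, if_neg (mem_vertexPairs.1 he).ne, smul_eq_mul]
      ring
    rw [h2] at h1
    change _ * (∑ i, ∑ j, B i j * gram y i j) / 2 = _
    rw [h1]
    ring
  simp only [hlhs] at h
  refine h.trans ?_
  have hprod : ∏ a, (Real.sqrt (1 - hB.eigenvalues a))⁻¹ ≤
      Real.exp (∑ a, (hB.eigenvalues a / 2 + hB.eigenvalues a ^ 2 / 4 + |hB.eigenvalues a| ^ 3)) := by
    rw [Real.exp_sum]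
    exact Finset.prod_le_prod (fun a _ => by positivity) fun a _ => inv_sqrt_one_sub_le (hle a)
  have hcube : ∑ a, |hB.eigenvalues a| ^ 3 ≤ Real.sqrt (2 * c ^ 2 * gramPowerSum 2 x) *
        Real.sqrt (c ^ 4 * (offGram x ^ 4).trace) := by
    have h3 := Real.sum_mul_le_sqrt_mul_sqrt Finset.univ (fun a => |hB.eigenvalues a|)
      (fun a => hB.eigenvalues a ^ 2)
    simp only [sq_abs, ← pow_mul] at h3
    rw [htr2, htr4] at h3
    refine le_trans (le_of_eq (Finset.sum_congr rfl fun a _ => ?_)) h3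
    rw [← sq_abs (hB.eigenvalues a)]
    ring
  calc _ ≤ (Real.exp (∑ a, (hB.eigenvalues a / 2 + hB.eigenvalues a ^ 2 / 4 +
        |hB.eigenvalues a| ^ 3))) ^ d :=
        pow_le_pow_left₀ (Finset.prod_nonneg fun a _ => by positivity) hprod d
    _ ≤ _ := by
        rw [← Real.exp_nat_mul]
        refine Real.exp_le_exp.2 (mul_le_mul_of_nonneg_left ?_ (Nat.cast_nonneg d))
        rw [Finset.sum_add_distrib, Finset.sum_add_distrib, ← Finset.sum_div, ← Finset.sum_div,
          htr1, htr2]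
        linarith

/-- The compensator of the quadratic part. Off the diagonal, the arithmetic-geometric mean inequality
with weights `d` and `1 / d` separates `x` from `y` and balances the two sums. -/
theorem sum_weights_le [NeZero d] (hn : 0 < n) {κ : ℝ} {x y : Fin n → UnitSphere d}
    (hx : x ∈ typicalPoints n d κ) (hy : y ∈ typicalPoints n d κ) :
    ∑ k, ∑ i, ∑ j, (if i < k then gram x i k ^ 2 else 0) * (if j < k then gram x j k ^ 2 else 0) *
      gram y i j ^ 2 ≤ κ * (n ^ 2 / d ^ 2) + 2 * (κ * (n ^ 3 / d ^ 3)) := by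
  have hd : (0 : ℝ) < d := Nat.cast_pos.2 (NeZero.pos d)
  obtain ⟨-, hx4, -, -, hxc⟩ := typicalPoints_bounds hn hx
  obtain ⟨-, hy4, -, -, -⟩ := typicalPoints_bounds hn hy
  have hterm : ∀ k i j : Fin n, (if i < k then gram x i k ^ 2 else 0) *
      (if j < k then gram x j k ^ 2 else 0) * gram y i j ^ 2 ≤
      (if i = j then (if i < k then gram x i k ^ 4 else 0) else 0) +
      d / 2 * (if i < k ∧ j < k ∧ i ≠ j then gram x i k ^ 4 * gram x j k ^ 4 else 0) +
      1 / (2 * d) * offGram y i j ^ 4 := by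
    intro k i j
    by_cases hij : i = j
    · subst hij
      by_cases hi : i < k
      · simp only [gram_self, offGram_self, hi, if_true, ne_eq, not_true, and_false, if_false]
        exact le_of_eq (by ring)
      · simp [hi, offGram_self]
    simp only [hij, if_false, offGram]
    have h4 : 0 ≤ 1 / (2 * (d : ℝ)) * gram y i j ^ 4 := by positivity
    by_cases hi : i < k <;> by_cases hj : j < k <;>
      simp only [hi, hj, ne_eq, hij, not_false_eq_true, and_self, and_true, and_false,
        if_true, if_false, zero_mul, mul_zero, zero_add]
    · have h5 : 0 ≤ (d * (gram x i k ^ 2 * gram x j k ^ 2) - gram y i j ^ 2) ^ 2 / (2 * d) := by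
        positivity
      have h6 : (d * (gram x i k ^ 2 * gram x j k ^ 2) - gram y i j ^ 2) ^ 2 / (2 * d) =
          d / 2 * (gram x i k ^ 4 * gram x j k ^ 4) + 1 / (2 * d) * gram y i j ^ 4 -
          gram x i k ^ 2 * gram x j k ^ 2 * gram y i j ^ 2 := by
        field_simp
        ring
      linarith
    all_goals exact h4
  refine (Finset.sum_le_sum fun k _ => Finset.sum_le_sum fun i _ => Finset.sum_le_sum fun j _ =>
    hterm k i j).trans ?_
  simp only [Finset.sum_add_distrib, ← Finset.mul_sum]
  have e1 : ∑ k : Fin n, ∑ i, ∑ j, (if i = j then (if i < k then gram x i k ^ 4 else 0) else 0) =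
      gramPowerSum 4 x := by
    rw [gramPowerSum, sum_vertexPairs fun i j => gram x i j ^ 4]
    simp
  have e2 : ∑ i, ∑ j, offGram y i j ^ 4 = 2 * gramPowerSum 4 y := by
    rw [sum_sum_eq_two_mul_sum_vertexPairs (fun i j => by rw [offGram_comm])
      (fun i => by rw [offGram_self]; norm_num), gramPowerSum]
    congr 1
    refine Finset.sum_congr rfl fun e he => ?_
    rw [offGram, if_neg (mem_vertexPairs.1 he).ne]
  have e3 : ∑ k, ∑ i, ∑ j, (if i < k ∧ j < k ∧ i ≠ j then gram x i k ^ 4 * gram x j k ^ 4 else 0) =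
      gramColumnSum x := rfl
  rw [e1, e2, e3, Finset.sum_const, Finset.card_univ, Fintype.card_fin, nsmul_eq_mul]
  have k2 : d / 2 * gramColumnSum x ≤ d / 2 * (κ * (n ^ 3 / d ^ 4)) := by gcongr
  have k3 : 1 / (2 * (d : ℝ)) * (n * (2 * gramPowerSum 4 y)) ≤
      1 / (2 * d) * (n * (2 * (κ * (n ^ 2 / d ^ 2)))) := by gcongr
  have k4 : d / 2 * (κ * ((n : ℝ) ^ 3 / d ^ 4)) = κ * (n ^ 3 / d ^ 3) / 2 := by field_simp
  have k5 : 1 / (2 * (d : ℝ)) * (n * (2 * (κ * (n ^ 2 / d ^ 2)))) = κ * (n ^ 3 / d ^ 3) := by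
    field_simp
  have hcs : 0 ≤ κ * ((n : ℝ) ^ 3 / d ^ 3) := by
    have : 0 ≤ κ := (latentEnergy_nonneg x).trans hx
    positivity
  linarith

/-- The exponential moment of the quadratic part of the exponent, on the typical latent points. -/
theorem integral_exp_quadratic_le [NeZero d] (hn : 0 < n) {κ θ : ℝ} (hθ : 0 ≤ θ)
    {x : Fin n → UnitSphere d} (hx : x ∈ typicalPoints n d κ) :
    ∫ y in typicalPoints n d κ, Real.exp (-θ * ∑ e ∈ vertexPairs n,
        gram x e.1 e.2 ^ 2 * (gram y e.1 e.2 ^ 2 - 1 / d)) ∂(latentLaw (Fin n) d) ≤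
      Real.exp (θ ^ 2 / d ^ 2 * (κ * (n ^ 2 / d ^ 2) + 2 * (κ * (n ^ 3 / d ^ 3)))) := by
  set w : Fin n → Fin n → ℝ := fun i k => if i < k then gram x i k ^ 2 else 0 with hw
  set R : ℝ := κ * (n ^ 2 / d ^ 2) + 2 * (κ * (n ^ 3 / d ^ 3)) with hR
  have h := integral_latent_exp_compensated_le_one (d := d) θ hθ n w
    (fun i k => by simp only [hw]; split_ifs <;> positivity)
    (fun i k hki => if_neg hki.not_gt)
  set f : (Fin n → UnitSphere d) → ℝ := fun y => ∑ k, (-θ * ∑ i, w i k * (gram y i k ^ 2 - 1 / d) -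
        θ ^ 2 / d ^ 2 * ∑ i, ∑ j, w i k * w j k * gram y i j ^ 2) with hf
  have hfc : Continuous fun y => Real.exp (f y) := by
    simp only [hf]
    fun_prop
  have hle : ∀ y ∈ typicalPoints n d κ, Real.exp (-θ * ∑ e ∈ vertexPairs n,
        gram x e.1 e.2 ^ 2 * (gram y e.1 e.2 ^ 2 - 1 / d)) ≤
        Real.exp (f y) * Real.exp (θ ^ 2 / d ^ 2 * R) := by
    intro y hy
    rw [← Real.exp_add]
    refine Real.exp_le_exp.2 ?_
    have h1 := sum_weights_le hn hx hy
    have h2 : ∑ e ∈ vertexPairs n, gram x e.1 e.2 ^ 2 * (gram y e.1 e.2 ^ 2 - 1 / d) =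
        ∑ k, ∑ i, w i k * (gram y i k ^ 2 - 1 / d) := by
      rw [sum_vertexPairs fun i j => gram x i j ^ 2 * (gram y i j ^ 2 - 1 / d)]
      refine Finset.sum_congr rfl fun k _ => Finset.sum_congr rfl fun i _ => ?_
      simp only [hw]
      split_ifs <;> simp
    have h3 : f y = -θ * (∑ k, ∑ i, w i k * (gram y i k ^ 2 - 1 / d)) -
        θ ^ 2 / d ^ 2 * ∑ k, ∑ i, ∑ j, w i k * w j k * gram y i j ^ 2 := by
      simp only [hf, Finset.sum_sub_distrib, ← Finset.mul_sum]
    rw [h2, h3]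
    have h4 : θ ^ 2 / (d : ℝ) ^ 2 * ∑ k, ∑ i, ∑ j, w i k * w j k * gram y i j ^ 2 ≤
        θ ^ 2 / d ^ 2 * R := mul_le_mul_of_nonneg_left h1 (by positivity)
    linarith
  calc _ ≤ ∫ y in typicalPoints n d κ, Real.exp (f y) * Real.exp (θ ^ 2 / d ^ 2 * R)
        ∂(latentLaw (Fin n) d) := by
        refine setIntegral_mono_on ?_ ?_ (measurableSet_typicalPoints κ) hle
        · exact (integrable_of_continuous_compact (by fun_prop)).integrableOn
        · exact (integrable_of_continuous_compact (by fun_prop)).integrableOn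
    _ ≤ ∫ y, Real.exp (f y) * Real.exp (θ ^ 2 / d ^ 2 * R) ∂(latentLaw (Fin n) d) := by
        refine setIntegral_le_integral (integrable_of_continuous_compact (by fun_prop)) ?_
        exact Eventually.of_forall fun y => by positivity
    _ ≤ 1 * Real.exp (θ ^ 2 / d ^ 2 * R) := by
        rw [integral_mul_const]
        exact mul_le_mul_of_nonneg_right h (Real.exp_pos _).le
    _ = _ := one_mul _

/-- Hölder's inequality for exponentials. -/
theorem integral_exp_add_le {Ω : Type*} [MeasurableSpace Ω] {μ : Measure Ω} {f g : Ω → ℝ}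
    {P Q α β : ℝ} (hPQ : P.HolderConjugate Q) (hf : Integrable (fun y => Real.exp (P * f y)) μ)
    (hg : Integrable (fun y => Real.exp (Q * g y)) μ)
    (hfα : ∫ y, Real.exp (P * f y) ∂μ ≤ Real.exp (P * α))
    (hgβ : ∫ y, Real.exp (Q * g y) ∂μ ≤ Real.exp (Q * β)) :
    ∫ y, Real.exp (f y + g y) ∂μ ≤ Real.exp (α + β) := by
  have hP := hPQ.pos
  have hQ := hPQ.symm.pos
  have hyoung : ∀ y, Real.exp (f y + g y) ≤ Real.exp (α + β) *
      (Real.exp (P * f y) * (Real.exp (-(P * α)) / P) +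
        Real.exp (Q * g y) * (Real.exp (-(Q * β)) / Q)) := by
    intro y
    have h := Real.young_inequality_of_nonneg (Real.exp_pos (f y - α)).le
      (Real.exp_pos (g y - β)).le hPQ
    rw [← Real.exp_add, ← Real.exp_mul, ← Real.exp_mul] at h
    have e1 : (f y - α) * P = P * f y + -(P * α) := by ring
    have e2 : (g y - β) * Q = Q * g y + -(Q * β) := by ring
    rw [e1, e2, Real.exp_add (P * f y), Real.exp_add (Q * g y)] at h
    calc Real.exp (f y + g y) = Real.exp (α + β) * Real.exp (f y - α + (g y - β)) := by
          rw [← Real.exp_add]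
          congr 1
          ring
      _ ≤ _ := by
          refine mul_le_mul_of_nonneg_left (h.trans (le_of_eq ?_)) (Real.exp_pos _).le
          ring
  refine (integral_mono_of_nonneg (Eventually.of_forall fun y => (Real.exp_pos _).le)
    (((hf.mul_const _).add (hg.mul_const _)).const_mul _) (Eventually.of_forall hyoung)).trans ?_
  simp only [Pi.add_apply]
  rw [integral_const_mul, integral_add (hf.mul_const _) (hg.mul_const _), integral_mul_const,
    integral_mul_const]
  have k1 : (∫ y, Real.exp (P * f y) ∂μ) * (Real.exp (-(P * α)) / P) ≤ 1 / P := by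
    calc _ ≤ Real.exp (P * α) * (Real.exp (-(P * α)) / P) := by gcongr
      _ = 1 / P := by rw [← mul_div_assoc, ← Real.exp_add, add_neg_cancel, Real.exp_zero]
  have k2 : (∫ y, Real.exp (Q * g y) ∂μ) * (Real.exp (-(Q * β)) / Q) ≤ 1 / Q := by
    calc _ ≤ Real.exp (Q * β) * (Real.exp (-(Q * β)) / Q) := by gcongr
      _ = 1 / Q := by rw [← mul_div_assoc, ← Real.exp_add, add_neg_cancel, Real.exp_zero]
  have k3 : 1 / P + 1 / Q = 1 := by
    have := hPQ.inv_add_inv_eq_one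
    rwa [one_div, one_div]
  calc _ ≤ Real.exp (α + β) * 1 := by
        refine mul_le_mul_of_nonneg_left ?_ (Real.exp_pos _).le
        linarith
    _ = _ := mul_one _

/-- The truncated second moment of the likelihood ratio, given one copy `x` of the latent points. The
subtracted term `lam² / (2d) ∑ gram²` is the mean over `y` of the quadratic term of the exponent. -/
theorem integral_typical_prod_le [NeZero d] (hn : 0 < n) (h0 : 0 ≤ lam) (h1 : lam < 1)
    {κ P Q c : ℝ} (hPQ : P.HolderConjugate Q) (hc : (∫ ρ, ρ ∂(radialLaw d)) ^ 2 * c = P * lam)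
    {x : Fin n → UnitSphere d} (hx : x ∈ typicalPoints n d κ)
    (hcx : c ^ 4 * (offGram x ^ 4).trace ≤ 1 / 16) :
    ∫ y in typicalPoints n d κ, ∏ e ∈ vertexPairs n,
        (1 + lam * (gram x e.1 e.2 * gram y e.1 e.2)) ∂(latentLaw (Fin n) d) ≤
      Real.exp (lam ^ 3 / 3 * (κ * (n ^ 2 / d ^ 3)) - lam ^ 2 / (2 * d) * gramPowerSum 2 x +
        (d * (c ^ 2 * gramPowerSum 2 x / 2 + Real.sqrt (2 * c ^ 2 * gramPowerSum 2 x) *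
          Real.sqrt (c ^ 4 * (offGram x ^ 4).trace)) / P +
        Q * lam ^ 4 / (4 * d ^ 2) * (κ * (n ^ 2 / d ^ 2) + 2 * (κ * (n ^ 3 / d ^ 3))))) := by
  have hP := hPQ.pos
  have hQ := hPQ.symm.pos
  set π := latentLaw (Fin n) d
  set A := typicalPoints n d κ
  set E := d * (c ^ 2 * gramPowerSum 2 x / 2 + Real.sqrt (2 * c ^ 2 * gramPowerSum 2 x) *
          Real.sqrt (c ^ 4 * (offGram x ^ 4).trace)) with hE
  set R : ℝ := κ * (n ^ 2 / d ^ 2) + 2 * (κ * (n ^ 3 / d ^ 3)) with hR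
  set f : (Fin n → UnitSphere d) → ℝ := fun y =>
    lam * ∑ e ∈ vertexPairs n, gram x e.1 e.2 * gram y e.1 e.2 with hf
  set g : (Fin n → UnitSphere d) → ℝ := fun y => -(lam ^ 2 / 2) * ∑ e ∈ vertexPairs n,
    gram x e.1 e.2 ^ 2 * (gram y e.1 e.2 ^ 2 - 1 / d) with hg
  have hfc : Continuous f := by fun_prop
  have hgc : Continuous g := by fun_prop
  set b : ℝ := lam ^ 3 / 3 * (κ * (n ^ 2 / d ^ 3)) - lam ^ 2 / (2 * d) * gramPowerSum 2 x with hb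
  have hpoint : ∀ y ∈ A, ∏ e ∈ vertexPairs n, (1 + lam * (gram x e.1 e.2 * gram y e.1 e.2)) ≤
      Real.exp b * Real.exp (f y + g y) := by
    intro y hy
    refine (prod_one_add_le_exp h0 h1 x y).trans ?_
    rw [← Real.exp_add]
    refine Real.exp_le_exp.2 ?_
    have k1 := sum_gram_cube_le x y
    have k2 := (typicalPoints_bounds hn hx).2.2.1
    have k3 := (typicalPoints_bounds hn hy).2.2.1
    have k4 : lam ^ 3 / 3 * ∑ e ∈ vertexPairs n, gram x e.1 e.2 ^ 3 * gram y e.1 e.2 ^ 3 ≤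
        lam ^ 3 / 3 * (κ * (n ^ 2 / d ^ 3)) :=
      mul_le_mul_of_nonneg_left (by linarith) (by positivity)
    have k5 : g y = -(lam ^ 2 / 2) * ∑ e ∈ vertexPairs n, gram x e.1 e.2 ^ 2 * gram y e.1 e.2 ^ 2 +
        lam ^ 2 / (2 * d) * gramPowerSum 2 x := by
      simp only [hg, gramPowerSum, mul_sub, Finset.sum_sub_distrib, ← Finset.sum_mul]
      ring
    rw [k5, hb, hf]
    linarith
  -- The integrand is positive, and the linear part may be integrated over all `y`.
  have hI1 : ∫ y in A, Real.exp (P * f y) ∂π ≤ Real.exp (P * (E / P)) := by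
    rw [mul_div_cancel₀ _ hP.ne']
    refine (setIntegral_le_integral (integrable_of_continuous_compact (by fun_prop))
      (Eventually.of_forall fun y => (Real.exp_pos _).le)).trans ?_
    refine le_trans (le_of_eq ?_) (integral_exp_linear_le x hcx)
    simp only [hf, hc, mul_assoc]
    rfl
  have hI2 : ∫ y in A, Real.exp (Q * g y) ∂π ≤
      Real.exp (Q * (Q * lam ^ 4 / (4 * d ^ 2) * R)) := by
    have h := integral_exp_quadratic_le (θ := Q * (lam ^ 2 / 2)) hn (by positivity) hx
    refine (le_of_eq ?_).trans (h.trans (le_of_eq ?_))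
    · simp only [hg]
      congr 1
      ext y
      congr 1
      ring
    · congr 1
      rw [hR]
      ring
  have hH := integral_exp_add_le (μ := π.restrict A) hPQ
    (integrable_of_continuous_compact (by fun_prop)).integrableOn
    (integrable_of_continuous_compact (by fun_prop)).integrableOn hI1 hI2
  calc _ ≤ ∫ y in A, Real.exp b * Real.exp (f y + g y) ∂π := by
        refine setIntegral_mono_on ?_ ?_ (measurableSet_typicalPoints κ) hpoint
        · exact (integrable_of_continuous_compact (by fun_prop)).integrableOn
        · exact (integrable_of_continuous_compact (by fun_prop)).integrableOn
    _ ≤ Real.exp b * Real.exp (E / P + Q * lam ^ 4 / (4 * d ^ 2) * R) := by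
        rw [integral_const_mul]
        exact mul_le_mul_of_nonneg_left hH (Real.exp_pos _).le
    _ = _ := (Real.exp_add _ _).symm

end Exponent

/-! ### The bound above the critical dimension -/

/-- The chord of a convex function on `[0, 1/2]`. -/
theorem inv_one_sub_pow_four_le {h : ℝ} (h0 : 0 ≤ h) (h1 : h ≤ 1 / 2) :
    1 / (1 - h) ^ 4 ≤ 1 + 30 * h := by
  have hpos : 0 < (1 - h) ^ 4 := pow_pos (by linarith) 4
  rw [div_le_iff₀ hpos]
  have h2 : 0 ≤ 26 - 62 * h + 52 * h ^ 2 - 15 * h ^ 3 := by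
    nlinarith [mul_nonneg (sq_nonneg h) (sub_nonneg.2 h1), sq_nonneg (h - 31 / 44)]
  have h3 := mul_nonneg (mul_nonneg h0 (sub_nonneg.2 h1)) h2
  nlinarith

/-- The mean norm `m` of a Gaussian vector satisfies `m² ≈ d`. -/
theorem radialLaw_mean_bounds {d : ℕ} [NeZero d] (hV : gaussianSqVar ≤ d) :
    d / 4 ≤ (∫ ρ, ρ ∂(radialLaw d)) ^ 2 ∧
      d ^ 2 / (∫ ρ, ρ ∂(radialLaw d)) ^ 4 ≤ 1 + 15 * gaussianSqVar / d := by
  have hd : (0 : ℝ) < d := Nat.cast_pos.2 (NeZero.pos d)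
  set m := ∫ ρ, ρ ∂(radialLaw d)
  have hm := integral_radialLaw_ge (d := d)
  set h := gaussianSqVar / (2 * d) with hh
  have h0 : 0 ≤ h := div_nonneg gaussianSqVar_nonneg (by positivity)
  have h1 : h ≤ 1 / 2 := by
    rw [hh, div_le_iff₀ (by positivity)]
    linarith
  have h2 : d * (1 - h) ^ 2 ≤ m ^ 2 := by
    calc d * (1 - h) ^ 2 = (Real.sqrt d * (1 - h)) ^ 2 := by
          rw [mul_pow, Real.sq_sqrt hd.le]
      _ ≤ m ^ 2 := pow_le_pow_left₀ (mul_nonneg (Real.sqrt_nonneg _) (by linarith)) hm 2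
  have hs : 0 < 1 - h := by linarith
  constructor
  · refine le_trans ?_ h2
    nlinarith [mul_nonneg hd.le (mul_nonneg (sub_nonneg.2 h1) (by linarith : 0 ≤ 3 / 2 - h))]
  · have h3 : (d : ℝ) ^ 2 * (1 - h) ^ 4 ≤ m ^ 4 := by
      calc (d : ℝ) ^ 2 * (1 - h) ^ 4 = (d * (1 - h) ^ 2) ^ 2 := by ring
        _ ≤ (m ^ 2) ^ 2 := pow_le_pow_left₀ (by positivity) h2 2
        _ = m ^ 4 := by ring
    calc (d : ℝ) ^ 2 / m ^ 4 ≤ d ^ 2 / (d ^ 2 * (1 - h) ^ 4) := by gcongr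
      _ = 1 / (1 - h) ^ 4 := by field_simp
      _ ≤ 1 + 30 * h := inv_one_sub_pow_four_le h0 h1
      _ = 1 + 15 * gaussianSqVar / d := by
          rw [hh]
          field_simp
          ring

section Magnitudes

/-! In the parametrization `d = t³`, `n lam = ν t⁴`, the Hölder exponents are `1 + t⁻²` and `1 + t²`,
and each part of the exponent is at most of the order `κ ν²`. -/

variable {n d lam κ t ν Q2 T4 c m V : ℝ}

theorem cubic_part_le (h1 : lam < 1) (hκ : 0 ≤ κ) (ht : 1 ≤ t) (htd : d = t ^ 3)
    (hν : n * lam = ν * t ^ 4) : lam ^ 3 / 3 * (κ * (n ^ 2 / d ^ 3)) ≤ κ * ν ^ 2 := by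
  have ht0 : 0 < t := by linarith
  calc lam ^ 3 / 3 * (κ * (n ^ 2 / d ^ 3)) = lam / 3 * (κ * ((n * lam) ^ 2 / d ^ 3)) := by ring
    _ = lam / 3 * (κ * ν ^ 2 / t) := by rw [hν, htd]; field_simp
    _ ≤ 1 * (κ * ν ^ 2) :=
        mul_le_mul (by linarith) (div_le_self (by positivity) ht) (by positivity) zero_le_one
    _ = _ := one_mul _

theorem fourth_spectral_moment_le (hn : 0 ≤ n) (h1 : lam < 1) (hκ : 0 ≤ κ)
    (ht : 1 ≤ t) (htd : d = t ^ 3) (hν : n * lam = ν * t ^ 4) (hν0 : 0 ≤ ν) (hν1 : ν ≤ 1)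
    (hc0 : 0 ≤ c) (hc : c ≤ 8 * lam / d) (hT4 : T4 ≤ κ * (n ^ 4 / d ^ 3 + n ^ 3 / d ^ 2)) :
    c ^ 4 * T4 ≤ 8192 * (κ * ν ^ 3) / t ^ 5 := by
  have ht0 : 0 < t := by linarith
  have hd : 0 < d := by rw [htd]; positivity
  have e1 : (8 * lam / d) ^ 4 * (κ * (n ^ 4 / d ^ 3 + n ^ 3 / d ^ 2)) =
      4096 * κ * ((n * lam) ^ 4 / d ^ 7 + lam * ((n * lam) ^ 3 / d ^ 6)) := by
    field_simp
    ring
  have e2 : (n * lam) ^ 4 / d ^ 7 = ν ^ 4 / t ^ 5 := by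
    rw [hν, htd]
    field_simp
  have e3 : (n * lam) ^ 3 / d ^ 6 = ν ^ 3 / t ^ 6 := by
    rw [hν, htd]
    field_simp
  have k1 : ν ^ 4 / t ^ 5 ≤ ν ^ 3 / t ^ 5 :=
    div_le_div_of_nonneg_right (pow_le_pow_of_le_one hν0 hν1 (by norm_num)) (by positivity)
  have k3 : ν ^ 3 / t ^ 6 ≤ ν ^ 3 / t ^ 5 :=
    div_le_div_of_nonneg_left (by positivity) (by positivity) (pow_le_pow_right₀ ht (by norm_num))
  have k2 : lam * (ν ^ 3 / t ^ 6) ≤ ν ^ 3 / t ^ 5 := by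
    calc lam * (ν ^ 3 / t ^ 6) ≤ 1 * (ν ^ 3 / t ^ 5) :=
          mul_le_mul h1.le k3 (by positivity) zero_le_one
      _ = _ := one_mul _
  calc c ^ 4 * T4 ≤ c ^ 4 * (κ * (n ^ 4 / d ^ 3 + n ^ 3 / d ^ 2)) :=
        mul_le_mul_of_nonneg_left hT4 (by positivity)
    _ ≤ (8 * lam / d) ^ 4 * (κ * (n ^ 4 / d ^ 3 + n ^ 3 / d ^ 2)) :=
        mul_le_mul_of_nonneg_right (pow_le_pow_left₀ hc0 hc 4) (by positivity)
    _ = 4096 * κ * (ν ^ 4 / t ^ 5 + lam * (ν ^ 3 / t ^ 6)) := by rw [e1, e2, e3]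
    _ ≤ 4096 * κ * (ν ^ 3 / t ^ 5 + ν ^ 3 / t ^ 5) :=
        mul_le_mul_of_nonneg_left (add_le_add k1 k2) (by positivity)
    _ = _ := by ring

theorem second_spectral_moment_le (hκ : 0 ≤ κ) (ht : 1 ≤ t) (htd : d = t ^ 3)
    (hν : n * lam = ν * t ^ 4) (hc0 : 0 ≤ c) (hc : c ≤ 8 * lam / d)
    (hQ2 : Q2 ≤ κ * (n ^ 2 / d)) : 2 * c ^ 2 * Q2 ≤ 128 * (κ * ν ^ 2) / t := by
  have ht0 : 0 < t := by linarith
  have hd : 0 < d := by rw [htd]; positivity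
  calc 2 * c ^ 2 * Q2 ≤ 2 * c ^ 2 * (κ * (n ^ 2 / d)) :=
        mul_le_mul_of_nonneg_left hQ2 (by positivity)
    _ ≤ 2 * (8 * lam / d) ^ 2 * (κ * (n ^ 2 / d)) :=
        mul_le_mul_of_nonneg_right (mul_le_mul_of_nonneg_left (pow_le_pow_left₀ hc0 hc 2)
          zero_le_two) (by positivity)
    _ = 128 * κ * ((n * lam) ^ 2 / d ^ 3) := by
        field_simp
        ring
    _ = 128 * (κ * ν ^ 2) / t := by
        rw [hν, htd]
        field_simp

/-- The leading terms cancel, up to `t⁻²` from the Hölder exponent and `d⁻¹` from the mean norm. -/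
theorem linear_part_sub_compensator_le (hκ : 0 ≤ κ) (ht : 1 ≤ t) (htd : d = t ^ 3)
    (hν : n * lam = ν * t ^ 4) (hQ0 : 0 ≤ Q2) (hQ2 : Q2 ≤ κ * (n ^ 2 / d)) (hV : 0 ≤ V)
    (hm0 : 0 < m ^ 2) (hm1 : d / 4 ≤ m ^ 2) (hm2 : d ^ 2 / m ^ 4 ≤ 1 + 15 * V / d) :
    d * (((1 + 1 / t ^ 2) * lam / m ^ 2) ^ 2 * Q2 / 2) / (1 + 1 / t ^ 2) -
      lam ^ 2 / (2 * d) * Q2 ≤ (8 + 8 * V) * (κ * ν ^ 2) := by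
  have ht0 : 0 < t := by linarith
  have hd : 0 < d := by rw [htd]; positivity
  have hP : 0 < 1 + 1 / t ^ 2 := by positivity
  have hcancel : ∀ P M : ℝ, 0 < P → 0 < M → d * ((P * lam / M) ^ 2 * Q2 / 2) / P -
      lam ^ 2 / (2 * d) * Q2 = lam ^ 2 / (2 * d) * Q2 * (P * (d ^ 2 / M ^ 2) - 1) := by
    intro P M hP hM
    field_simp
  rw [hcancel _ _ hP hm0, ← pow_mul]
  have k1 : lam ^ 2 / (2 * d) * Q2 ≤ κ * ν ^ 2 * t ^ 2 / 2 := by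
    calc lam ^ 2 / (2 * d) * Q2 ≤ lam ^ 2 / (2 * d) * (κ * (n ^ 2 / d)) :=
          mul_le_mul_of_nonneg_left hQ2 (by positivity)
      _ = κ * ((n * lam) ^ 2 / d ^ 2) / 2 := by field_simp
      _ = κ * ν ^ 2 * t ^ 2 / 2 := by
          rw [hν, htd]
          field_simp
  have k2 : d ^ 2 / m ^ 4 ≤ 16 := by
    have : 0 < m ^ 4 := by
      have e : m ^ 4 = (m ^ 2) ^ 2 := by ring
      rw [e]
      positivity
    rw [div_le_iff₀ this]
    nlinarith [mul_le_mul hm1 hm1 (by positivity) hm0.le]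
  have k3 : (1 + 1 / t ^ 2) * (d ^ 2 / m ^ 4) - 1 ≤ (16 + 15 * V) / t ^ 2 := by
    have k4 : 15 * V / d ≤ 15 * V / t ^ 2 := by
      rw [htd]
      exact div_le_div_of_nonneg_left (by positivity) (by positivity)
        (pow_le_pow_right₀ ht (by norm_num))
    have k5 : 1 / t ^ 2 * (d ^ 2 / m ^ 4) ≤ 1 / t ^ 2 * 16 :=
      mul_le_mul_of_nonneg_left k2 (by positivity)
    have k6 : (16 + 15 * V) / t ^ 2 = 1 / t ^ 2 * 16 + 15 * V / t ^ 2 := by ring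
    linarith
  norm_num only
  calc _ ≤ lam ^ 2 / (2 * d) * Q2 * ((16 + 15 * V) / t ^ 2) :=
        mul_le_mul_of_nonneg_left k3 (by positivity)
    _ ≤ κ * ν ^ 2 * t ^ 2 / 2 * ((16 + 15 * V) / t ^ 2) :=
        mul_le_mul_of_nonneg_right k1 (by positivity)
    _ = (16 + 15 * V) / 2 * (κ * ν ^ 2) := by field_simp
    _ ≤ _ := mul_le_mul_of_nonneg_right (by linarith) (by positivity)

theorem spectral_remainder_le {a b P : ℝ} (hκ : 0 ≤ κ) (ht : 1 ≤ t) (htd : d = t ^ 3)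
    (hν1 : ν ≤ 1) (ha0 : 0 ≤ a) (ha : a ≤ 128 * (κ * ν ^ 2) / t) (hb0 : 0 ≤ b)
    (hb : b ≤ 8192 * (κ * ν ^ 3) / t ^ 5) (hP : 1 ≤ P) :
    d * (Real.sqrt a * Real.sqrt b) / P ≤ 1024 * (κ * ν ^ 2) := by
  have ht0 : 0 < t := by linarith
  have hd : 0 < d := by rw [htd]; positivity
  have k1 : Real.sqrt a * Real.sqrt b ≤ 1024 * (κ * ν ^ 2) / t ^ 3 := by
    rw [← Real.sqrt_mul ha0]
    refine Real.sqrt_le_iff.2 ⟨by positivity, ?_⟩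
    calc a * b ≤ 128 * (κ * ν ^ 2) / t * (8192 * (κ * ν ^ 3) / t ^ 5) :=
          mul_le_mul ha hb hb0 (by positivity)
      _ = ν * (1024 * (κ * ν ^ 2) / t ^ 3) ^ 2 := by
          field_simp
          ring
      _ ≤ 1 * (1024 * (κ * ν ^ 2) / t ^ 3) ^ 2 :=
          mul_le_mul_of_nonneg_right hν1 (by positivity)
      _ = _ := one_mul _
  calc _ ≤ d * (Real.sqrt a * Real.sqrt b) := div_le_self (by positivity) hP
    _ ≤ d * (1024 * (κ * ν ^ 2) / t ^ 3) := mul_le_mul_of_nonneg_left k1 hd.le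
    _ = _ := by
        rw [htd]
        field_simp

theorem quadratic_part_le (h0 : 0 ≤ lam) (h1 : lam < 1) (hκ : 0 ≤ κ)
    (ht : 1 ≤ t) (htd : d = t ^ 3) (hν : n * lam = ν * t ^ 4) (hν0 : 0 ≤ ν) (hν1 : ν ≤ 1) :
    (1 + t ^ 2) * lam ^ 4 / (4 * d ^ 2) * (κ * (n ^ 2 / d ^ 2) + 2 * (κ * (n ^ 3 / d ^ 3))) ≤
      2 * (κ * ν ^ 2) := by
  have ht0 : 0 < t := by linarith
  have hd : 0 < d := by rw [htd]; positivity
  have e1 : (1 + t ^ 2) * lam ^ 4 / (4 * d ^ 2) *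
      (κ * (n ^ 2 / d ^ 2) + 2 * (κ * (n ^ 3 / d ^ 3))) = (1 + t ^ 2) / 4 * κ *
      (lam ^ 2 * ((n * lam) ^ 2 / d ^ 4) + 2 * (lam * ((n * lam) ^ 3 / d ^ 5))) := by
    field_simp
  have e2 : (n * lam) ^ 2 / d ^ 4 = ν ^ 2 / t ^ 4 := by
    rw [hν, htd]
    field_simp
  have e3 : (n * lam) ^ 3 / d ^ 5 = ν ^ 3 / t ^ 3 := by
    rw [hν, htd]
    field_simp
  have k1 : lam ^ 2 * (ν ^ 2 / t ^ 4) ≤ ν ^ 2 / t ^ 2 := by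
    calc lam ^ 2 * (ν ^ 2 / t ^ 4) ≤ 1 * (ν ^ 2 / t ^ 2) :=
          mul_le_mul (pow_le_one₀ h0 h1.le) (div_le_div_of_nonneg_left (by positivity)
            (by positivity) (pow_le_pow_right₀ ht (by norm_num))) (by positivity) zero_le_one
      _ = _ := one_mul _
  have k2 : lam * (ν ^ 3 / t ^ 3) ≤ ν ^ 2 / t ^ 2 := by
    calc lam * (ν ^ 3 / t ^ 3) ≤ 1 * (ν ^ 2 / t ^ 2) :=
          mul_le_mul h1.le (div_le_div₀ (by positivity)
            (pow_le_pow_of_le_one hν0 hν1 (by norm_num)) (by positivity)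
            (pow_le_pow_right₀ ht (by norm_num))) (by positivity) zero_le_one
      _ = _ := one_mul _
  have ht2 : 1 ≤ t ^ 2 := one_le_pow₀ ht
  rw [e1, e2, e3]
  calc _ ≤ (1 + t ^ 2) / 4 * κ * (ν ^ 2 / t ^ 2 + 2 * (ν ^ 2 / t ^ 2)) :=
        mul_le_mul_of_nonneg_left (add_le_add k1 (by linarith)) (by positivity)
    _ ≤ (t ^ 2 + t ^ 2) / 4 * κ * (ν ^ 2 / t ^ 2 + 2 * (ν ^ 2 / t ^ 2)) := by
        gcongr
    _ = 3 / 2 * (κ * ν ^ 2) := by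
        field_simp
        ring
    _ ≤ _ := mul_le_mul_of_nonneg_right (by norm_num) (by positivity)

end Magnitudes

theorem integral_typical_prod_le_exp {n d : ℕ} [NeZero d] (hn : 0 < n) {lam κ t ν : ℝ}
    (h0 : 0 ≤ lam) (h1 : lam < 1) (hV : gaussianSqVar ≤ d) (ht : 1 ≤ t) (htd : (d : ℝ) = t ^ 3)
    (hν : n * lam = ν * t ^ 4) (hν1 : ν ≤ 1) (hκν : 2 ^ 17 * (κ * ν ^ 3) ≤ 1)
    {x : Fin n → UnitSphere d} (hx : x ∈ typicalPoints n d κ) :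
    ∫ y in typicalPoints n d κ, ∏ e ∈ vertexPairs n,
        (1 + lam * (gram x e.1 e.2 * gram y e.1 e.2)) ∂(latentLaw (Fin n) d) ≤
      Real.exp ((1040 + 8 * gaussianSqVar) * (κ * ν ^ 2)) := by
  have hd : (0 : ℝ) < d := Nat.cast_pos.2 (NeZero.pos d)
  have ht0 : 0 < t := by linarith
  have hκ : 0 ≤ κ := (latentEnergy_nonneg x).trans hx
  have hV0 := gaussianSqVar_nonneg
  have hν0 : 0 ≤ ν := by
    have : 0 ≤ ν * t ^ 4 := by rw [← hν]; positivity
    exact nonneg_of_mul_nonneg_left this (by positivity)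
  obtain ⟨hm1, hm2⟩ := radialLaw_mean_bounds hV
  obtain ⟨b2, -, -, b4, -⟩ := typicalPoints_bounds hn hx
  have hQ2 : 0 ≤ gramPowerSum 2 x := gramPowerSum_even_nonneg 1 x
  have hT4 := trace_offGram_pow_four_nonneg x
  have hm0 : 0 < (∫ ρ, ρ ∂(radialLaw d)) ^ 2 := by linarith [div_pos hd (by norm_num : (0 : ℝ) < 4)]
  have hPQ : (1 + 1 / t ^ 2).HolderConjugate (1 + t ^ 2) := by
    rw [Real.holderConjugate_iff]
    refine ⟨by linarith [(by positivity : 0 < 1 / t ^ 2)], ?_⟩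
    field_simp
    ring
  have hP2 : 1 + 1 / t ^ 2 ≤ 2 := by
    have : 1 / t ^ 2 ≤ 1 := by
      rw [div_le_one (by positivity)]
      exact one_le_pow₀ ht
    linarith
  have hP0 := hPQ.pos
  have hc0 : 0 ≤ (1 + 1 / t ^ 2) * lam / (∫ ρ, ρ ∂(radialLaw d)) ^ 2 := by positivity
  have hc : (1 + 1 / t ^ 2) * lam / (∫ ρ, ρ ∂(radialLaw d)) ^ 2 ≤ 8 * lam / d := by
    calc _ ≤ 2 * lam / ((d : ℝ) / 4) :=
          div_le_div₀ (by positivity) (mul_le_mul_of_nonneg_right hP2 h0) (by positivity) hm1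
      _ = 8 * lam / d := by
          field_simp
          ring
  have hmc : (∫ ρ, ρ ∂(radialLaw d)) ^ 2 *
      ((1 + 1 / t ^ 2) * lam / (∫ ρ, ρ ∂(radialLaw d)) ^ 2) = (1 + 1 / t ^ 2) * lam :=
    mul_div_cancel₀ _ hm0.ne'
  have T2 := linear_part_sub_compensator_le hκ ht htd hν hQ2 b2 hV0 hm0 hm1 hm2
  have hcT := fourth_spectral_moment_le (Nat.cast_nonneg n) h1 hκ ht htd hν hν0 hν1 hc0 hc b4
  have hcQ := second_spectral_moment_le hκ ht htd hν hc0 hc b2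
  generalize (1 + 1 / t ^ 2) * lam / (∫ ρ, ρ ∂(radialLaw d)) ^ 2 = c at *
  have hcT' : c ^ 4 * (offGram x ^ 4).trace ≤ 1 / 16 := by
    refine hcT.trans ?_
    have : 8192 * (κ * ν ^ 3) / t ^ 5 ≤ 8192 * (κ * ν ^ 3) :=
      div_le_self (by positivity) (one_le_pow₀ ht)
    linarith
  refine (integral_typical_prod_le hn h0 h1 hPQ hmc hx hcT').trans (Real.exp_le_exp.2 ?_)
  have T1 := cubic_part_le h1 hκ ht htd hν
  have T3 := spectral_remainder_le hκ ht htd hν1 (by positivity) hcQ (by positivity) hcT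
    hPQ.lt.le
  have T4 := quadratic_part_le h0 h1 hκ ht htd hν hν0 hν1
  have hκν2 : 0 ≤ κ * ν ^ 2 := by positivity
  rw [mul_add (d : ℝ), add_div]
  linarith

/-- For `p < 1/2` the parameter `r² / (p (1 - p))` is below one, as the expansion requires. -/
theorem rggTV_le_of_large_dimension {n d : ℕ} [NeZero d] (hn : 0 < n) {p r κ t ν : ℝ}
    {K : RGGKernel} (hp : 0 < p) (hp2 : p < 1 / 2) (hr : 0 ≤ r) (hrp : r ≤ p)
    (hK : ∀ t : Set.Icc (-1 : ℝ) 1, (K t : ℝ) = p + r * t) (hκ : 0 < κ)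
    (hV : gaussianSqVar ≤ d) (ht : 1 ≤ t) (htd : (d : ℝ) = t ^ 3)
    (hν : n * (r ^ 2 / (p * (1 - p))) = ν * t ^ 4) (hν1 : ν ≤ 1)
    (hκν : 2 ^ 17 * (κ * ν ^ 3) ≤ 1) :
    rggTV n d K ≤ energyBound / κ +
      Real.sqrt (Real.exp ((1040 + 8 * gaussianSqVar) * (κ * ν ^ 2)) - 1 + energyBound / κ) := by
  have hp1 : 0 < p * (1 - p) := mul_pos hp (by linarith)
  have h0 : 0 ≤ r ^ 2 / (p * (1 - p)) := by positivity
  have h1 : r ^ 2 / (p * (1 - p)) < 1 := by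
    rw [div_lt_one hp1]
    nlinarith [mul_le_mul hrp hrp hr hp.le]
  have h := rggTV_le_truncated (n := n) (d := d) hp hp2 hr hrp hK (measurableSet_typicalPoints κ)
    (fun x hx => integral_typical_prod_le_exp hn h0 h1 hV ht htd hν hν1 hκν hx)
  have hA := one_sub_le_typicalPoints (n := n) (d := d) hn hκ
  have hA1 : (latentLaw (Fin n) d).real (typicalPoints n d κ) ≤ 1 := measureReal_le_one
  set a := (latentLaw (Fin n) d).real (typicalPoints n d κ)
  have hM : 1 ≤ Real.exp ((1040 + 8 * gaussianSqVar) * (κ * ν ^ 2)) :=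
    Real.one_le_exp (mul_nonneg (by linarith [gaussianSqVar_nonneg]) (by positivity))
  refine h.trans (add_le_add (by linarith) (Real.sqrt_le_sqrt ?_))
  nlinarith

/-! ### The critical dimension -/

section Asymptotics

/-- The lower bound on `r` enters through this limit only; a growing factor in place of the logarithm
would do. -/
theorem tendsto_signal_atTop {p r : ℕ → ℝ} {c : ℝ} (hp : ∀ n, 0 < p n) (hc : 0 < c)
    (hrlow : ∀ᶠ n : ℕ in atTop, c * (Real.sqrt (p n / n) * Real.log n) ≤ r n) :
    Tendsto (fun n : ℕ => n * r n ^ 2 / p n) atTop atTop := by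
  have hlog : Tendsto (fun n : ℕ => Real.log n) atTop atTop :=
    Real.tendsto_log_atTop.comp tendsto_natCast_atTop_atTop
  have h : Tendsto (fun n : ℕ => c ^ 2 * Real.log n ^ 2) atTop atTop :=
    ((tendsto_pow_atTop two_ne_zero).comp hlog).const_mul_atTop (by positivity)
  refine tendsto_atTop_mono' _ ?_ h
  filter_upwards [hrlow, eventually_gt_atTop 0] with n hn hn0
  have hn0' : (0 : ℝ) < n := Nat.cast_pos.2 hn0
  have h1 : 0 ≤ Real.log n := Real.log_natCast_nonneg n
  have h2 : (c * (Real.sqrt (p n / n) * Real.log n)) ^ 2 ≤ r n ^ 2 :=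
    pow_le_pow_left₀ (by positivity) hn 2
  rw [mul_pow, mul_pow, Real.sq_sqrt (div_nonneg (hp n).le hn0'.le)] at h2
  rw [le_div_iff₀ (hp n)]
  calc c ^ 2 * Real.log n ^ 2 * p n = n * (c ^ 2 * (p n / n * Real.log n ^ 2)) := by
        field_simp
    _ ≤ n * r n ^ 2 := mul_le_mul_of_nonneg_left h2 hn0'.le

/-- The truncation level `κ` is sent to infinity after `n`. -/
theorem tendsto_zero_of_le_truncated {u ν : ℕ → ℝ} {B C : ℝ} (hu : ∀ n, 0 ≤ u n)
    (hν : Tendsto ν atTop (𝓝 0))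
    (h : ∀ κ : ℝ, 0 < κ → ∀ᶠ n in atTop,
      u n ≤ B / κ + Real.sqrt (Real.exp (C * (κ * ν n ^ 2)) - 1 + B / κ)) :
    Tendsto u atTop (𝓝 0) := by
  have hB : Tendsto (fun κ : ℝ => B / κ) atTop (𝓝 0) := tendsto_const_nhds.div_atTop tendsto_id
  have hg : Tendsto (fun κ : ℝ => B / κ + Real.sqrt (B / κ)) atTop (𝓝 0) := by
    simpa using hB.add (hB.sqrt)
  rw [tendsto_order]
  refine ⟨fun b hb => Eventually.of_forall fun n => hb.trans_le (hu n), fun b hb => ?_⟩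
  obtain ⟨κ, hκb, hκ⟩ := ((hg.eventually_lt_const hb).and (eventually_gt_atTop 0)).exists
  have hexp : Tendsto (fun n => B / κ + Real.sqrt (Real.exp (C * (κ * ν n ^ 2)) - 1 + B / κ)) atTop
      (𝓝 (B / κ + Real.sqrt (B / κ))) := by
    have h1 : Tendsto (fun n => C * (κ * ν n ^ 2)) atTop (𝓝 0) := by
      simpa using ((hν.pow 2).const_mul κ).const_mul C
    have h2 : Tendsto (fun n => Real.exp (C * (κ * ν n ^ 2)) - 1 + B / κ) atTop (𝓝 (B / κ)) := by
      simpa using ((Real.continuous_exp.tendsto 0).comp h1).sub_const 1 |>.add_const (B / κ)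
    exact h2.sqrt.const_add _
  filter_upwards [h κ hκ, hexp.eventually_lt_const hκb] with n h1 h2 using h1.trans_lt h2

variable {p r : ℕ → ℝ} {K : ℕ → RGGKernel} {d : ℕ → ℕ}

theorem tendsto_rggTV_one (hp : ∀ n, 0 < p n ∧ p n < 1 / 2) (hr : ∀ n, 0 < r n ∧ r n ≤ p n)
    (hK : ∀ n (t : Set.Icc (-1 : ℝ) 1), (K n t : ℝ) = p n + r n * t) (hd : ∀ n, 1 ≤ d n)
    (hsig : Tendsto (fun n : ℕ => n * r n ^ 2 / p n) atTop atTop)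
    (hsmall : (fun n => (d n : ℝ)) =o[atTop] fun n => (n * r n ^ 2 / p n) ^ (3 / 4 : ℝ)) :
    Tendsto (fun n => rggTV n (d n) (K n)) atTop (𝓝 1) := by
  set a : ℕ → ℝ := fun n => n * r n ^ 2 / p n with ha
  set δ : ℕ → ℝ := fun n => d n / a n ^ (3 / 4 : ℝ) with hδ
  have hδ0 : Tendsto δ atTop (𝓝 0) := hsmall.tendsto_div_nhds_zero
  have hlow : Tendsto (fun n => 1 - (27000 * δ n ^ 4 + 900 * δ n)) atTop (𝓝 1) := by
    simpa using ((hδ0.pow 4).const_mul 27000 |>.add (hδ0.const_mul 900)).const_sub 1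
  refine tendsto_of_tendsto_of_tendsto_of_le_of_le' hlow tendsto_const_nhds ?_ ?_
  -- `δ` bounds both error terms, as `d / a ≤ δ` for `a ≥ 1`, and `n ≤ 5 ⌊n / 3⌋`.
  · filter_upwards [eventually_ge_atTop 3, hsig.eventually_ge_atTop 1] with n hn ha1
    have : NeZero (d n) := ⟨by have := hd n; omega⟩
    obtain ⟨hp0, hp2⟩ := hp n
    obtain ⟨hr0, hrp⟩ := hr n
    have hdn : (0 : ℝ) < d n := Nat.cast_pos.2 (hd n)
    have hn0 : (0 : ℝ) < n := Nat.cast_pos.2 (by omega)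
    have hn1 : (1 : ℝ) ≤ n := Nat.one_le_cast.2 (by omega)
    have hN0 : (0 : ℝ) < (n / 3 : ℕ) := Nat.cast_pos.2 (by omega)
    have hN : (n : ℝ) ≤ 5 * (n / 3 : ℕ) := by exact_mod_cast (by omega : n ≤ 5 * (n / 3))
    have h := rggTV_ge_signedTriangles (N := n / 3) (n := n) (d := d n) hp0 hp2.le hr0 hrp (hK n)
      (by omega) (by omega)
    refine le_trans ?_ h
    have hapos : 0 < a n := by linarith
    have e1 : δ n ^ 4 = p n ^ 3 * d n ^ 4 / (n ^ 3 * r n ^ 6) := by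
      have : (a n ^ (3 / 4 : ℝ)) ^ 4 = a n ^ 3 := by
        rw [← Real.rpow_natCast, ← Real.rpow_mul hapos.le, ← Real.rpow_natCast]
        norm_num
      simp only [hδ]
      rw [div_pow, this, ha]
      field_simp
    have k1 : p n ^ 3 * d n ^ 4 / ((n / 3 : ℕ) ^ 3 * r n ^ 6) ≤ 125 * δ n ^ 4 := by
      rw [e1, ← mul_div_assoc, div_le_div_iff₀ (by positivity) (by positivity)]
      have : (n : ℝ) ^ 3 ≤ 125 * (n / 3 : ℕ) ^ 3 := by
        calc (n : ℝ) ^ 3 ≤ (5 * (n / 3 : ℕ)) ^ 3 := pow_le_pow_left₀ hn0.le hN 3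
          _ = _ := by ring
      calc p n ^ 3 * d n ^ 4 * (n ^ 3 * r n ^ 6) = (p n ^ 3 * d n ^ 4 * r n ^ 6) * n ^ 3 := by ring
        _ ≤ (p n ^ 3 * d n ^ 4 * r n ^ 6) * (125 * (n / 3 : ℕ) ^ 3) :=
            mul_le_mul_of_nonneg_left this (by positivity)
        _ = _ := by ring
    have k2 : p n * d n / ((n / 3 : ℕ) ^ 2 * r n ^ 2) ≤ 25 * δ n := by
      have e2 : d n / a n = p n * d n / (n * r n ^ 2) := by
        simp only [ha]
        field_simp
      have k3 : d n / a n ≤ δ n := by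
        refine div_le_div_of_nonneg_left hdn.le (Real.rpow_pos_of_pos hapos _) ?_
        calc a n ^ (3 / 4 : ℝ) ≤ a n ^ (1 : ℝ) :=
              Real.rpow_le_rpow_of_exponent_le ha1 (by norm_num)
          _ = a n := Real.rpow_one _
      refine le_trans ?_ (mul_le_mul_of_nonneg_left k3 (by norm_num))
      rw [e2, ← mul_div_assoc, div_le_div_iff₀ (by positivity) (by positivity)]
      have : (n : ℝ) ≤ 25 * (n / 3 : ℕ) ^ 2 := by
        calc (n : ℝ) ≤ n ^ 2 := by nlinarith
          _ ≤ (5 * (n / 3 : ℕ)) ^ 2 := pow_le_pow_left₀ hn0.le hN 2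
          _ = _ := by ring
      calc p n * d n * (n * r n ^ 2) = (p n * d n * r n ^ 2) * n := by ring
        _ ≤ (p n * d n * r n ^ 2) * (25 * (n / 3 : ℕ) ^ 2) :=
            mul_le_mul_of_nonneg_left this (by positivity)
        _ = _ := by ring
    linarith
  · refine Eventually.of_forall fun n => ?_
    have : NeZero (d n) := ⟨by have := hd n; omega⟩
    exact rggTV_le_one (hp n).2.le (hr n).1.le (hr n).2 (hK n)

theorem tendsto_rggTV_zero (hp : ∀ n, 0 < p n ∧ p n < 1 / 2) (hr : ∀ n, 0 < r n ∧ r n ≤ p n)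
    (hK : ∀ n (t : Set.Icc (-1 : ℝ) 1), (K n t : ℝ) = p n + r n * t) (hd : ∀ n, 1 ≤ d n)
    (hsig : Tendsto (fun n : ℕ => n * r n ^ 2 / p n) atTop atTop)
    (hlarge : (fun n => (n * r n ^ 2 / p n) ^ (3 / 4 : ℝ)) =o[atTop] fun n => (d n : ℝ)) :
    Tendsto (fun n => rggTV n (d n) (K n)) atTop (𝓝 0) := by
  set a : ℕ → ℝ := fun n => n * r n ^ 2 / p n with ha
  have ha0 : ∀ n, 0 ≤ a n := fun n => div_nonneg (by positivity) (hp n).1.le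
  have hδ0 : Tendsto (fun n => a n ^ (3 / 4 : ℝ) / d n) atTop (𝓝 0) := hlarge.tendsto_div_nhds_zero
  have hd0 : ∀ n, (0 : ℝ) < d n := fun n => Nat.cast_pos.2 (hd n)
  have hdtop : Tendsto (fun n => (d n : ℝ)) atTop atTop := by
    have h1 : Tendsto (fun n => a n ^ (3 / 4 : ℝ)) atTop atTop :=
      (tendsto_rpow_atTop (by norm_num)).comp hsig
    refine tendsto_atTop_mono' _ ?_ h1
    filter_upwards [hδ0.eventually_le_const zero_lt_one] with n hn
    exact (div_le_one (hd0 n)).1 hn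
  set t : ℕ → ℝ := fun n => (d n : ℝ) ^ (1 / 3 : ℝ) with ht
  have ht0 : ∀ n, 0 < t n := fun n => Real.rpow_pos_of_pos (hd0 n) _
  have ht1 : ∀ n, 1 ≤ t n := fun n => Real.one_le_rpow (Nat.one_le_cast.2 (hd n)) (by norm_num)
  have htd : ∀ n, (d n : ℝ) = t n ^ 3 := fun n => by
    rw [ht, ← Real.rpow_natCast, ← Real.rpow_mul (hd0 n).le]
    norm_num
  set ν : ℕ → ℝ := fun n => n * (r n ^ 2 / (p n * (1 - p n))) / t n ^ 4 with hν
  have hνeq : ∀ n, n * (r n ^ 2 / (p n * (1 - p n))) = ν n * t n ^ 4 := fun n =>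
    (div_mul_cancel₀ _ (pow_pos (ht0 n) 4).ne').symm
  have hp1 : ∀ n, 0 < p n * (1 - p n) := fun n =>
    mul_pos (hp n).1 (by linarith [(hp n).2])
  have hν0 : Tendsto ν atTop (𝓝 0) := by
    have h1 : Tendsto (fun n => 2 * (a n ^ (3 / 4 : ℝ) / d n) ^ (4 / 3 : ℝ)) atTop (𝓝 0) := by
      have := (hδ0.rpow_const (p := (4 / 3 : ℝ)) (Or.inr (by norm_num))).const_mul 2
      rwa [Real.zero_rpow (by norm_num), mul_zero] at this
    refine squeeze_zero (fun n => ?_) (fun n => ?_) h1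
    · exact div_nonneg (mul_nonneg (Nat.cast_nonneg n) (div_nonneg (sq_nonneg _) (hp1 n).le))
        (pow_pos (ht0 n) 4).le
    · have e1 : (a n ^ (3 / 4 : ℝ) / d n) ^ (4 / 3 : ℝ) = a n / t n ^ 4 := by
        rw [Real.div_rpow (Real.rpow_nonneg (ha0 n) _) (hd0 n).le, ← Real.rpow_mul (ha0 n), ht,
          ← Real.rpow_natCast (_ ^ (1 / 3 : ℝ)), ← Real.rpow_mul (hd0 n).le]
        norm_num
      rw [e1, ← mul_div_assoc]
      refine div_le_div_of_nonneg_right ?_ (pow_pos (ht0 n) 4).le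
      have hpn := (hp n).1
      have hpn2 := (hp n).2
      have h2 : r n ^ 2 / (p n * (1 - p n)) ≤ 2 * (r n ^ 2 / p n) := by
        rw [← mul_div_assoc, div_le_div_iff₀ (hp1 n) hpn]
        have : 0 ≤ r n ^ 2 * p n := by positivity
        nlinarith
      calc n * (r n ^ 2 / (p n * (1 - p n))) ≤ n * (2 * (r n ^ 2 / p n)) :=
            mul_le_mul_of_nonneg_left h2 (Nat.cast_nonneg n)
        _ = 2 * a n := by
            simp only [ha]
            ring
  refine tendsto_zero_of_le_truncated (B := energyBound) (C := 1040 + 8 * gaussianSqVar)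
    (fun n => tvDist_nonneg _ _) hν0 fun κ hκ => ?_
  have h3 : Tendsto (fun n => 2 ^ 17 * (κ * ν n ^ 3)) atTop (𝓝 0) := by
    simpa using ((hν0.pow 3).const_mul κ).const_mul (2 ^ 17)
  filter_upwards [eventually_gt_atTop 0, hdtop.eventually_ge_atTop gaussianSqVar,
    hν0.eventually_le_const zero_lt_one, h3.eventually_le_const zero_lt_one] with n hn hV hν1 hκν
  have : NeZero (d n) := ⟨by have := hd n; omega⟩
  exact rggTV_le_of_large_dimension hn (hp n).1 (hp n).2 (hr n).1.le (hr n).2 (hK n) hκ hV (ht1 n)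
    (htd n) (hνeq n) hν1 hκν

end Asymptotics

theorem mainTheorem5 (p r : ℕ → ℝ) (c : ℝ) (K : ℕ → RGGKernel)
    (hp : ∀ n, 0 < p n ∧ p n < 1 / 2)
    (hr : ∀ n, 0 < r n ∧ r n ≤ p n)
    (hc : 0 < c)
    (hrlow : ∀ᶠ n : ℕ in atTop, c * (Real.sqrt (p n / n) * Real.log n) ≤ r n)
    (hK : ∀ n (t : Set.Icc (-1 : ℝ) 1), (K n t : ℝ) = p n + r n * t) :
    IsCriticalDimension K (fun n => (n * r n ^ 2 / p n) ^ (3 / 4 : ℝ)) := by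
  have hsig := tendsto_signal_atTop (fun n => (hp n).1) hc hrlow
  exact ⟨fun _ hd hsmall => tendsto_rggTV_one hp hr hK hd hsig hsmall,
    fun _ hd hlarge => tendsto_rggTV_zero hp hr hK hd hsig hlarge⟩
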